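/- **Theorem 1.2.** Let $(\mu_j)_{j\in\mathbb N}$, $(\gamma_j)_{j\in\mathbb N}$, $(\nu_j)_{j\in\mathbb N}$ be three sequences of real random variables on a probability space, each i.i.d., independent of one another, with distributions of bounded support. For a finite interval $\Lambda$ of positive integers let $$H_\Lambda=-\sum_{j,\,j+1\in\Lambda}\mu_j\left[(1+\gamma_j)\sigma^x_j\sigma^x_{j+1}+(1-\gamma_j)\sigma^y_j\sigma^y_{j+1}\right]-\sum_{j\in\Lambda}\nu_j\sigma^z_j$$ be the XY Hamiltonian on $\mathcal H_\Lambda=\bigotimes_{j\in\Lambda}\mathbb C^2$, where $\sigma^{x},\sigma^y,\sigma^z$ are the Pauli matrices. Let $M=M^{(n)}$ be the $n\times n$ Hermitian block Jacobi matrix with $2\times2$ blocks $M_{jj}=-\nu_j\sigma^z$, $M_{j,j+1}=\mu_jS(\gamma_j)$, $M_{j+1,j}=\mu_jS(\gamma_j)^T$, and all other blocks zero, where $S(\gamma)=\begin{pmatrix}1&\gamma\\-\gamma&-1\end{pmatrix}$. Assume: 1. for every $n\ge1$, almost surely every eigenvalue of $H_{[1,n]}$ is simple; 2. there are $C>0$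 and $\beta>6$ such that for all $n\ge 1$ and $1\le j,k\le n$ $$\mathbb E\Big(\sup_{|g|\le1}\|g(M^{(n)})_{jk}\|\Big)\le\frac{C}{(1+|j-k|)^\beta},$$ where the supremum is over all Borel functions $g:\mathbb R\to\mathbb C$ of modulus at most $1$, $g(M^{(n)})_{jk}$ is the $(j,k)$-th $2\times2$ block of $g(M^{(n)})$, and $\|\cdot\|$ is the operator norm induced by the Euclidean norm on $\mathbb C^2$. For integers $1\le a\le b\le n$, $1\le m\le n$ and $1=r_0<r_1<\dots<r_m=n+1$, put $\Lambda_0=[a,b]$ and $\Lambda_k=[r_{k-1},r_k-1]$, $k=1,\dots,m$. For normalized eigenvectors $\psi_k$ of $H_{\Lambda_k}$ let $\rho=\bigotimes_{k=1}^m|\psi_k\rangle\langle\psi_k|$ and $\rho_t=e^{-itH_{[1,n]}}\rho\, e^{itH_{[1,n]}}$, and let $\mathcal E(\rho_t)=-\mathrm{Tr}\,\rho_t^1\log\rho_t^1$, where $\rho_t^1$ is the partial trace of $\rho_t$ over the sites in $[1,n]\setminus\Lambda_0$. Then there is a constant $C'<\infty$ such that $$\mathbb E\Big(\sup_{t,\,\{\psi_k\}}\mathcal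 E(\rho_t)\Big)\le C'$$ for all $n$, $m$, $a$, $b$ with $1\le a\le b\le n$, $1\le m\le n$ and all such decompositions $\Lambda_1,\dots,\Lambda_m$ of $[1,n]$. The supremum is over all $t\in\mathbb R$ and all normalized eigenvectors $\psi_k$ of $H_{\Lambda_k}$, $k=1,\dots,m$ (and is measurable up to null sets as a function of the disorder). -/

import Mathlib

open MeasureTheory ProbabilityTheory
open scoped Matrix ENNReal

namespace XYChain

noncomputable section

/-! ### Spin systems on finite sets of sites -/

/-- Basis labels of the space `⨂_{j ∈ Λ} ℂ²`: spin configurations on `Λ`; the value `0` is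
spin up `(1,0)ᵀ`, the value `1` is spin down `(0,1)ᵀ`. -/
abbrev Config (Λ : Finset ℕ) : Type := Λ → Fin 2

/-- Linear operators on `⨂_{j ∈ Λ} ℂ²`, as matrices in the product basis. -/
abbrev Op (Λ : Finset ℕ) : Type := Matrix (Config Λ) (Config Λ) ℂ

/-- The Pauli matrix `σˣ`. -/
def pauliX : Matrix (Fin 2) (Fin 2) ℂ := !![0, 1; 1, 0]

/-- The Pauli matrix `σʸ`. -/
def pauliY : Matrix (Fin 2) (Fin 2) ℂ := !![0, -Complex.I; Complex.I, 0]

/-- The Pauli matrix `σᶻ`. -/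
def pauliZ : Matrix (Fin 2) (Fin 2) ℂ := !![1, 0; 0, -1]

/-- The operator acting as `A` on the tensor factor `j` and as the identity on the others. -/
def siteOp {Λ : Finset ℕ} (j : Λ) (A : Matrix (Fin 2) (Fin 2) ℂ) : Op Λ :=
  Matrix.of fun s s' => if ∀ i, i ≠ j → s i = s' i then A (s j) (s' j) else 0

/-- The anisotropic XY Hamiltonian on the set of sites `Λ` (in the applications an interval),
`-∑_{j, j+1 ∈ Λ} μ_j [(1 + γ_j) σˣ_j σˣ_{j+1} + (1 - γ_j) σʸ_j σʸ_{j+1}] - ∑_{j ∈ Λ} ν_j σᶻ_j`. -/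
def hamiltonian (Λ : Finset ℕ) (μ γ ν : ℕ → ℝ) : Op Λ :=
  -(∑ j : Λ, ∑ k : Λ,
      if (k : ℕ) = j + 1 then
        (μ j : ℂ) • ((1 + γ j : ℂ) • (siteOp j pauliX * siteOp k pauliX) +
          (1 - γ j : ℂ) • (siteOp j pauliY * siteOp k pauliY))
      else 0) -
    ∑ j : Λ, (ν j : ℂ) • siteOp j pauliZ

/-- All eigenspaces of `H` are at most one-dimensional. -/
def HasSimpleSpectrum {Λ : Finset ℕ} (H : Op Λ) : Prop :=
  ∀ E : ℂ, Module.finrank ℂ (Module.End.eigenspace (Matrix.toLin' H) E) ≤ 1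

/-- `ψ` is a normalized eigenvector of `H`. -/
def IsEigenstate {Λ : Finset ℕ} (H : Op Λ) (ψ : Config Λ → ℂ) : Prop :=
  star ψ ⬝ᵥ ψ = 1 ∧ ∃ E : ℂ, H *ᵥ ψ = E • ψ

/-- The rank-one operator `|ψ⟩⟨ψ|`. -/
def pureState {Λ : Finset ℕ} (ψ : Config Λ → ℂ) : Op Λ :=
  Matrix.vecMulVec ψ (star ψ)

/-- The Schrödinger evolution `e^{-itH} ρ e^{itH}`. -/
def evolve {Λ : Finset ℕ} (H : Op Λ) (t : ℝ) (ρ : Op Λ) : Op Λ :=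
  NormedSpace.exp ((-(Complex.I * t)) • H) * ρ * NormedSpace.exp ((Complex.I * t) • H)

/-! ### Entanglement entropy -/

/-- For `Λ₀ ⊆ Λ`, the configuration on `Λ` that is `s` on `Λ₀` and `u` on `Λ \ Λ₀`. -/
def glue {Λ Λ₀ : Finset ℕ} (s : Config Λ₀) (u : Config (Λ \ Λ₀)) : Config Λ :=
  fun j => if h : (j : ℕ) ∈ Λ₀ then s ⟨j, h⟩ else u ⟨j, Finset.mem_sdiff.2 ⟨j.2, h⟩⟩

/-- For `Λ₀ ⊆ Λ`, the partial trace over the spins in `Λ \ Λ₀`. -/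
def partialTrace {Λ : Finset ℕ} (Λ₀ : Finset ℕ) (ρ : Op Λ) : Op Λ₀ :=
  Matrix.of fun s s' => ∑ u : Config (Λ \ Λ₀), ρ (glue s u) (glue s' u)

/-- The von Neumann entropy `-Tr (ρ log ρ)`, with `0 log 0 = 0`. -/
def vonNeumannEntropy {Λ : Finset ℕ} (ρ : Op Λ) : ℝ :=
  (Matrix.trace (cfc Real.negMulLog ρ)).re

/-- The entanglement entropy of `ρ` with respect to the decomposition of `Λ` into `Λ₀ ⊆ Λ` and
`Λ \ Λ₀`. -/
def entanglement {Λ : Finset ℕ} (Λ₀ : Finset ℕ) (ρ : Op Λ) : ℝ :=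
  vonNeumannEntropy (partialTrace Λ₀ ρ)

/-! ### Decompositions of the chain and product states -/

/-- A decomposition of the chain `{0, …, n - 1}` into `m` consecutive nonempty intervals
`{r_k, …, r_{k+1} - 1}`, `0 ≤ k < m`. -/
structure Decomposition (n m : ℕ) where
  /-- The endpoints of the intervals. -/
  r : Fin (m + 1) → ℕ
  strictMono : StrictMono r
  first : r 0 = 0
  last : r (Fin.last m) = n

/-- The `k`-th interval of the decomposition. -/
def Decomposition.block {n m : ℕ} (d : Decomposition n m) (k : Fin m) : Finset ℕ :=
  Finset.Ico (d.r k.castSucc) (d.r k.succ)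

theorem Decomposition.block_subset {n m : ℕ} (d : Decomposition n m) (k : Fin m) :
    d.block k ⊆ Finset.range n := by
  intro j hj
  have h1 := (Finset.mem_Ico.1 hj).2
  have h2 : d.r k.succ ≤ d.r (Fin.last m) := d.strictMono.monotone (Fin.le_last _)
  rw [d.last] at h2
  exact Finset.mem_range.2 (lt_of_lt_of_le h1 h2)

/-- The tensor product `⨂_k ρ_k` of operators on the blocks of a decomposition. -/
def productState {n m : ℕ} (d : Decomposition n m) (ρ : ∀ k, Op (d.block k)) :
    Op (Finset.range n) :=
  Matrix.of fun s s' => ∏ k, ρ k (Finset.restrict₂ (π := fun _ => Fin 2) (d.block_subset k) s)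
    (Finset.restrict₂ (π := fun _ => Fin 2) (d.block_subset k) s')

/-- The supremum, over all times and all choices of normalized eigenstates `ψ_k` of the
restrictions of the Hamiltonian to the blocks, of the entanglement entropy with respect to `Λ₀`
of the time evolution of `⨂_k |ψ_k⟩⟨ψ_k|` under the Hamiltonian of the full chain. -/
def supEntanglement {n m : ℕ} (d : Decomposition n m) (Λ₀ : Finset ℕ) (μ γ ν : ℕ → ℝ) : ℝ≥0∞ :=
  ⨆ (t : ℝ) (ψ : ∀ k, Config (d.block k) → ℂ)
    (_ : ∀ k, IsEigenstate (hamiltonian (d.block k) μ γ ν) (ψ k)),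
    ENNReal.ofReal (entanglement Λ₀
      (evolve (hamiltonian (Finset.range n) μ γ ν) t (productState d fun k => pureState (ψ k))))

/-! ### The effective one-particle Hamiltonian and its eigencorrelators -/

/-- The `2 × 2` matrix `S(γ)`. -/
def couplingBlock (γ : ℝ) : Matrix (Fin 2) (Fin 2) ℂ := !![1, (γ : ℂ); -(γ : ℂ), -1]

/-- The `2 × 2` blocks of the effective one-particle Hamiltonian. -/
def effectiveBlock (μ γ ν : ℕ → ℝ) (j k : ℕ) : Matrix (Fin 2) (Fin 2) ℂ :=
  if j = k then -(ν j : ℂ) • pauliZ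
  else if k = j + 1 then (μ j : ℂ) • couplingBlock (γ j)
  else if j = k + 1 then (μ k : ℂ) • (couplingBlock (γ k))ᵀ
  else 0

/-- The effective one-particle Hamiltonian `M`, a block Jacobi matrix with `2 × 2` blocks. -/
def effectiveHamiltonian (Λ : Finset ℕ) (μ γ ν : ℕ → ℝ) :
    Matrix (Λ × Fin 2) (Λ × Fin 2) ℂ :=
  Matrix.of fun p q => effectiveBlock μ γ ν p.1 q.1 p.2 q.2

theorem effectiveBlock_conjTranspose (μ γ ν : ℕ → ℝ) (j k : ℕ) :
    (effectiveBlock μ γ ν j k)ᴴ = effectiveBlock μ γ ν k j := by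
  unfold effectiveBlock
  split_ifs <;> first
    | omega
    | (subst_vars; ext x y; fin_cases x <;> fin_cases y <;>
        simp [pauliZ, couplingBlock])

theorem effectiveHamiltonian_isHermitian (Λ : Finset ℕ) (μ γ ν : ℕ → ℝ) :
    (effectiveHamiltonian Λ μ γ ν).IsHermitian := by
  ext p q
  have h := congrFun (congrFun (effectiveBlock_conjTranspose μ γ ν q.1 p.1) p.2) q.2
  simpa [effectiveHamiltonian, Matrix.conjTranspose_apply] using h

/-- The functional calculus of a Hermitian matrix: `g(A) = U diag(g(λ_i)) U*` where
`A = U diag(λ_i) U*`. -/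
def functionOf {ι : Type*} [Fintype ι] [DecidableEq ι] {A : Matrix ι ι ℂ} (hA : A.IsHermitian)
    (g : ℝ → ℂ) : Matrix ι ι ℂ :=
  (hA.eigenvectorUnitary : Matrix ι ι ℂ) * Matrix.diagonal (fun i => g (hA.eigenvalues i)) *
    star (hA.eigenvectorUnitary : Matrix ι ι ℂ)

/-- The eigencorrelator `sup_{|g| ≤ 1} ‖g(M)_{jk}‖`: the supremum is over all Borel functions
`g : ℝ → ℂ` of modulus at most `1`, and the norm of the `2 × 2` block is the operator norm for the
Euclidean norm on `ℂ²`. -/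
def eigencorrelator (Λ : Finset ℕ) (μ γ ν : ℕ → ℝ) (j k : Λ) : ℝ≥0∞ :=
  ⨆ (g : ℝ → ℂ) (_ : Measurable g) (_ : ∀ x, ‖g x‖ ≤ 1),
    ENNReal.ofReal ‖Matrix.toEuclideanCLM (n := Fin 2) (𝕜 := ℂ)
      (Matrix.of fun x y =>
        functionOf (effectiveHamiltonian_isHermitian Λ μ γ ν) g (j, x) (k, y))‖

/-- Eigencorrelator localization with decay function `F`, uniformly in the length of the chain. -/
def EigencorrelatorLocalization {Ω : Type*} [MeasurableSpace Ω] (P : Measure Ω)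
    (μ γ ν : ℕ → Ω → ℝ) (F : ℝ → ℝ) : Prop :=
  ∀ (n : ℕ) (j k : Finset.range n),
    ∫⁻ ω, eigencorrelator (Finset.range n) (fun i => μ i ω) (fun i => γ i ω) (fun i => ν i ω)
        j k ∂P
      ≤ ENNReal.ofReal (F |((j : ℕ) : ℝ) - ((k : ℕ) : ℝ)|)

end

end XYChain

open MeasureTheory ProbabilityTheory
open scoped Matrix ENNReal

namespace XYChain

noncomputable section

/-! ### Site operators -/

/-! The Jordan-Wigner transformation turns the chain into free fermions. `hamiltonian_eq` writes H
as the bilinear form ∑ M_pq c_p* c_q with M the effective Hamiltonian, and by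
`hamiltonian_comm_fermi` the commutator of H with a linear combination of the c_p amounts to the
action of 2M on its coefficients. The problem thus becomes one about matrices whose size grows only
linearly in the length of the chain.

Simplicity of the spectrum makes every eigenvector of H quasi-free. Operators commuting with H act
on an eigenvector as scalars; applied to bilinears in modes this shows that each mode is occupied or
empty and that modes of equal energy are occupied alike, while parity excludes zero modes. So the
one-particle projection is 1_S(M) for a Borel set S, even if M is degenerate
(`exists_isVacuum_of_eigenstate`). Products over blocks have the direct sum of these projections
(`isVacuum_productVector`), and time evolution conjugates it by W = e^{-2itM}
(`IsVacuum.propagate`).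

The entropy of the reduced state is bounded without Wick's theorem. Its covariance matrix Γ is the
compression to Λ₀ of a projection P. Subadditivity over the modes that diagonalize Γ
(`entropy_le_sum_modes`), the bound 4√(ξ(1-ξ)) for the binary entropy, and Peierls' inequality
(`sum_sqrt_le_sum_sqrt_diag`) leave only the diagonal of Γ - Γ². As P² = P, its entries are the sums
of |P_pq|² over q outside Λ₀, so the entropy is at most 2 ∑ |P_pq| over p inside and q outside
(`entanglement_pureState_le`).

The entries of P = W P₀ W* are dominated by sums of products of three eigencorrelators, uniformly in
t and in the eigenvectors (`supEntanglement_le`). The factors may be cut off at 1, so the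
expectation of the product decays with exponent β/3 in each of the three distances
(`lintegral_mul_mul_le`). A path from inside to outside crosses the boundary in one of its three
steps (`sum_boundary_le`), and the pairs separated by the boundary have bounded total weight because
β/3 > 2. The hypotheses, given for initial intervals, pass to the blocks by stationarity of the
disorder (`map_translate_eq`); this is one use of measurability in the parameters. -/

theorem siteOp_apply {Λ : Finset ℕ} (j : Λ) (A : Matrix (Fin 2) (Fin 2) ℂ) (s s' : Config Λ) :
    siteOp j A s s' = if ∀ i, i ≠ j → s i = s' i then A (s j) (s' j) else 0 := rfl

/-- Only configurations that agree with `s` away from `j` contribute. Together with `ext_mulVec`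
this reduces operator identities to sums over one or two spins. -/
theorem siteOp_mulVec {Λ : Finset ℕ} (j : Λ) (A : Matrix (Fin 2) (Fin 2) ℂ) (v : Config Λ → ℂ)
    (s : Config Λ) :
    (siteOp j A *ᵥ v) s = ∑ x, A (s j) x * v (Function.update s j x) := by
  simp only [Matrix.mulVec, dotProduct, siteOp_apply, ite_mul, zero_mul]
  rw [← Finset.sum_filter]
  refine Finset.sum_bij' (fun s' _ => s' j) (fun x _ => Function.update s j x) ?_ ?_ ?_ ?_ ?_
  · simp
  · intro x _
    simp only [Finset.mem_filter, Finset.mem_univ, true_and]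
    intro i hi
    rw [Function.update_of_ne hi]
  · intro s' hs'
    simp only [Finset.mem_filter, Finset.mem_univ, true_and] at hs'
    funext i
    by_cases hi : i = j
    · subst hi; simp
    · rw [Function.update_of_ne hi, hs' i hi]
  · simp
  · intro s' hs'
    simp only [Finset.mem_filter, Finset.mem_univ, true_and] at hs'
    congr 2
    funext i
    by_cases hi : i = j
    · subst hi; simp
    · rw [Function.update_of_ne hi, hs' i hi]

theorem ext_mulVec {ι : Type*} [Fintype ι] [DecidableEq ι] {A B : Matrix ι ι ℂ}
    (h : ∀ v i, (A *ᵥ v) i = (B *ᵥ v) i) : A = B := by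
  ext i j
  simpa using h (Pi.single j 1) i

theorem siteOp_mul {Λ : Finset ℕ} (j : Λ) (A B : Matrix (Fin 2) (Fin 2) ℂ) :
    siteOp j A * siteOp j B = siteOp j (A * B) := by
  refine ext_mulVec fun v s => ?_
  simp [← Matrix.mulVec_mulVec, siteOp_mulVec, Matrix.mul_apply]
  ring

theorem siteOp_comm {Λ : Finset ℕ} {j k : Λ} (h : j ≠ k) (A B : Matrix (Fin 2) (Fin 2) ℂ) :
    siteOp j A * siteOp k B = siteOp k B * siteOp j A := by
  refine ext_mulVec fun v s => ?_
  simp only [← Matrix.mulVec_mulVec, siteOp_mulVec, Function.update_of_ne h,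
    Function.update_of_ne h.symm, Finset.mul_sum]
  rw [Finset.sum_comm]
  refine Finset.sum_congr rfl fun x _ => Finset.sum_congr rfl fun y _ => ?_
  rw [Function.update_comm h]
  ring

theorem siteOp_one {Λ : Finset ℕ} (j : Λ) : siteOp j (1 : Matrix (Fin 2) (Fin 2) ℂ) = 1 := by
  refine ext_mulVec fun v s => ?_
  simp [siteOp_mulVec, Matrix.one_apply]

theorem siteOp_add {Λ : Finset ℕ} (j : Λ) (A B : Matrix (Fin 2) (Fin 2) ℂ) :
    siteOp j (A + B) = siteOp j A + siteOp j B := by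
  ext s s'
  simp only [siteOp_apply, Matrix.add_apply]
  split_ifs <;> simp

theorem siteOp_smul {Λ : Finset ℕ} (j : Λ) (c : ℂ) (A : Matrix (Fin 2) (Fin 2) ℂ) :
    siteOp j (c • A) = c • siteOp j A := by
  ext s s'
  simp only [siteOp_apply, Matrix.smul_apply]
  split_ifs <;> simp

theorem siteOp_zero {Λ : Finset ℕ} (j : Λ) : siteOp j (0 : Matrix (Fin 2) (Fin 2) ℂ) = 0 := by
  simpa using siteOp_smul j 0 0

theorem siteOp_conjTranspose {Λ : Finset ℕ} (j : Λ) (A : Matrix (Fin 2) (Fin 2) ℂ) :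
    (siteOp j A)ᴴ = siteOp j Aᴴ := by
  ext s s'
  simp only [Matrix.conjTranspose_apply, siteOp_apply]
  by_cases h : ∀ i, i ≠ j → s i = s' i
  · rw [if_pos h, if_pos fun i hi => (h i hi).symm]
  · rw [if_neg h, if_neg fun h' => h fun i hi => (h' i hi).symm, star_zero]

/-! ### Parity operators -/

/-- The eigenvalue of `σᶻ`. -/
def spinSign (x : Fin 2) : ℂ := if x = 0 then 1 else -1

theorem spinSign_mul_self (x : Fin 2) : spinSign x * spinSign x = 1 := by
  unfold spinSign; split_ifs <;> norm_num

theorem spinSign_of_ne {x y : Fin 2} (h : x ≠ y) : spinSign x = -spinSign y := by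
  revert h; fin_cases x <;> fin_cases y <;> simp [spinSign]

/-- The operator `∏_{i ∈ T} σᶻ_i`. -/
def parityOp {Λ : Finset ℕ} (T : Finset Λ) : Op Λ :=
  Matrix.diagonal fun s => ∏ i ∈ T, spinSign (s i)

theorem parityOp_mul_self {Λ : Finset ℕ} (T : Finset Λ) : parityOp T * parityOp T = 1 := by
  simp [parityOp, ← Finset.prod_mul_distrib, spinSign_mul_self]

theorem parityOp_comm {Λ : Finset ℕ} (T U : Finset Λ) :
    parityOp T * parityOp U = parityOp U * parityOp T := by
  simp [parityOp, mul_comm]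

theorem parityOp_conjTranspose {Λ : Finset ℕ} (T : Finset Λ) : (parityOp T)ᴴ = parityOp T := by
  unfold parityOp
  rw [Matrix.diagonal_conjTranspose]
  congr 1
  funext s
  simp only [Pi.star_apply, star_prod]
  refine Finset.prod_congr rfl fun i _ => ?_
  unfold spinSign; split_ifs <;> simp

theorem parityOp_disjUnion {Λ : Finset ℕ} {T U : Finset Λ} (h : Disjoint T U) :
    parityOp (T ∪ U) = parityOp T * parityOp U := by
  simp [parityOp, Finset.prod_union h]

theorem parityOp_singleton {Λ : Finset ℕ} (j : Λ) : parityOp {j} = siteOp j pauliZ := by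
  refine ext_mulVec fun v s => ?_
  simp only [parityOp, Matrix.mulVec_diagonal, siteOp_mulVec, Finset.prod_singleton]
  have h : ∀ x, s j = x → Function.update s j x = s := by rintro x rfl; simp
  rcases Fin.exists_fin_two.1 ⟨s j, rfl⟩ with hx | hx <;>
    simp [hx, spinSign, pauliZ, h _ hx]

theorem parityOp_commute_siteOp {Λ : Finset ℕ} {T : Finset Λ} {j : Λ} (h : j ∉ T)
    (A : Matrix (Fin 2) (Fin 2) ℂ) : parityOp T * siteOp j A = siteOp j A * parityOp T := by
  ext s s'
  simp only [parityOp, Matrix.diagonal_mul, Matrix.mul_diagonal, siteOp_apply]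
  split_ifs with hs
  · rw [mul_comm]
    congr 1
    exact Finset.prod_congr rfl fun i hi => by rw [hs i (fun e => h (e ▸ hi))]
  · simp

/-- A matrix with zero diagonal flips the spin at `j`, which reverses exactly one factor of the
parity. -/
theorem parityOp_anticommute_siteOp {Λ : Finset ℕ} {T : Finset Λ} {j : Λ} (h : j ∈ T)
    {A : Matrix (Fin 2) (Fin 2) ℂ} (hA : ∀ x, A x x = 0) :
    parityOp T * siteOp j A = -(siteOp j A * parityOp T) := by
  ext s s'
  simp only [parityOp, Matrix.diagonal_mul, Matrix.mul_diagonal, Matrix.neg_apply, siteOp_apply]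
  split_ifs with hs
  · by_cases e : s j = s' j
    · rw [e, hA]; simp
    · rw [mul_comm, ← mul_neg]
      congr 1
      rw [← Finset.mul_prod_erase T _ h, ← Finset.mul_prod_erase T _ h, spinSign_of_ne e, neg_mul]
      congr 2
      exact Finset.prod_congr rfl fun i hi => by rw [hs i (Finset.ne_of_mem_erase hi)]
  · simp

/-! ### The Jordan-Wigner transformation -/

/-- The sites to the left of `j`. -/
def sitesBelow {Λ : Finset ℕ} (j : Λ) : Finset Λ := Finset.univ.filter (· < j)

theorem mem_sitesBelow {Λ : Finset ℕ} {i j : Λ} : i ∈ sitesBelow j ↔ i < j := by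
  simp [sitesBelow]

/-- The lowering operator (`x = 0`) and the raising operator (`x = 1`) of a spin. -/
def ladder (x : Fin 2) : Matrix (Fin 2) (Fin 2) ℂ :=
  if x = 0 then !![0, 0; 1, 0] else !![0, 1; 0, 0]

theorem ladder_diag (x y : Fin 2) : ladder x y y = 0 := by
  fin_cases x <;> fin_cases y <;> simp [ladder]

theorem ladder_conjTranspose (x : Fin 2) : (ladder x)ᴴ = ladder x.rev := by
  fin_cases x <;> ext a b <;> fin_cases a <;> fin_cases b <;> simp [ladder]

theorem ladder_anticomm (x y : Fin 2) :
    ladder x * ladder y + ladder y * ladder x = if y = x.rev then 1 else 0 := by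
  fin_cases x <;> fin_cases y <;> ext a b <;> fin_cases a <;> fin_cases b <;> simp [ladder]

/-- The Jordan-Wigner operators: `fermi (j, 0)` annihilates, `fermi (j, 1)` creates, the fermion
`j`. -/
def fermi {Λ : Finset ℕ} (p : Λ × Fin 2) : Op Λ :=
  parityOp (sitesBelow p.1) * siteOp p.1 (ladder p.2)

/-- The particle-hole involution of the labels of the Jordan-Wigner operators. -/
def bar {ι : Type*} (p : ι × Fin 2) : ι × Fin 2 := (p.1, p.2.rev)

theorem bar_bar {ι : Type*} (p : ι × Fin 2) : bar (bar p) = p := by simp [bar]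

/-- The particle-hole involution as a permutation. -/
def barEquiv (ι : Type*) : ι × Fin 2 ≃ ι × Fin 2 := ⟨bar, bar, bar_bar, bar_bar⟩

theorem parityOp_sitesBelow_comm_siteOp {Λ : Finset ℕ} (j : Λ) (A : Matrix (Fin 2) (Fin 2) ℂ) :
    parityOp (sitesBelow j) * siteOp j A = siteOp j A * parityOp (sitesBelow j) :=
  parityOp_commute_siteOp (by simp [mem_sitesBelow]) A

theorem fermi_conjTranspose {Λ : Finset ℕ} (p : Λ × Fin 2) : (fermi p)ᴴ = fermi (bar p) := by
  rw [fermi, Matrix.conjTranspose_mul, parityOp_conjTranspose, siteOp_conjTranspose,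
    ladder_conjTranspose, ← parityOp_sitesBelow_comm_siteOp]
  rfl

/-- The string of the right-hand operator contains the left-hand site and gives one sign; the string
of the left-hand operator misses the right-hand site and gives none. -/
theorem fermi_anticomm_of_lt {Λ : Finset ℕ} {p q : Λ × Fin 2} (h : p.1 < q.1) :
    fermi p * fermi q = -(fermi q * fermi p) := by
  unfold fermi
  set S := parityOp (sitesBelow p.1)
  set T := parityOp (sitesBelow q.1)
  set a := siteOp p.1 (ladder p.2)
  set b := siteOp q.1 (ladder q.2)
  have h1 : T * a = -(a * T) :=
    parityOp_anticommute_siteOp (mem_sitesBelow.2 h) (ladder_diag p.2)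
  have h2 : S * b = b * S :=
    parityOp_commute_siteOp (by simpa [mem_sitesBelow] using h.le) _
  have h3 : a * b = b * a := siteOp_comm h.ne _ _
  have h4 : S * T = T * S := parityOp_comm _ _
  calc S * a * (T * b) = S * (a * T) * b := by noncomm_ring
    _ = -(S * T * (a * b)) := by rw [← neg_eq_iff_eq_neg.2 h1]; noncomm_ring
    _ = -(T * (S * b) * a) := by rw [h4, h3]; noncomm_ring
    _ = -(T * b * (S * a)) := by rw [h2]; noncomm_ring

/-- As `bar` exchanges annihilators and creators, this single relation contains all the canonical
anticommutation relations. -/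
theorem fermi_anticomm {Λ : Finset ℕ} (p q : Λ × Fin 2) :
    fermi p * fermi q + fermi q * fermi p = if q = bar p then 1 else 0 := by
  rcases lt_trichotomy p.1 q.1 with h | h | h
  · rw [fermi_anticomm_of_lt h, neg_add_cancel, if_neg]
    rintro rfl; exact lt_irrefl _ h
  · obtain ⟨j, x⟩ := p
    obtain ⟨k, y⟩ := q
    obtain rfl : j = k := h
    have key : ∀ x y : Fin 2, (fermi (j, x) * fermi (j, y) : Op Λ) =
        siteOp j (ladder x * ladder y) := by
      intro x y
      simp only [fermi]
      rw [parityOp_sitesBelow_comm_siteOp j (ladder x), mul_assoc,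
        ← mul_assoc (parityOp _) (parityOp _), parityOp_mul_self, one_mul, siteOp_mul]
    rw [key, key, ← siteOp_add, ladder_anticomm]
    by_cases e : y = x.rev
    · simp [e, bar, siteOp_one]
    · simp [e, bar, siteOp_zero]
  · rw [fermi_anticomm_of_lt h, add_neg_cancel, if_neg]
    rintro rfl; exact lt_irrefl _ h

theorem parityOp_univ_mul_fermi {Λ : Finset ℕ} (p : Λ × Fin 2) :
    parityOp Finset.univ * fermi p = -(fermi p * parityOp Finset.univ) := by
  rw [fermi, ← mul_assoc, parityOp_comm, mul_assoc,
    parityOp_anticommute_siteOp (Finset.mem_univ _) (ladder_diag p.2)]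
  noncomm_ring

theorem fermi_mul_fermi_same {Λ : Finset ℕ} (j : Λ) (x y : Fin 2) :
    (fermi (j, x) * fermi (j, y) : Op Λ) = siteOp j (ladder x * ladder y) := by
  simp only [fermi]
  rw [parityOp_sitesBelow_comm_siteOp j (ladder x), mul_assoc,
    ← mul_assoc (parityOp _) (parityOp _), parityOp_mul_self, one_mul, siteOp_mul]

theorem sitesBelow_succ {Λ : Finset ℕ} {j k : Λ} (h : (k : ℕ) = j + 1) :
    sitesBelow k = sitesBelow j ∪ {j} := by
  ext i
  simp only [mem_sitesBelow, Finset.mem_union, Finset.mem_singleton, ← Subtype.coe_lt_coe,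
    Subtype.ext_iff]
  omega

theorem parityOp_sitesBelow_succ {Λ : Finset ℕ} {j k : Λ} (h : (k : ℕ) = j + 1) :
    parityOp (sitesBelow k) = parityOp (sitesBelow j) * siteOp j pauliZ := by
  rw [sitesBelow_succ h, parityOp_disjUnion, parityOp_singleton]
  simp [mem_sitesBelow]

theorem ne_of_succ {Λ : Finset ℕ} {j k : Λ} (h : (k : ℕ) = j + 1) : j ≠ k := by
  rintro rfl; omega

/-- The strings of neighbouring sites cancel up to one σᶻ at the left site. This is why a
nearest-neighbour spin interaction is a local fermionic bilinear. -/
theorem fermi_mul_fermi_succ {Λ : Finset ℕ} {j k : Λ} (h : (k : ℕ) = j + 1) (x y : Fin 2) :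
    fermi (j, x) * fermi (k, y) = siteOp j (ladder x * pauliZ) * siteOp k (ladder y) := by
  simp only [fermi]
  rw [parityOp_sitesBelow_succ h, parityOp_sitesBelow_comm_siteOp j (ladder x),
    mul_assoc, ← mul_assoc (parityOp _) (_ * _), ← mul_assoc (parityOp _) (parityOp _),
    parityOp_mul_self, one_mul, ← mul_assoc, siteOp_mul]

theorem fermi_succ_mul_fermi {Λ : Finset ℕ} {j k : Λ} (h : (k : ℕ) = j + 1) (x y : Fin 2) :
    fermi (k, x) * fermi (j, y) = siteOp j (pauliZ * ladder y) * siteOp k (ladder x) := by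
  simp only [fermi]
  rw [parityOp_sitesBelow_comm_siteOp, parityOp_sitesBelow_succ h,
    parityOp_sitesBelow_comm_siteOp j pauliZ, mul_assoc, mul_assoc (siteOp j _),
    ← mul_assoc (parityOp _) (parityOp _), parityOp_mul_self, one_mul, siteOp_mul,
    siteOp_comm (ne_of_succ h).symm]

theorem pauliX_eq : pauliX = ladder 0 + ladder 1 := by
  ext a b; fin_cases a <;> fin_cases b <;> simp [pauliX, ladder]

theorem pauliY_eq : pauliY = Complex.I • ladder 0 + (-Complex.I) • ladder 1 := by
  ext a b; fin_cases a <;> fin_cases b <;> simp [pauliY, ladder]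

theorem ladder_mul_pauliZ (x : Fin 2) : ladder x * pauliZ = spinSign x • ladder x := by
  fin_cases x <;> ext a b <;> fin_cases a <;> fin_cases b <;> simp [pauliZ, ladder, spinSign]

theorem pauliZ_mul_ladder (x : Fin 2) : pauliZ * ladder x = -spinSign x • ladder x := by
  fin_cases x <;> ext a b <;> fin_cases a <;> fin_cases b <;> simp [pauliZ, ladder, spinSign]

theorem bond_eq {Λ : Finset ℕ} {j k : Λ} (h : (k : ℕ) = j + 1) (γ : ℝ) :
    (∑ x, ∑ y, couplingBlock γ x y • ((fermi (j, x))ᴴ * fermi (k, y))) +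
      (∑ x, ∑ y, (couplingBlock γ)ᵀ x y • ((fermi (k, x))ᴴ * fermi (j, y))) =
    -((1 + γ : ℂ) • (siteOp j pauliX * siteOp k pauliX) +
          (1 - γ : ℂ) • (siteOp j pauliY * siteOp k pauliY)) := by
  simp only [fermi_conjTranspose, bar, fermi_mul_fermi_succ h, fermi_succ_mul_fermi h,
    ladder_mul_pauliZ, pauliZ_mul_ladder, pauliX_eq, pauliY_eq, siteOp_add, siteOp_smul,
    Fin.sum_univ_two, couplingBlock, spinSign, Matrix.transpose_apply]
  simp only [add_mul, mul_add, smul_mul_assoc, mul_smul_comm, smul_add, smul_smul]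
  simp
  simp only [← Complex.coe_smul]
  module

theorem field_eq {Λ : Finset ℕ} (j : Λ) :
    (∑ x, ∑ y, pauliZ x y • ((fermi (j, x))ᴴ * fermi (j, y))) = siteOp j pauliZ := by
  simp only [fermi_conjTranspose, bar, fermi_mul_fermi_same, ← siteOp_smul, ← siteOp_add,
    Fin.sum_univ_two]
  congr 1
  ext a b
  fin_cases a <;> fin_cases b <;> simp [pauliZ, ladder]

theorem effectiveBlock_eq (μ γ ν : ℕ → ℝ) (j k : ℕ) :
    effectiveBlock μ γ ν j k = (if j = k then -(ν j : ℂ) • pauliZ else 0) +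
      ((if k = j + 1 then (μ j : ℂ) • couplingBlock (γ j) else 0) +
      (if j = k + 1 then (μ k : ℂ) • (couplingBlock (γ k))ᵀ else 0)) := by
  unfold effectiveBlock
  split_ifs <;> first | omega | simp

/-- The spin Hamiltonian is quadratic in the fermions: diagonal blocks of M give the field terms
(`field_eq`), and the two off-diagonal blocks of a bond together give its interaction (`bond_eq`).
-/
theorem hamiltonian_eq (Λ : Finset ℕ) (μ γ ν : ℕ → ℝ) :
    hamiltonian Λ μ γ ν =
      ∑ p, ∑ q, effectiveHamiltonian Λ μ γ ν p q • ((fermi p)ᴴ * fermi q) := by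
  set F : Λ → Λ → Matrix (Fin 2) (Fin 2) ℂ → Op Λ := fun j k A =>
    ∑ x, ∑ y, A x y • ((fermi (j, x))ᴴ * fermi (k, y)) with hF
  have hadd : ∀ j k A B, F j k (A + B) = F j k A + F j k B := by
    intro j k A B
    simp only [hF, Matrix.add_apply, add_smul, Finset.sum_add_distrib]
  have hsmul : ∀ j k (c : ℂ) A, F j k (c • A) = c • F j k A := by
    intro j k c A
    simp only [hF, Matrix.smul_apply, smul_eq_mul, mul_smul, Finset.smul_sum]
  have hzero : ∀ j k, F j k 0 = 0 := by intro j k; simp [hF]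
  have h1 : ∑ p, ∑ q, effectiveHamiltonian Λ μ γ ν p q • ((fermi p)ᴴ * fermi q) =
      ∑ j : Λ, ∑ k : Λ, F j k (effectiveBlock μ γ ν j k) := by
    simp only [Fintype.sum_prod_type, hF, effectiveHamiltonian, Matrix.of_apply]
    refine Finset.sum_congr rfl fun j _ => ?_
    rw [Finset.sum_comm]
  have hite : ∀ j k (c : Prop) [Decidable c] A, F j k (if c then A else 0) =
      if c then F j k A else 0 := by
    intro j k c _ A; split_ifs <;> simp [hzero]
  rw [h1]
  simp only [effectiveBlock_eq, hadd, hite, hsmul, Finset.sum_add_distrib]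
  rw [Finset.sum_comm (f := fun (j : Λ) (k : Λ) =>
    if (j : ℕ) = k + 1 then (μ k : ℂ) • F j k (couplingBlock (γ k))ᵀ else 0)]
  rw [hamiltonian, ← Finset.sum_add_distrib, sub_eq_add_neg, add_comm]
  congr 1
  · rw [← Finset.sum_neg_distrib]
    refine Finset.sum_congr rfl fun j _ => ?_
    simp only [← Subtype.ext_iff, Finset.sum_ite_eq, Finset.mem_univ, if_true, neg_smul]
    rw [← field_eq j]
  · rw [← Finset.sum_neg_distrib]
    refine Finset.sum_congr rfl fun j _ => ?_
    rw [← Finset.sum_neg_distrib, ← Finset.sum_add_distrib]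
    refine Finset.sum_congr rfl fun k _ => ?_
    split_ifs with h
    · rw [← smul_add, ← smul_neg]
      congr 1
      exact (bond_eq h _).symm
    · simp

/-- Particle-hole symmetry of M: reversing both indices changes the sign of `pauliZ` and of
`couplingBlock`. -/
theorem effectiveHamiltonian_bar (Λ : Finset ℕ) (μ γ ν : ℕ → ℝ) (p q : Λ × Fin 2) :
    effectiveHamiltonian Λ μ γ ν (bar p) (bar q) = -effectiveHamiltonian Λ μ γ ν q p := by
  have h2 : ∀ (j k : ℕ) (x y : Fin 2), effectiveBlock μ γ ν j k x.rev y.rev =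
      -effectiveBlock μ γ ν k j y x := by
    intro j k x y
    unfold effectiveBlock
    split_ifs <;> first
      | omega
      | (subst_vars; fin_cases x <;> fin_cases y <;> simp [pauliZ, couplingBlock])
  exact h2 _ _ _ _

theorem effectiveHamiltonian_star (Λ : Finset ℕ) (μ γ ν : ℕ → ℝ) (p q : Λ × Fin 2) :
    star (effectiveHamiltonian Λ μ γ ν p q) = effectiveHamiltonian Λ μ γ ν q p :=
  (effectiveHamiltonian_isHermitian Λ μ γ ν).apply q p

theorem hamiltonian_isHermitian (Λ : Finset ℕ) (μ γ ν : ℕ → ℝ) :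
    (hamiltonian Λ μ γ ν)ᴴ = hamiltonian Λ μ γ ν := by
  simp only [hamiltonian_eq, Matrix.conjTranspose_sum, Matrix.conjTranspose_smul,
    Matrix.conjTranspose_mul, Matrix.conjTranspose_conjTranspose, effectiveHamiltonian_star]
  rw [Finset.sum_comm]

theorem fermi_anticomm' {Λ : Finset ℕ} (p q : Λ × Fin 2) :
    fermi p * fermi q = (if q = bar p then 1 else 0) - fermi q * fermi p :=
  eq_sub_of_add_eq (fermi_anticomm p q)

/-- The commutator of a quadratic and a linear expression is linear. Each factor of the bilinear can
be contracted with `fermi p`; by particle-hole symmetry both contractions give the same sum, hence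
the factor 2. -/
theorem hamiltonian_comm_fermi (Λ : Finset ℕ) (μ γ ν : ℕ → ℝ) (p : Λ × Fin 2) :
    hamiltonian Λ μ γ ν * fermi p = fermi p * hamiltonian Λ μ γ ν -
      (2 : ℂ) • ∑ q, effectiveHamiltonian Λ μ γ ν p q • fermi q := by
  set M := effectiveHamiltonian Λ μ γ ν with hM
  have key : ∀ a b : Λ × Fin 2, (fermi a)ᴴ * fermi b * fermi p =
      fermi p * ((fermi a)ᴴ * fermi b) + ((if b = bar p then (fermi (bar a)) else 0) -
        if a = p then fermi b else 0) := by
    intro a b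
    rw [fermi_conjTranspose, mul_assoc, fermi_anticomm' b p, mul_sub, ← mul_assoc,
      fermi_anticomm' (bar a) p, bar_bar, sub_mul, mul_assoc]
    have e1 : (p = bar b) = (b = bar p) :=
      propext ⟨fun h => by rw [h, bar_bar], fun h => by rw [h, bar_bar]⟩
    have e2 : (p = a) = (a = p) := propext eq_comm
    simp only [e1, e2, mul_ite, ite_mul, one_mul, mul_one, zero_mul, mul_zero]
    abel
  rw [hamiltonian_eq]
  simp only [Finset.sum_mul, Finset.mul_sum, smul_mul_assoc, mul_smul_comm, key, smul_add, smul_sub,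
    Finset.sum_add_distrib, Finset.sum_sub_distrib, smul_ite, smul_zero]
  have h1 : ∑ a, ∑ b, (if b = bar p then M a b • (fermi (bar a) : Op Λ) else 0) =
      -∑ q, M p q • fermi q := by
    simp only [Finset.sum_ite_eq', Finset.mem_univ, if_true]
    rw [← Finset.sum_neg_distrib]
    refine Fintype.sum_equiv (barEquiv Λ) _ _ fun a => ?_
    change _ = -(M p (bar a) • fermi (bar a))
    rw [← neg_smul]
    congr 1
    have := effectiveHamiltonian_bar Λ μ γ ν (bar p) a
    rw [bar_bar] at this
    rw [hM, this, neg_neg]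
  have h2 : ∑ a, ∑ b, (if a = p then M a b • (fermi b : Op Λ) else 0) = ∑ q, M p q • fermi q := by
    rw [Finset.sum_comm]
    simp
  rw [h1, h2]
  module

/-! ### Spectral decomposition of Hermitian matrices -/

section Spectral

variable {ι : Type*} [Fintype ι] [DecidableEq ι] {A : Matrix ι ι ℂ} (hA : A.IsHermitian)

/-- The `i`-th vector of an orthonormal eigenbasis of a Hermitian matrix. -/
def eigvec (i : ι) : ι → ℂ := fun p => (hA.eigenvectorUnitary : Matrix ι ι ℂ) p i

theorem eigvec_orthonormal (i j : ι) :
    star (eigvec hA i) ⬝ᵥ eigvec hA j = if i = j then 1 else 0 := by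
  have h := congrFun (congrFun (Unitary.coe_star_mul_self hA.eigenvectorUnitary) i) j
  simpa [Matrix.mul_apply, dotProduct, Matrix.one_apply, eigvec] using h

theorem eigvec_complete (p q : ι) :
    ∑ i, eigvec hA i p * star (eigvec hA i q) = if p = q then 1 else 0 := by
  have h := congrFun (congrFun (Unitary.coe_mul_star_self hA.eigenvectorUnitary) p) q
  simpa [Matrix.mul_apply, Matrix.one_apply, eigvec] using h

theorem mulVec_eigvec (i : ι) : A *ᵥ eigvec hA i = (hA.eigenvalues i : ℂ) • eigvec hA i := by
  have h := hA.mulVec_eigenvectorBasis i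
  funext p
  have h2 := congrFun h p
  simpa [eigvec, Matrix.IsHermitian.eigenvectorUnitary_apply, Matrix.mulVec, dotProduct] using h2

theorem functionOf_apply (g : ℝ → ℂ) (p q : ι) :
    functionOf hA g p q = ∑ i, g (hA.eigenvalues i) * (eigvec hA i p * star (eigvec hA i q)) := by
  rw [functionOf, Matrix.mul_apply]
  simp only [Matrix.mul_diagonal, eigvec, Matrix.star_apply]
  refine Finset.sum_congr rfl fun i _ => ?_
  ring

theorem functionOf_mulVec (g : ℝ → ℂ) (v : ι → ℂ) :
    functionOf hA g *ᵥ v =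
      ∑ i, (g (hA.eigenvalues i) * (star (eigvec hA i) ⬝ᵥ v)) • eigvec hA i := by
  funext p
  simp only [Matrix.mulVec, dotProduct, functionOf_apply, Finset.sum_apply, Pi.smul_apply,
    smul_eq_mul, Finset.sum_mul, Finset.mul_sum, Pi.star_apply]
  rw [Finset.sum_comm]
  refine Finset.sum_congr rfl fun i _ => Finset.sum_congr rfl fun q _ => ?_
  ring

/-- Completeness of the eigenbasis, written as functional calculus. -/
theorem functionOf_one : functionOf hA (fun _ => 1) = 1 := by
  ext p q
  simp only [functionOf_apply, one_mul, eigvec_complete, Matrix.one_apply]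

theorem functionOf_mul (g h : ℝ → ℂ) :
    functionOf hA g * functionOf hA h = functionOf hA (fun x => g x * h x) := by
  have e : star (hA.eigenvectorUnitary : Matrix ι ι ℂ) *
      (hA.eigenvectorUnitary : Matrix ι ι ℂ) = 1 :=
    Unitary.coe_star_mul_self hA.eigenvectorUnitary
  simp only [functionOf]
  calc _ = (hA.eigenvectorUnitary : Matrix ι ι ℂ) *
        Matrix.diagonal (fun i => g (hA.eigenvalues i)) *
        (star (hA.eigenvectorUnitary : Matrix ι ι ℂ) * (hA.eigenvectorUnitary : Matrix ι ι ℂ)) *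
        Matrix.diagonal (fun i => h (hA.eigenvalues i)) *
        star (hA.eigenvectorUnitary : Matrix ι ι ℂ) := by simp only [mul_assoc]
    _ = _ := by rw [e, mul_one, mul_assoc (hA.eigenvectorUnitary : Matrix ι ι ℂ),
                  Matrix.diagonal_mul_diagonal]

theorem functionOf_conjTranspose (g : ℝ → ℂ) :
    (functionOf hA g)ᴴ = functionOf hA (fun x => star (g x)) := by
  ext p q
  simp only [Matrix.conjTranspose_apply, functionOf_apply, star_sum, star_mul', star_star]
  refine Finset.sum_congr rfl fun i _ => ?_
  ring

theorem sum_eigvec (v : ι → ℂ) : ∑ i, (star (eigvec hA i) ⬝ᵥ v) • eigvec hA i = v := by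
  have := functionOf_mulVec hA (fun _ => 1) v
  simpa [functionOf_one] using this.symm

end Spectral

/-! ### Fermionic modes -/

section Modes

variable {Λ : Finset ℕ}

/-- The linear combination of Jordan-Wigner operators with coefficients conjugate to `v`. -/
def mode (v : Λ × Fin 2 → ℂ) : Op Λ := ∑ p, star (v p) • fermi p

/-- The antiunitary particle-hole conjugation. -/
def conjBar {ι : Type*} (v : ι × Fin 2 → ℂ) : ι × Fin 2 → ℂ := fun p => star (v (bar p))

theorem conjBar_conjBar {ι : Type*} (v : ι × Fin 2 → ℂ) : conjBar (conjBar v) = v := by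
  funext p; simp [conjBar, bar_bar]

theorem mode_add (v w : Λ × Fin 2 → ℂ) : mode (v + w) = mode v + mode w := by
  simp [mode, add_smul, Finset.sum_add_distrib]

theorem mode_smul (c : ℂ) (v : Λ × Fin 2 → ℂ) : mode (c • v) = star c • mode v := by
  simp [mode, Finset.smul_sum, mul_smul]

theorem mode_zero : mode (0 : Λ × Fin 2 → ℂ) = 0 := by simp [mode]

theorem mode_sub (v w : Λ × Fin 2 → ℂ) : mode (v - w) = mode v - mode w := by
  simp [mode, sub_smul, Finset.sum_sub_distrib]

theorem mode_sum {κ : Type*} (s : Finset κ) (v : κ → Λ × Fin 2 → ℂ) :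
    mode (∑ i ∈ s, v i) = ∑ i ∈ s, mode (v i) := by
  classical
  induction s using Finset.induction_on with
  | empty => simp [mode_zero]
  | insert a s h ih => rw [Finset.sum_insert h, Finset.sum_insert h, mode_add, ih]

theorem mode_conjTranspose (v : Λ × Fin 2 → ℂ) : (mode v)ᴴ = mode (conjBar v) := by
  simp only [mode, Matrix.conjTranspose_sum, Matrix.conjTranspose_smul, star_star, conjBar,
    fermi_conjTranspose]
  refine Fintype.sum_equiv (barEquiv Λ) _ _ fun p => ?_
  change _ = v (bar (bar p)) • fermi (bar p)
  rw [bar_bar]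

theorem mode_anticomm (v w : Λ × Fin 2 → ℂ) :
    mode v * mode w + mode w * mode v = (star v ⬝ᵥ conjBar w) • (1 : Op Λ) := by
  simp only [mode, Finset.sum_mul_sum]
  rw [Finset.sum_comm (f := fun i j => star (w i) • fermi i * star (v j) • fermi j),
    ← Finset.sum_add_distrib, dotProduct, Finset.sum_smul]
  refine Finset.sum_congr rfl fun p _ => ?_
  rw [← Finset.sum_add_distrib]
  have : ∀ q, star (v p) • fermi p * star (w q) • fermi q +
      star (w q) • fermi q * star (v p) • fermi p =
      if q = bar p then (star (v p) * star (w q)) • (1 : Op Λ) else 0 := by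
    intro q
    rw [smul_mul_smul_comm, smul_mul_smul_comm, mul_comm (star (w q)), ← smul_add, fermi_anticomm]
    split_ifs <;> simp
  rw [Finset.sum_congr rfl fun q _ => this q]
  simp [conjBar]

theorem mode_anticomm_star (v w : Λ × Fin 2 → ℂ) :
    mode v * (mode w)ᴴ + (mode w)ᴴ * mode v = (star v ⬝ᵥ w) • (1 : Op Λ) := by
  rw [mode_conjTranspose, mode_anticomm, conjBar_conjBar]

theorem hamiltonian_mul_mode (μ γ ν : ℕ → ℝ) (v : Λ × Fin 2 → ℂ) :
    hamiltonian Λ μ γ ν * mode v = mode v * hamiltonian Λ μ γ ν -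
      (2 : ℂ) • mode (effectiveHamiltonian Λ μ γ ν *ᵥ v) := by
  have h : mode (effectiveHamiltonian Λ μ γ ν *ᵥ v) =
      ∑ p, star (v p) • ∑ q, effectiveHamiltonian Λ μ γ ν p q • fermi q := by
    simp only [mode, Matrix.mulVec, dotProduct, star_sum, star_mul', effectiveHamiltonian_star,
      Finset.sum_smul, Finset.smul_sum, smul_smul]
    rw [Finset.sum_comm]
    refine Finset.sum_congr rfl fun p _ => Finset.sum_congr rfl fun q _ => ?_
    rw [mul_comm]
  rw [h]
  simp only [mode, Finset.mul_sum, Finset.sum_mul, mul_smul_comm, smul_mul_assoc,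
    hamiltonian_comm_fermi, smul_sub, Finset.sum_sub_distrib]
  congr 1
  rw [Finset.smul_sum]
  exact Finset.sum_congr rfl fun p _ => smul_comm _ _ _

/-- The mode of an eigenvector of M with eigenvalue `x` is a ladder operator: it lowers the energy
by `2x`, and its adjoint raises it by the same amount. -/
theorem hamiltonian_mul_mode_of_eigen {μ γ ν : ℕ → ℝ} {v : Λ × Fin 2 → ℂ} {x : ℝ}
    (hv : effectiveHamiltonian Λ μ γ ν *ᵥ v = (x : ℂ) • v) :
    hamiltonian Λ μ γ ν * mode v = mode v * hamiltonian Λ μ γ ν - (2 * x : ℂ) • mode v := by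
  rw [hamiltonian_mul_mode, hv, mode_smul, smul_smul]
  simp

theorem hamiltonian_mul_mode_star_of_eigen {μ γ ν : ℕ → ℝ} {v : Λ × Fin 2 → ℂ} {x : ℝ}
    (hv : effectiveHamiltonian Λ μ γ ν *ᵥ v = (x : ℂ) • v) :
    hamiltonian Λ μ γ ν * (mode v)ᴴ =
      (mode v)ᴴ * hamiltonian Λ μ γ ν + (2 * x : ℂ) • (mode v)ᴴ := by
  have h := congrArg Matrix.conjTranspose (hamiltonian_mul_mode_of_eigen hv)
  simp only [Matrix.conjTranspose_mul, Matrix.conjTranspose_sub, Matrix.conjTranspose_smul,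
    hamiltonian_isHermitian] at h
  rw [h]
  simp

theorem parityOp_univ_mul_mode (v : Λ × Fin 2 → ℂ) :
    parityOp Finset.univ * mode v = -(mode v * parityOp Finset.univ) := by
  simp only [mode, Finset.mul_sum, Finset.sum_mul, mul_smul_comm, smul_mul_assoc,
    parityOp_univ_mul_fermi, smul_neg, Finset.sum_neg_distrib]

theorem parityOp_univ_comm_hamiltonian (μ γ ν : ℕ → ℝ) :
    parityOp Finset.univ * hamiltonian Λ μ γ ν = hamiltonian Λ μ γ ν * parityOp Finset.univ := by
  have key : ∀ p q : Λ × Fin 2, parityOp Finset.univ * ((fermi p)ᴴ * fermi q) =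
      (fermi p)ᴴ * fermi q * parityOp Finset.univ := by
    intro p q
    rw [fermi_conjTranspose, ← mul_assoc, parityOp_univ_mul_fermi, neg_mul, mul_assoc,
      parityOp_univ_mul_fermi]
    noncomm_ring
  simp only [hamiltonian_eq, Finset.mul_sum, Finset.sum_mul, mul_smul_comm, smul_mul_assoc, key]

/-- The vector `ψ` is the quasi-free vacuum with one-particle projection `P`. -/
def IsVacuum (P : Matrix (Λ × Fin 2) (Λ × Fin 2) ℂ) (ψ : Config Λ → ℂ) : Prop :=
  ∀ v, mode (P *ᵥ v) *ᵥ ψ = 0 ∧ (mode (v - P *ᵥ v))ᴴ *ᵥ ψ = 0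

end Modes

/-! ### Eigenstates of Hamiltonians with simple spectrum -/

section Eigenstates

variable {Λ : Finset ℕ}

theorem eq_smul_of_simple {H : Op Λ} (hH : HasSimpleSpectrum H) {ψ φ : Config Λ → ℂ} {E : ℂ}
    (hψ : H *ᵥ ψ = E • ψ) (h0 : ψ ≠ 0) (hφ : H *ᵥ φ = E • φ) : ∃ c : ℂ, φ = c • ψ := by
  have mem : ∀ {x : Config Λ → ℂ}, H *ᵥ x = E • x →
      x ∈ Module.End.eigenspace (Matrix.toLin' H) E := fun h => by
    rw [Module.End.mem_eigenspace_iff, Matrix.toLin'_apply, h]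
  obtain ⟨⟨w, hw⟩, hspan⟩ := finrank_le_one_iff.1 (hH E)
  obtain ⟨a, ha⟩ := hspan ⟨ψ, mem hψ⟩
  obtain ⟨b, hb⟩ := hspan ⟨φ, mem hφ⟩
  have ha' : a • w = ψ := congrArg Subtype.val ha
  have hb' : b • w = φ := congrArg Subtype.val hb
  have ha0 : a ≠ 0 := by rintro rfl; exact h0 (by rw [← ha', zero_smul])
  exact ⟨b * a⁻¹, by rw [← ha', ← hb', smul_smul, inv_mul_cancel_right₀ ha0]⟩

/-- An operator commuting with H preserves its eigenspaces, which are at most lines. All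
consequences of simplicity below are drawn through this statement. -/
theorem commute_mulVec_of_simple {H X : Op Λ} (hH : HasSimpleSpectrum H) {ψ : Config Λ → ℂ} {E : ℂ}
    (hψ : H *ᵥ ψ = E • ψ) (h0 : ψ ≠ 0) (hX : H * X = X * H) : ∃ c : ℂ, X *ᵥ ψ = c • ψ := by
  refine eq_smul_of_simple hH hψ h0 ?_
  rw [Matrix.mulVec_mulVec, hX, ← Matrix.mulVec_mulVec, hψ, Matrix.mulVec_smul]

theorem mode_mulVec_add {v : Λ × Fin 2 → ℂ} (hv : star v ⬝ᵥ v = 1) (ψ : Config Λ → ℂ) :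
    mode v *ᵥ ((mode v)ᴴ *ᵥ ψ) + (mode v)ᴴ *ᵥ (mode v *ᵥ ψ) = ψ := by
  rw [Matrix.mulVec_mulVec, Matrix.mulVec_mulVec, ← Matrix.add_mulVec, mode_anticomm_star, hv,
    one_smul, Matrix.one_mulVec]

variable {μ γ ν : ℕ → ℝ} {ψ : Config Λ → ℂ} {E : ℂ}

/-- By simplicity ψ is an eigenvector both of the total parity and of the mode. The mode
anticommutes with the parity, whose eigenvalue is nonzero, so the eigenvalue of the mode is 0. -/
theorem eq_zero_of_odd (hH : HasSimpleSpectrum (hamiltonian Λ μ γ ν))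
    (hψ : hamiltonian Λ μ γ ν *ᵥ ψ = E • ψ) (h0 : ψ ≠ 0) {v : Λ × Fin 2 → ℂ}
    (hv : hamiltonian Λ μ γ ν * mode v = mode v * hamiltonian Λ μ γ ν) : mode v *ᵥ ψ = 0 := by
  obtain ⟨c, hc⟩ := commute_mulVec_of_simple hH hψ h0 hv
  obtain ⟨q, hq⟩ := commute_mulVec_of_simple hH hψ h0 (parityOp_univ_comm_hamiltonian μ γ ν).symm
  have h1 : parityOp Finset.univ *ᵥ (mode v *ᵥ ψ) = -(mode v *ᵥ (parityOp Finset.univ *ᵥ ψ)) := by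
    rw [Matrix.mulVec_mulVec, parityOp_univ_mul_mode, Matrix.neg_mulVec, ← Matrix.mulVec_mulVec]
  have h2 : parityOp Finset.univ *ᵥ (parityOp Finset.univ *ᵥ ψ) = ψ := by
    rw [Matrix.mulVec_mulVec, parityOp_mul_self, Matrix.one_mulVec]
  rw [hq, Matrix.mulVec_smul, hq, smul_smul] at h2
  rw [hq, Matrix.mulVec_smul, hc, Matrix.mulVec_smul, hq, smul_smul, smul_smul, mul_comm q,
    ← neg_smul] at h1
  have h3 : (c * q + c * q) • ψ = 0 := by
    rw [add_smul]; nth_rewrite 1 [h1]; rw [← add_smul, neg_add_cancel, zero_smul]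
  have hq0 : q ≠ 0 := by
    rintro rfl
    exact h0 (by rw [← h2]; simp)
  rcases smul_eq_zero.1 h3 with h | h
  · have : c = 0 := by
      have h4 : c * q = 0 := by linear_combination h / 2
      exact (mul_eq_zero.1 h4).resolve_right hq0
    rw [hc, this, zero_smul]
  · exact absurd h h0

/-- Particle-hole conjugation is antiunitary and maps the eigenspace of `x` to that of `-x`. -/
theorem effectiveHamiltonian_mulVec_conjBar {v : Λ × Fin 2 → ℂ} {x : ℝ}
    (hv : effectiveHamiltonian Λ μ γ ν *ᵥ v = (x : ℂ) • v) :
    effectiveHamiltonian Λ μ γ ν *ᵥ conjBar v = (-x : ℂ) • conjBar v := by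
  funext p
  have h := congrArg star (congrFun hv (bar p))
  simp only [Matrix.mulVec, dotProduct, star_sum, star_mul', Pi.smul_apply, smul_eq_mul,
    conjBar, RCLike.star_def, Complex.conj_ofReal] at h ⊢
  rw [neg_mul, ← h, ← Finset.sum_neg_distrib]
  refine (Fintype.sum_equiv (barEquiv Λ) _ _ fun q => ?_).symm
  change _ = effectiveHamiltonian Λ μ γ ν p (bar q) * _
  have e1 := effectiveHamiltonian_bar Λ μ γ ν p (bar q)
  have e2 := effectiveHamiltonian_star Λ μ γ ν (bar p) q
  rw [bar_bar] at e1
  rw [RCLike.star_def] at e2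
  change _ = _ * (starRingEnd ℂ) (v (bar (bar q)))
  rw [bar_bar, e1] at *
  rw [e2, ← neg_mul]
  congr 1
  rw [← effectiveHamiltonian_bar, bar_bar]

theorem dotProduct_eq_zero_of_ne {ι : Type*} [Fintype ι] {A : Matrix ι ι ℂ} (hA : A.IsHermitian)
    {v w : ι → ℂ} {x y : ℝ} (hv : A *ᵥ v = (x : ℂ) • v) (hw : A *ᵥ w = (y : ℂ) • w) (h : x ≠ y) :
    star v ⬝ᵥ w = 0 := by
  have h1 : star v ⬝ᵥ (A *ᵥ w) = star (A *ᵥ v) ⬝ᵥ w := by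
    rw [Matrix.star_mulVec, hA.eq, Matrix.dotProduct_mulVec]
  rw [hv, hw, dotProduct_smul, star_smul, smul_dotProduct] at h1
  simp only [smul_eq_mul, RCLike.star_def, Complex.conj_ofReal] at h1
  have h2 : ((y : ℂ) - x) * (star v ⬝ᵥ w) = 0 := by linear_combination h1
  refine (mul_eq_zero.1 h2).resolve_left ?_
  exact sub_ne_zero.2 (by exact_mod_cast h.symm)

/-- Commuting quadratic expressions in modes of equal energy. -/
theorem hamiltonian_comm_star_mul {v w : Λ × Fin 2 → ℂ} {x : ℝ}
    (hv : effectiveHamiltonian Λ μ γ ν *ᵥ v = (x : ℂ) • v)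
    (hw : effectiveHamiltonian Λ μ γ ν *ᵥ w = (x : ℂ) • w) :
    hamiltonian Λ μ γ ν * ((mode w)ᴴ * mode v) = (mode w)ᴴ * mode v * hamiltonian Λ μ γ ν := by
  rw [← mul_assoc, hamiltonian_mul_mode_star_of_eigen hw, add_mul, mul_assoc,
    hamiltonian_mul_mode_of_eigen hv, mul_sub, mul_assoc]
  simp

/-- A zero mode and its adjoint would both commute with H and hence annihilate ψ, against their
anticommutation relation. -/
theorem eigenvalue_ne_zero (hH : HasSimpleSpectrum (hamiltonian Λ μ γ ν))
    (hψ : hamiltonian Λ μ γ ν *ᵥ ψ = E • ψ) (h0 : ψ ≠ 0) {v : Λ × Fin 2 → ℂ} {x : ℝ}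
    (hv : effectiveHamiltonian Λ μ γ ν *ᵥ v = (x : ℂ) • v) (h1 : star v ⬝ᵥ v = 1) : x ≠ 0 := by
  rintro rfl
  refine h0 ?_
  rw [← mode_mulVec_add h1 ψ, eq_zero_of_odd hH hψ h0, mode_conjTranspose,
    eq_zero_of_odd hH hψ h0]
  · simp
  · rw [← mode_conjTranspose, hamiltonian_mul_mode_star_of_eigen hv]; simp
  · rw [hamiltonian_mul_mode_of_eigen hv]; simp

/-- The anticommutator is the overlap of `v` with `conjBar w`, an eigenvector for `-x`, which
differs from `x`. -/
theorem mode_mul_mode_of_eigen {v w : Λ × Fin 2 → ℂ} {x : ℝ} (hx : x ≠ 0)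
    (hv : effectiveHamiltonian Λ μ γ ν *ᵥ v = (x : ℂ) • v)
    (hw : effectiveHamiltonian Λ μ γ ν *ᵥ w = (x : ℂ) • w) :
    mode v * mode w = -(mode w * mode v) := by
  refine eq_neg_of_add_eq_zero_left ?_
  have hw' := effectiveHamiltonian_mulVec_conjBar hw
  rw [mode_anticomm, dotProduct_eq_zero_of_ne (effectiveHamiltonian_isHermitian Λ μ γ ν) hv
    (y := -x) (by rw [hw']; simp) (by intro h; apply hx; linarith), zero_smul]

theorem mode_sq_of_eigen {v : Λ × Fin 2 → ℂ} {x : ℝ} (hx : x ≠ 0)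
    (hv : effectiveHamiltonian Λ μ γ ν *ᵥ v = (x : ℂ) • v) : mode v * mode v = 0 := by
  have h := mode_mul_mode_of_eigen hx hv hv
  have h2 : (2 : ℂ) • (mode v * mode v) = 0 := by rw [two_smul]; nth_rewrite 1 [h]; simp
  exact (smul_eq_zero.1 h2).resolve_left two_ne_zero

open scoped ComplexOrder in
theorem eq_zero_of_mode_star_mul {v : Λ × Fin 2 → ℂ} {φ : Config Λ → ℂ}
    (h : (mode v)ᴴ *ᵥ (mode v *ᵥ φ) = 0) : mode v *ᵥ φ = 0 := by
  rw [← dotProduct_star_self_eq_zero]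
  rw [Matrix.star_mulVec, ← Matrix.dotProduct_mulVec, h, dotProduct_zero]

/-- In an eigenstate, every mode of definite energy is occupied or empty. -/
theorem mode_dichotomy (hH : HasSimpleSpectrum (hamiltonian Λ μ γ ν))
    (hψ : hamiltonian Λ μ γ ν *ᵥ ψ = E • ψ) (h0 : ψ ≠ 0) {v : Λ × Fin 2 → ℂ} {x : ℝ}
    (hv : effectiveHamiltonian Λ μ γ ν *ᵥ v = (x : ℂ) • v) (h1 : star v ⬝ᵥ v = 1) :
    mode v *ᵥ ψ = 0 ∨ (mode v)ᴴ *ᵥ ψ = 0 := by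
  have hx := eigenvalue_ne_zero hH hψ h0 hv h1
  have hsq := mode_sq_of_eigen hx hv
  obtain ⟨c, hc⟩ := commute_mulVec_of_simple hH hψ h0 (hamiltonian_comm_star_mul hv hv)
  have hanti := mode_mulVec_add h1 ψ
  -- With b the mode, b b* b = b while b*b ψ = cψ. Hence bψ = 0 or c = 1, and in the latter case b
  -- b* ψ = 0.
  have hb : c • (mode v *ᵥ ψ) = mode v *ᵥ ψ := by
    rw [← Matrix.mulVec_smul, ← hc]
    have h := mode_mulVec_add h1 (mode v *ᵥ ψ)
    rw [Matrix.mulVec_mulVec _ (mode v) (mode v), hsq] at h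
    simpa [← Matrix.mulVec_mulVec] using h
  by_cases hb0 : mode v *ᵥ ψ = 0
  · exact Or.inl hb0
  · right
    have hc1 : c = 1 := by
      have h2 : (c - 1) • (mode v *ᵥ ψ) = 0 := by rw [sub_smul, hb, one_smul, sub_self]
      exact sub_eq_zero.1 ((smul_eq_zero.1 h2).resolve_right hb0)
    rw [← Matrix.mulVec_mulVec, hc1, one_smul] at hc
    rw [hc, add_eq_right] at hanti
    rw [mode_conjTranspose]
    refine eq_zero_of_mode_star_mul ?_
    rw [← mode_conjTranspose, Matrix.conjTranspose_conjTranspose]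
    exact hanti

/-- The hopping operator from `v` to `w` conserves the energy, so ψ is an eigenvector of it; it is
nilpotent, so it annihilates ψ. The anticommutation relations of `w`, applied to `mode v *ᵥ ψ`, then
give the claim. Thus occupation depends on the energy only, and M need not have simple spectrum. -/
theorem mode_empty_of_eigen (hH : HasSimpleSpectrum (hamiltonian Λ μ γ ν))
    (hψ : hamiltonian Λ μ γ ν *ᵥ ψ = E • ψ) (h0 : ψ ≠ 0) {v w : Λ × Fin 2 → ℂ} {x : ℝ}
    (hv : effectiveHamiltonian Λ μ γ ν *ᵥ v = (x : ℂ) • v)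
    (hw : effectiveHamiltonian Λ μ γ ν *ᵥ w = (x : ℂ) • w)
    (hv1 : star v ⬝ᵥ v = 1) (hw1 : star w ⬝ᵥ w = 1) (hvw : star v ⬝ᵥ w = 0)
    (h : mode w *ᵥ ψ = 0) : mode v *ᵥ ψ = 0 := by
  have hx := eigenvalue_ne_zero hH hψ h0 hv hv1
  have anti : mode v * (mode w)ᴴ = -((mode w)ᴴ * mode v) :=
    eq_neg_of_add_eq_zero_left (by rw [mode_anticomm_star, hvw, zero_smul])
  obtain ⟨c, hc⟩ := commute_mulVec_of_simple hH hψ h0 (hamiltonian_comm_star_mul hv hw)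
  have hX : (mode w)ᴴ * mode v * ((mode w)ᴴ * mode v) = 0 := by
    calc _ = (mode w)ᴴ * (mode v * (mode w)ᴴ) * mode v := by noncomm_ring
      _ = -((mode w)ᴴ * (mode w)ᴴ * (mode v * mode v)) := by rw [anti]; noncomm_ring
      _ = 0 := by rw [mode_sq_of_eigen hx hv, mul_zero, neg_zero]
  have hcc : (c * c) • ψ = 0 := by
    rw [← smul_smul, ← hc, ← Matrix.mulVec_smul, ← hc, Matrix.mulVec_mulVec, hX,
      Matrix.zero_mulVec]
  have hc0 : c = 0 := mul_self_eq_zero.1 ((smul_eq_zero.1 hcc).resolve_right h0)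
  rw [hc0, zero_smul, ← Matrix.mulVec_mulVec] at hc
  by_contra hne
  have hw2 := mode_mulVec_add hw1 (mode v *ᵥ ψ)
  rw [hc, Matrix.mulVec_zero, zero_add, Matrix.mulVec_mulVec _ (mode w) (mode v),
    mode_mul_mode_of_eigen hx hw hv, Matrix.neg_mulVec, ← Matrix.mulVec_mulVec, h] at hw2
  simp at hw2
  exact hne hw2.symm

/-- Eigenstates of an XY Hamiltonian with simple spectrum are quasi-free vacua whose one-particle
projection is a spectral projection of the effective Hamiltonian. -/
theorem exists_isVacuum_of_eigenstate (hH : HasSimpleSpectrum (hamiltonian Λ μ γ ν))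
    (hψ : IsEigenstate (hamiltonian Λ μ γ ν) ψ) :
    ∃ S : Set ℝ, MeasurableSet S ∧
      IsVacuum (functionOf (effectiveHamiltonian_isHermitian Λ μ γ ν) (S.indicator 1)) ψ := by
  classical
  obtain ⟨h1, E, hE⟩ := hψ
  have h0 : ψ ≠ 0 := by rintro rfl; simp at h1
  set hA := effectiveHamiltonian_isHermitian Λ μ γ ν
  -- An energy belongs to `S` as soon as one eigenbasis mode at that energy annihilates ψ;
  -- `mode_empty_of_eigen` then gives it for all of them. The set is finite, hence Borel.
  set S : Set ℝ := {x | ∃ i, hA.eigenvalues i = x ∧ mode (eigvec hA i) *ᵥ ψ = 0} with hS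
  have hSfin : S.Finite := (Set.finite_range hA.eigenvalues).subset (by
    rintro x ⟨i, hi, -⟩; exact ⟨i, hi⟩)
  have hunit : ∀ i, star (eigvec hA i) ⬝ᵥ eigvec hA i = 1 := fun i => by
    rw [eigvec_orthonormal, if_pos rfl]
  have hin : ∀ i, hA.eigenvalues i ∈ S → mode (eigvec hA i) *ᵥ ψ = 0 := by
    rintro i ⟨k, hk, hk0⟩
    by_cases hik : i = k
    · rw [hik]; exact hk0
    · refine mode_empty_of_eigen hH hE h0 (mulVec_eigvec hA i) (w := eigvec hA k) ?_
        (hunit i) (hunit k) ?_ hk0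
      · rw [mulVec_eigvec hA k, hk]
      · rw [eigvec_orthonormal, if_neg hik]
  have hout : ∀ i, hA.eigenvalues i ∉ S → (mode (eigvec hA i))ᴴ *ᵥ ψ = 0 := by
    intro i hi
    refine (mode_dichotomy hH hE h0 (mulVec_eigvec hA i) (hunit i)).resolve_left fun h => ?_
    exact hi ⟨i, rfl, h⟩
  refine ⟨S, hSfin.measurableSet, fun v => ⟨?_, ?_⟩⟩
  · rw [functionOf_mulVec, mode_sum, Matrix.sum_mulVec]
    refine Finset.sum_eq_zero fun i _ => ?_
    rw [mode_smul, Matrix.smul_mulVec]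
    by_cases hi : hA.eigenvalues i ∈ S
    · rw [hin i hi, smul_zero]
    · simp [hi]
  · nth_rewrite 1 [← sum_eigvec hA v]
    rw [functionOf_mulVec, ← Finset.sum_sub_distrib, mode_sum, Matrix.conjTranspose_sum,
      Matrix.sum_mulVec]
    refine Finset.sum_eq_zero fun i _ => ?_
    rw [← sub_smul, mode_smul, Matrix.conjTranspose_smul, Matrix.smul_mulVec]
    by_cases hi : hA.eigenvalues i ∈ S
    · simp [hi]
    · rw [hout i hi, smul_zero]

end Eigenstates

/-! ### Covariance of quasi-free vacua -/

theorem fermi_eq_mode {Λ : Finset ℕ} (p : Λ × Fin 2) : fermi p = mode (Pi.single p 1) := by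
  simp [mode, Pi.single_apply, apply_ite, ite_smul]

theorem dotProduct_mulVec_conjTranspose {ι : Type*} [Fintype ι] (A : Matrix ι ι ℂ) (v w : ι → ℂ) :
    star v ⬝ᵥ (Aᴴ *ᵥ w) = star (A *ᵥ v) ⬝ᵥ w := by
  rw [Matrix.star_mulVec, Matrix.dotProduct_mulVec]

/-- On ψ the adjoint mode of `w` may be replaced by that of `P *ᵥ w`. Anticommuting it to the left
leaves the scalar and a term that vanishes because `mode (P *ᵥ w)` annihilates ψ. -/
theorem IsVacuum.covariance_mode {Λ : Finset ℕ} {P : Matrix (Λ × Fin 2) (Λ × Fin 2) ℂ}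
    {ψ : Config Λ → ℂ} (h : IsVacuum P ψ) (h1 : star ψ ⬝ᵥ ψ = 1) (v w : Λ × Fin 2 → ℂ) :
    star ψ ⬝ᵥ ((mode v * (mode w)ᴴ) *ᵥ ψ) = star v ⬝ᵥ (P *ᵥ w) := by
  have e1 : (mode w)ᴴ *ᵥ ψ = (mode (P *ᵥ w))ᴴ *ᵥ ψ := by
    have := (h w).2
    rw [mode_sub, Matrix.conjTranspose_sub, Matrix.sub_mulVec, sub_eq_zero] at this
    exact this
  have e2 : mode v * (mode (P *ᵥ w))ᴴ =
      (star v ⬝ᵥ (P *ᵥ w)) • (1 : Op Λ) - (mode (P *ᵥ w))ᴴ * mode v :=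
    eq_sub_of_add_eq (mode_anticomm_star v (P *ᵥ w))
  rw [← Matrix.mulVec_mulVec, e1, Matrix.mulVec_mulVec, e2, Matrix.sub_mulVec, Matrix.smul_mulVec,
    Matrix.one_mulVec, dotProduct_sub, dotProduct_smul, h1, ← Matrix.mulVec_mulVec,
    dotProduct_mulVec_conjTranspose, (h w).1]
  simp

theorem IsVacuum.covariance {Λ : Finset ℕ} {P : Matrix (Λ × Fin 2) (Λ × Fin 2) ℂ}
    {ψ : Config Λ → ℂ} (h : IsVacuum P ψ) (h1 : star ψ ⬝ᵥ ψ = 1) (p q : Λ × Fin 2) :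
    star ψ ⬝ᵥ ((fermi p * (fermi q)ᴴ) *ᵥ ψ) = P p q := by
  rw [fermi_eq_mode, fermi_eq_mode, h.covariance_mode h1, Pi.star_single]
  simp

/-! ### Time evolution -/

section Evolution

variable {Λ : Finset ℕ}

/-- The unitary group `e^{-itH}`. -/
def propagator (H : Op Λ) (t : ℝ) : Op Λ := NormedSpace.exp ((-(Complex.I * t)) • H)

theorem propagator_conjTranspose {H : Op Λ} (hH : Hᴴ = H) (t : ℝ) :
    (propagator H t)ᴴ = NormedSpace.exp ((Complex.I * t) • H) := by
  rw [propagator, ← Matrix.exp_conjTranspose, Matrix.conjTranspose_smul, hH]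
  simp

theorem propagator_conjTranspose_mul_self {H : Op Λ} (hH : Hᴴ = H) (t : ℝ) :
    (propagator H t)ᴴ * propagator H t = 1 := by
  rw [propagator_conjTranspose hH, propagator, ← Matrix.exp_add_of_commute, ← add_smul,
    add_neg_cancel, zero_smul, NormedSpace.exp_zero]
  exact ((Commute.refl H).smul_left _).smul_right _

theorem evolve_pureState {H : Op Λ} (hH : Hᴴ = H) (t : ℝ) (ψ : Config Λ → ℂ) :
    evolve H t (pureState ψ) = pureState (propagator H t *ᵥ ψ) := by
  rw [evolve, pureState, pureState, ← propagator_conjTranspose hH, Matrix.mul_vecMulVec,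
    Matrix.vecMulVec_mul, Matrix.star_mulVec]
  rfl

theorem norm_propagator_mulVec {H : Op Λ} (hH : Hᴴ = H) (t : ℝ) (ψ : Config Λ → ℂ) :
    star (propagator H t *ᵥ ψ) ⬝ᵥ (propagator H t *ᵥ ψ) = star ψ ⬝ᵥ ψ := by
  rw [← dotProduct_mulVec_conjTranspose, Matrix.mulVec_mulVec, propagator_conjTranspose_mul_self hH,
    Matrix.one_mulVec]

open scoped Matrix.Norms.L2Operator in
-- `B` intertwines `H - c` with `H`, hence also their exponentials, and the scalar shift splits off
-- as a phase.
theorem exp_smul_mul_of_shift {ι : Type*} [Fintype ι] [DecidableEq ι] {H B : Matrix ι ι ℂ} {c : ℂ}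
    (h : H * B = B * H - c • B) (z : ℂ) :
    B * NormedSpace.exp (z • H) = Complex.exp (z * c) • (NormedSpace.exp (z • H) * B) := by
  let : NormedAlgebra ℚ (Matrix ι ι ℂ) := NormedAlgebra.restrictScalars ℚ ℂ _
  have h1 : SemiconjBy B (z • H + (-(z * c)) • 1) (z • H) := by
    change B * (z • H + (-(z * c)) • 1) = z • H * B
    rw [smul_mul_assoc, h]
    rw [mul_add, mul_smul_comm, mul_smul_comm, mul_one, smul_sub, smul_smul, neg_smul,
      sub_eq_add_neg]
  have h2 := h1.exp_right
  have h3 : NormedSpace.exp ((-(z * c)) • (1 : Matrix ι ι ℂ)) =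
      Complex.exp (-(z * c)) • (1 : Matrix ι ι ℂ) := by
    rw [← Algebra.algebraMap_eq_smul_one, ← Algebra.algebraMap_eq_smul_one,
      ← NormedSpace.algebraMap_exp_comm, Complex.exp_eq_exp_ℂ]
  have h4 : B * (NormedSpace.exp (z • H + (-(z * c)) • (1 : Matrix ι ι ℂ))) =
      NormedSpace.exp (z • H) * B := h2
  rw [Matrix.exp_add_of_commute _ _ ((Commute.one_right _).smul_right _), h3, mul_smul_comm,
    mul_smul_comm, mul_one] at h4
  rw [← h4, smul_smul, ← Complex.exp_add, add_neg_cancel, Complex.exp_zero, one_smul]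

variable (μ γ ν : ℕ → ℝ)

/-- The one-particle time evolution `e^{-2itM}`. -/
def oneParticleEvolution (Λ : Finset ℕ) (μ γ ν : ℕ → ℝ) (t : ℝ) :
    Matrix (Λ × Fin 2) (Λ × Fin 2) ℂ :=
  functionOf (effectiveHamiltonian_isHermitian Λ μ γ ν) fun x =>
    Complex.exp ((-(2 * t * x) : ℝ) * Complex.I)

theorem oneParticleEvolution_conjTranspose_mul_self (t : ℝ) :
    (oneParticleEvolution Λ μ γ ν t)ᴴ * oneParticleEvolution Λ μ γ ν t = 1 := by
  rw [oneParticleEvolution, functionOf_conjTranspose, functionOf_mul,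
    ← functionOf_one (effectiveHamiltonian_isHermitian Λ μ γ ν)]
  congr 1
  funext x
  rw [RCLike.star_def, ← Complex.exp_conj, ← Complex.exp_add, map_mul, Complex.conj_ofReal,
    Complex.conj_I, mul_neg, neg_add_cancel, Complex.exp_zero]

/-- The Heisenberg evolution of a mode is the one-particle evolution of its coefficients, as one
sees in an eigenbasis of M. -/
theorem mode_mul_propagator (t : ℝ) (v : Λ × Fin 2 → ℂ) :
    mode v * propagator (hamiltonian Λ μ γ ν) t =
      propagator (hamiltonian Λ μ γ ν) t * mode ((oneParticleEvolution Λ μ γ ν t)ᴴ *ᵥ v) := by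
  set hA := effectiveHamiltonian_isHermitian Λ μ γ ν
  rw [oneParticleEvolution, functionOf_conjTranspose, functionOf_mulVec, mode_sum, Finset.mul_sum]
  nth_rewrite 1 [← sum_eigvec hA v]
  rw [mode_sum, Finset.sum_mul]
  refine Finset.sum_congr rfl fun i _ => ?_
  rw [mode_smul, mode_smul, smul_mul_assoc, propagator,
    exp_smul_mul_of_shift (hamiltonian_mul_mode_of_eigen (mulVec_eigvec hA i)), smul_smul,
    mul_smul_comm, star_mul', star_star, mul_comm]
  congr 3
  push_cast
  ring

theorem IsVacuum.propagate {P : Matrix (Λ × Fin 2) (Λ × Fin 2) ℂ} {ψ : Config Λ → ℂ}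
    (h : IsVacuum P ψ) (t : ℝ) :
    IsVacuum (oneParticleEvolution Λ μ γ ν t * P * (oneParticleEvolution Λ μ γ ν t)ᴴ)
      (propagator (hamiltonian Λ μ γ ν) t *ᵥ ψ) := by
  set W := oneParticleEvolution Λ μ γ ν t with hW
  have hWW : Wᴴ * W = 1 := oneParticleEvolution_conjTranspose_mul_self μ γ ν t
  have hWW' : W * Wᴴ = 1 := mul_eq_one_comm.1 hWW
  have hU := propagator_conjTranspose_mul_self (hamiltonian_isHermitian Λ μ γ ν) t
  have hU' := mul_eq_one_comm.1 hU
  set U := propagator (hamiltonian Λ μ γ ν) t with hUdef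
  have hm : ∀ v, mode v * U = U * mode (Wᴴ *ᵥ v) := mode_mul_propagator μ γ ν t
  have hm' : ∀ v, (mode v)ᴴ * U = U * (mode (Wᴴ *ᵥ v))ᴴ := by
    intro v
    have h1 := congrArg Matrix.conjTranspose (hm v)
    rw [Matrix.conjTranspose_mul, Matrix.conjTranspose_mul] at h1
    calc (mode v)ᴴ * U = U * (Uᴴ * (mode v)ᴴ) * U := by rw [← mul_assoc U, hU', one_mul]
      _ = U * (mode (Wᴴ *ᵥ v))ᴴ * (Uᴴ * U) := by rw [h1]; noncomm_ring
      _ = _ := by rw [hU, mul_one]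
  have hP : ∀ v, Wᴴ *ᵥ ((W * P * Wᴴ) *ᵥ v) = P *ᵥ (Wᴴ *ᵥ v) := by
    intro v
    rw [Matrix.mulVec_mulVec, ← mul_assoc, ← mul_assoc, hWW, one_mul, ← Matrix.mulVec_mulVec]
  intro v
  constructor
  · rw [Matrix.mulVec_mulVec, hm, ← Matrix.mulVec_mulVec, hP, (h _).1, Matrix.mulVec_zero]
  · rw [Matrix.mulVec_mulVec, hm', ← Matrix.mulVec_mulVec, Matrix.mulVec_sub, hP, (h _).2,
      Matrix.mulVec_zero]

end Evolution

/-! ### Subsystems -/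

section Embedding

variable {Λ Λ' : Finset ℕ}

/-- The configurations on `Λ` are the pairs of configurations on `Λ'` and on `Λ \ Λ'`. -/
def splitConfig (h : Λ' ⊆ Λ) : Config Λ ≃ Config Λ' × Config (Λ \ Λ') where
  toFun s := (fun i => s ⟨i, h i.2⟩, fun i => s ⟨i, (Finset.mem_sdiff.1 i.2).1⟩)
  invFun x := glue x.1 x.2
  left_inv s := by
    funext j
    simp only [glue]
    split_ifs <;> rfl
  right_inv x := by
    refine Prod.ext ?_ ?_
    · funext i; simp [glue]
    · funext i
      simp only [glue]
      rw [dif_neg (Finset.mem_sdiff.1 i.2).2]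

/-- The operator `A ⊗ 1` on `Λ`, for an operator `A` on `Λ' ⊆ Λ`. -/
def embed (h : Λ' ⊆ Λ) (A : Op Λ') : Op Λ :=
  (Matrix.kronecker A (1 : Op (Λ \ Λ'))).submatrix (splitConfig h) (splitConfig h)

theorem embed_mul (h : Λ' ⊆ Λ) (A B : Op Λ') : embed h (A * B) = embed h A * embed h B := by
  rw [embed, embed, embed, Matrix.submatrix_mul_equiv]
  congr 1
  have := Matrix.mul_kronecker_mul A B (1 : Op (Λ \ Λ')) (1 : Op (Λ \ Λ'))
  rw [mul_one] at this
  exact this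

theorem embed_conjTranspose (h : Λ' ⊆ Λ) (A : Op Λ') : (embed h A)ᴴ = embed h Aᴴ := by
  rw [embed, embed, Matrix.conjTranspose_submatrix]
  congr 1
  have := Matrix.conjTranspose_kronecker A (1 : Op (Λ \ Λ'))
  rw [Matrix.conjTranspose_one] at this
  exact this

theorem embed_apply (h : Λ' ⊆ Λ) (A : Op Λ') (s s' : Config Λ) :
    embed h A s s' = if (splitConfig h s).2 = (splitConfig h s').2 then
      A (splitConfig h s).1 (splitConfig h s').1 else 0 := by
  simp [embed, Matrix.kronecker, Matrix.kroneckerMap_apply, Matrix.one_apply]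

theorem embed_sum_smul {κ : Type*} [Fintype κ] (h : Λ' ⊆ Λ) (c : κ → ℂ) (A : κ → Op Λ') :
    embed h (∑ i, c i • A i) = ∑ i, c i • embed h (A i) := by
  ext s s'
  rw [embed_apply, Matrix.sum_apply, Matrix.sum_apply]
  by_cases e : (splitConfig h s).2 = (splitConfig h s').2
  · rw [if_pos e]
    exact Finset.sum_congr rfl fun i _ => by
      rw [Matrix.smul_apply, Matrix.smul_apply, embed_apply, if_pos e]
  · rw [if_neg e]
    exact (Finset.sum_eq_zero fun i _ => by
      rw [Matrix.smul_apply, embed_apply, if_neg e, smul_zero]).symm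

theorem embed_mulVec (h : Λ' ⊆ Λ) (A : Op Λ') (v : Config Λ → ℂ) (s : Config Λ) :
    (embed h A *ᵥ v) s =
      ∑ x, A (splitConfig h s).1 x * v ((splitConfig h).symm (x, (splitConfig h s).2)) := by
  rw [Matrix.mulVec, dotProduct, ← (splitConfig h).symm.sum_comp, Fintype.sum_prod_type]
  refine Finset.sum_congr rfl fun x _ => ?_
  rw [Finset.sum_eq_single (splitConfig h s).2]
  · simp [embed_apply]
  · intro u _ hu
    rw [embed_apply, Equiv.apply_symm_apply, if_neg (Ne.symm hu), zero_mul]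
  · simp

/-- The inclusion of sites. -/
def inclSite (h : Λ' ⊆ Λ) : Λ' ↪ Λ := ⟨fun i => ⟨i, h i.2⟩, fun i j e => by
  exact Subtype.ext (congrArg (fun k : Λ => (k : ℕ)) e)⟩

theorem embed_siteOp (h : Λ' ⊆ Λ) (j : Λ') (A : Matrix (Fin 2) (Fin 2) ℂ) :
    embed h (siteOp j A) = siteOp (inclSite h j) A := by
  ext s s'
  rw [embed_apply, siteOp_apply, siteOp_apply]
  have : (∀ i, i ≠ inclSite h j → s i = s' i) ↔
      (splitConfig h s).2 = (splitConfig h s').2 ∧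
        ∀ i, i ≠ j → (splitConfig h s).1 i = (splitConfig h s').1 i := by
    constructor
    · intro hs
      refine ⟨?_, ?_⟩
      · funext i
        refine hs _ fun e => (Finset.mem_sdiff.1 i.2).2 ?_
        have e' : (i : ℕ) = j := congrArg Subtype.val e
        rw [e']; exact j.2
      · intro i hi
        refine hs _ fun e => hi ?_
        exact (inclSite h).injective e
    · rintro ⟨h1, h2⟩ i hi
      by_cases hi' : (i : ℕ) ∈ Λ'
      · exact h2 ⟨i, hi'⟩ (by rintro rfl; exact hi rfl)
      · exact congrFun h1 ⟨i, Finset.mem_sdiff.2 ⟨i.2, hi'⟩⟩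
  simp only [this]
  by_cases h1 : (splitConfig h s).2 = (splitConfig h s').2
  · simp only [h1, true_and, if_true]; rfl
  · simp [h1]

theorem embed_parityOp (h : Λ' ⊆ Λ) (T : Finset Λ') :
    embed h (parityOp T) = parityOp (T.map (inclSite h)) := by
  ext s s'
  rw [embed_apply, parityOp, parityOp, Matrix.diagonal_apply, Matrix.diagonal_apply]
  by_cases e : s = s'
  · subst e; simp only [if_true, Finset.prod_map]; rfl
  · have : ¬((splitConfig h s).2 = (splitConfig h s').2 ∧
        (splitConfig h s).1 = (splitConfig h s').1) := fun h1 =>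
      e ((splitConfig h).injective (Prod.ext h1.2 h1.1))
    rw [if_neg e]
    split_ifs with h1 h2
    · exact absurd ⟨h1, h2⟩ this
    · rfl
    · rfl

/-- `Λ'` is the part of `Λ` from `a` up to some point. -/
def IsSegment (Λ Λ' : Finset ℕ) (a : ℕ) : Prop :=
  (∀ j ∈ Λ', a ≤ j) ∧ ∀ i ∈ Λ, ∀ j ∈ Λ', a ≤ i → i < j → i ∈ Λ'

/-- The inclusion of the labels of the Jordan-Wigner operators. -/
def incl (h : Λ' ⊆ Λ) (p : Λ' × Fin 2) : Λ × Fin 2 := (inclSite h p.1, p.2)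

theorem incl_injective (h : Λ' ⊆ Λ) : Function.Injective (incl h) := by
  rintro ⟨i, x⟩ ⟨j, y⟩ e
  simp only [incl, Prod.mk.injEq, EmbeddingLike.apply_eq_iff_eq] at e
  rw [e.1, e.2]

/-- The Jordan-Wigner string to the left of `a`. -/
def leftString (Λ : Finset ℕ) (a : ℕ) : Op Λ := parityOp (Finset.univ.filter fun i => (i : ℕ) < a)

theorem leftString_mul_self (a : ℕ) : leftString Λ a * leftString Λ a = 1 := parityOp_mul_self _

/-- For a segment, the string in the large chain is the string inside the segment times a fixed
string to its left. -/
theorem fermi_incl (h : Λ' ⊆ Λ) {a : ℕ} (hs : IsSegment Λ Λ' a) (p : Λ' × Fin 2) :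
    fermi (incl h p) = leftString Λ a * embed h (fermi p) := by
  have h1 : sitesBelow (incl h p).1 =
      (Finset.univ.filter fun i : Λ => (i : ℕ) < a) ∪ (sitesBelow p.1).map (inclSite h) := by
    ext i
    simp only [mem_sitesBelow, Finset.mem_union, Finset.mem_filter, Finset.mem_univ, true_and,
      Finset.mem_map]
    have hp := hs.1 p.1 p.1.2
    constructor
    · intro hi
      have hi' : (i : ℕ) < p.1 := hi
      by_cases ha : (i : ℕ) < a
      · exact Or.inl ha
      · exact Or.inr ⟨⟨i, hs.2 i i.2 p.1 p.1.2 (not_lt.1 ha) hi'⟩, hi', rfl⟩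
    · rintro (hi | ⟨k, hk, rfl⟩)
      · exact Subtype.coe_lt_coe.1 (lt_of_lt_of_le hi hp)
      · exact hk
  have h2 : Disjoint (Finset.univ.filter fun i : Λ => (i : ℕ) < a)
      ((sitesBelow p.1).map (inclSite h)) := by
    rw [Finset.disjoint_left]
    intro i hi hi2
    obtain ⟨k, -, rfl⟩ := Finset.mem_map.1 hi2
    exact absurd (Finset.mem_filter.1 hi).2 (not_lt.2 (hs.1 k k.2))
  rw [fermi, h1, parityOp_disjUnion h2, fermi, embed_mul, embed_parityOp, embed_siteOp, mul_assoc]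
  rfl

theorem leftString_comm_embed (h : Λ' ⊆ Λ) {a : ℕ} (hs : IsSegment Λ Λ' a) (p : Λ' × Fin 2) :
    leftString Λ a * embed h (fermi p) = embed h (fermi p) * leftString Λ a := by
  rw [fermi, embed_mul, embed_parityOp, embed_siteOp, leftString, ← mul_assoc, parityOp_comm,
    mul_assoc, parityOp_commute_siteOp, mul_assoc]
  simp only [Finset.mem_filter, Finset.mem_univ, true_and, not_lt]
  exact hs.1 p.1 p.1.2

/-- The two left strings cancel, so two-point functions inside a segment are seen by the reduced
state even though single fermions are not local. -/
theorem fermi_mul_star_incl (h : Λ' ⊆ Λ) {a : ℕ} (hs : IsSegment Λ Λ' a) (p q : Λ' × Fin 2) :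
    fermi (incl h p) * (fermi (incl h q))ᴴ = embed h (fermi p * (fermi q)ᴴ) := by
  have e1 := leftString_comm_embed h hs (bar q)
  have e2 := leftString_mul_self (Λ := Λ) a
  have e3 : (leftString Λ a)ᴴ = leftString Λ a := parityOp_conjTranspose _
  rw [fermi_incl h hs, fermi_incl h hs, leftString_comm_embed h hs p, Matrix.conjTranspose_mul,
    embed_conjTranspose, fermi_conjTranspose, embed_mul, e3, mul_assoc,
    ← mul_assoc (leftString Λ a), e1, mul_assoc, e2, mul_one]

/-! ### Partial traces -/

theorem trace_partialTrace_mul (h : Λ' ⊆ Λ) (ρ : Op Λ) (A : Op Λ') :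
    (partialTrace Λ' ρ * A).trace = (ρ * embed h A).trace := by
  simp only [Matrix.trace, Matrix.diag, Matrix.mul_apply]
  rw [← (splitConfig h).symm.sum_comp, Fintype.sum_prod_type]
  refine Finset.sum_congr rfl fun s _ => ?_
  simp only [partialTrace, Matrix.of_apply, Finset.sum_mul]
  rw [Finset.sum_comm]
  refine Finset.sum_congr rfl fun u _ => ?_
  rw [← (splitConfig h).symm.sum_comp, Fintype.sum_prod_type]
  refine Finset.sum_congr rfl fun s' _ => ?_
  rw [Finset.sum_eq_single u]
  · rw [embed_apply]; simp only [Equiv.apply_symm_apply, if_true]; rfl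
  · intro u' _ hu
    rw [embed_apply]; simp only [Equiv.apply_symm_apply]
    rw [if_neg hu, mul_zero]
  · simp

theorem trace_pureState_mul (ψ : Config Λ → ℂ) (A : Op Λ) :
    (pureState ψ * A).trace = star ψ ⬝ᵥ (A *ᵥ ψ) := by
  rw [pureState, Matrix.vecMulVec_mul, Matrix.trace_vecMulVec, dotProduct_comm,
    Matrix.dotProduct_mulVec]

theorem embed_one (h : Λ' ⊆ Λ) : embed h 1 = 1 := by
  rw [embed]
  have := Matrix.one_kronecker_one (α := ℂ) (m := Config Λ') (n := Config (Λ \ Λ'))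
  change (Matrix.kroneckerMap _ _ _).submatrix _ _ = _
  rw [this, Matrix.submatrix_one_equiv]

open scoped ComplexOrder in
theorem partialTrace_pureState_posSemidef (ψ : Config Λ → ℂ) :
    (partialTrace Λ' (pureState ψ)).PosSemidef := by
  have : partialTrace Λ' (pureState ψ) =
      ∑ u : Config (Λ \ Λ'),
        Matrix.vecMulVec (fun s => ψ (glue s u)) (star fun s => ψ (glue s u)) := by
    ext s s'
    simp [partialTrace, pureState, Matrix.vecMulVec_apply, Matrix.sum_apply]
  rw [this]
  exact Matrix.posSemidef_sum _ fun u _ => Matrix.posSemidef_vecMulVec_self_star _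

end Embedding

/-! ### Product states -/

section Products

variable {n m : ℕ} (d : Decomposition n m)

theorem Decomposition.exists_block {j : ℕ} (hj : j < n) : ∃ k, j ∈ d.block k := by
  have key : ∀ i : Fin (m + 1), j < d.r i → ∃ k, j ∈ d.block k := by
    intro i
    induction i using Fin.induction with
    | zero => intro h; rw [d.first] at h; omega
    | succ i ih =>
      intro h
      by_cases hi : j < d.r i.castSucc
      · exact ih hi
      · exact ⟨i, Finset.mem_Ico.2 ⟨not_lt.1 hi, h⟩⟩
  exact key (Fin.last m) (by rw [d.last]; exact hj)

theorem Decomposition.block_unique {j : ℕ} {k l : Fin m} (hk : j ∈ d.block k) (hl : j ∈ d.block l) :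
    k = l := by
  have key : ∀ {k l : Fin m}, k < l → j ∈ d.block k → j ∈ d.block l → False := by
    intro k l hkl hk hl
    have h1 := (Finset.mem_Ico.1 hk).2
    have h2 := (Finset.mem_Ico.1 hl).1
    have h3 : d.r k.succ ≤ d.r l.castSucc := d.strictMono.monotone (by
      rw [Fin.le_def]; simpa using hkl)
    omega
  rcases lt_trichotomy k l with h | h | h
  · exact (key h hk hl).elim
  · exact h
  · exact (key h hl hk).elim

theorem Decomposition.isSegment_block (k : Fin m) :
    IsSegment (Finset.range n) (d.block k) (d.r k.castSucc) := by
  refine ⟨fun j hj => (Finset.mem_Ico.1 hj).1, fun i _ j hj h1 h2 => ?_⟩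
  exact Finset.mem_Ico.2 ⟨h1, h2.trans (Finset.mem_Ico.1 hj).2⟩

/-- The restriction of a configuration to a block. -/
def blockConfig (k : Fin m) (s : Config (Finset.range n)) : Config (d.block k) :=
  fun i => s ⟨i, d.block_subset k i.2⟩

theorem bijective_blockConfig :
    Function.Bijective fun (s : Config (Finset.range n)) (k : Fin m) => blockConfig d k s := by
  constructor
  · intro s s' h
    funext j
    obtain ⟨k, hk⟩ := d.exists_block (Finset.mem_range.1 j.2)
    exact congrFun (congrFun h k) ⟨j, hk⟩
  · intro f
    choose k hk using fun j : Finset.range n => d.exists_block (Finset.mem_range.1 j.2)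
    refine ⟨fun j => f (k j) ⟨j, hk j⟩, ?_⟩
    funext l i
    simp only [blockConfig]
    have key : ∀ l' (h' : (i : ℕ) ∈ d.block l'), l' = l → f l' ⟨i, h'⟩ = f l i := by
      rintro l' h' rfl; rfl
    exact key _ _ (d.block_unique (hk _) i.2)

/-- The tensor product of vectors on the blocks of a decomposition. -/
def productVector (ψ : ∀ k, Config (d.block k) → ℂ) : Config (Finset.range n) → ℂ :=
  fun s => ∏ k, ψ k (blockConfig d k s)

theorem productState_pureState (ψ : ∀ k, Config (d.block k) → ℂ) :
    productState d (fun k => pureState (ψ k)) = pureState (productVector d ψ) := by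
  ext s s'
  simp only [productState, pureState, Matrix.of_apply, Matrix.vecMulVec_apply, productVector,
    Pi.star_apply, star_prod, ← Finset.prod_mul_distrib]
  rfl

theorem norm_productVector {ψ : ∀ k, Config (d.block k) → ℂ} (h : ∀ k, star (ψ k) ⬝ᵥ ψ k = 1) :
    star (productVector d ψ) ⬝ᵥ productVector d ψ = 1 := by
  simp only [dotProduct, Pi.star_apply, productVector, star_prod, ← Finset.prod_mul_distrib]
  have e := (Equiv.ofBijective _ (bijective_blockConfig d)).sum_comp
    (fun f : ∀ k, Config (d.block k) => ∏ k, star (ψ k (f k)) * ψ k (f k))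
  refine e.trans ?_
  rw [← Fintype.prod_sum (fun k (x : Config (d.block k)) => star (ψ k x) * ψ k x)]
  exact Finset.prod_eq_one fun k _ => h k

/-- The embedded operator acts on the factor `ψ k` alone; the remaining factors come out of the sum.
-/
theorem embed_mulVec_productVector {ψ : ∀ k, Config (d.block k) → ℂ} {k : Fin m}
    {A : Op (d.block k)} (hA : A *ᵥ ψ k = 0) :
    embed (d.block_subset k) A *ᵥ productVector d ψ = 0 := by
  funext s
  rw [embed_mulVec]
  have key : ∀ x, productVector d ψ
      ((splitConfig (d.block_subset k)).symm (x, (splitConfig (d.block_subset k) s).2)) =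
      ψ k x * ∏ l ∈ Finset.univ.erase k, ψ l (blockConfig d l s) := by
    intro x
    rw [productVector, ← Finset.mul_prod_erase _ _ (Finset.mem_univ k)]
    congr 1
    · congr 1
      funext i
      change glue x _ _ = _
      simp [glue]
    · refine Finset.prod_congr rfl fun l hl => ?_
      congr 1
      funext i
      change glue x _ _ = _
      have hi : (i : ℕ) ∉ d.block k := fun hi => (Finset.ne_of_mem_erase hl) (d.block_unique i.2 hi)
      simp only [glue]
      rw [dif_neg hi]
      rfl
  simp only [key, ← mul_assoc]
  rw [← Finset.sum_mul]
  have := congrFun hA (splitConfig (d.block_subset k) s).1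
  simp only [Matrix.mulVec, dotProduct, Pi.zero_apply] at this
  rw [this, zero_mul]
  rfl

end Products

/-! ### Quasi-free product states -/

theorem dotProduct_mul_conjTranspose {Λ : Finset ℕ} (A B : Op Λ) (ψ : Config Λ → ℂ) :
    star ψ ⬝ᵥ ((A * Bᴴ) *ᵥ ψ) = star (Aᴴ *ᵥ ψ) ⬝ᵥ (Bᴴ *ᵥ ψ) := by
  rw [← dotProduct_mulVec_conjTranspose, Matrix.conjTranspose_conjTranspose, Matrix.mulVec_mulVec]

theorem IsVacuum.isHermitian {Λ : Finset ℕ} {P : Matrix (Λ × Fin 2) (Λ × Fin 2) ℂ}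
    {ψ : Config Λ → ℂ} (h : IsVacuum P ψ) (h1 : star ψ ⬝ᵥ ψ = 1) : P.IsHermitian := by
  ext p q
  rw [Matrix.conjTranspose_apply, ← h.covariance h1, ← h.covariance h1,
    dotProduct_mul_conjTranspose, dotProduct_mul_conjTranspose, ← Matrix.star_dotProduct]

/-- `IsVacuum` does not require a projection; this comes from the existence of a normalized vacuum.
P is the Gram matrix of the vectors obtained by applying adjoint modes to ψ, and these do not change
when the argument is replaced by its image under P. -/
theorem IsVacuum.mul_self {Λ : Finset ℕ} {P : Matrix (Λ × Fin 2) (Λ × Fin 2) ℂ}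
    {ψ : Config Λ → ℂ} (h : IsVacuum P ψ) (h1 : star ψ ⬝ᵥ ψ = 1) : P * P = P := by
  have hP := h.isHermitian h1
  have key : ∀ x w, star (P *ᵥ x) ⬝ᵥ (P *ᵥ w) = star x ⬝ᵥ (P *ᵥ w) := by
    intro x w
    have e : (mode (P *ᵥ x))ᴴ *ᵥ ψ = (mode x)ᴴ *ᵥ ψ := by
      have := (h x).2
      rw [mode_sub, Matrix.conjTranspose_sub, Matrix.sub_mulVec, sub_eq_zero] at this
      exact this.symm
    rw [← h.covariance_mode h1, ← h.covariance_mode h1, dotProduct_mul_conjTranspose,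
      dotProduct_mul_conjTranspose, e]
  ext p q
  have := key (Pi.single p 1) (Pi.single q 1)
  rw [← dotProduct_mulVec_conjTranspose, hP.eq, Matrix.mulVec_mulVec] at this
  simpa [Pi.star_single] using this

theorem isVacuum_of_single {Λ : Finset ℕ} {P : Matrix (Λ × Fin 2) (Λ × Fin 2) ℂ}
    {ψ : Config Λ → ℂ}
    (h : ∀ q, mode (fun p => P p q) *ᵥ ψ = 0 ∧
      (mode (Pi.single q 1 - fun p => P p q))ᴴ *ᵥ ψ = 0) : IsVacuum P ψ := by
  intro v
  have hv : P *ᵥ v = ∑ q, v q • fun p => P p q := by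
    funext p; simp [Matrix.mulVec, dotProduct, mul_comm]
  have hv2 : v = ∑ q, v q • Pi.single q 1 := by
    funext p; simp [Finset.sum_apply, Pi.single_apply]
  constructor
  · rw [hv, mode_sum, Matrix.sum_mulVec]
    refine Finset.sum_eq_zero fun q _ => ?_
    rw [mode_smul, Matrix.smul_mulVec, (h q).1, smul_zero]
  · rw [hv]
    nth_rewrite 1 [hv2]
    rw [← Finset.sum_sub_distrib, mode_sum, Matrix.conjTranspose_sum, Matrix.sum_mulVec]
    refine Finset.sum_eq_zero fun q _ => ?_
    rw [← smul_sub, mode_smul, Matrix.conjTranspose_smul, Matrix.smul_mulVec, (h q).2, smul_zero]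

/-- Extension by zero of a one-particle vector. -/
def extendVec {Λ Λ' : Finset ℕ} (h : Λ' ⊆ Λ) (v : Λ' × Fin 2 → ℂ) : Λ × Fin 2 → ℂ :=
  Function.extend (incl h) v 0

theorem mode_extendVec {Λ Λ' : Finset ℕ} (h : Λ' ⊆ Λ) {a : ℕ} (hs : IsSegment Λ Λ' a)
    (v : Λ' × Fin 2 → ℂ) : mode (extendVec h v) = leftString Λ a * embed h (mode v) := by
  rw [mode, mode, embed_sum_smul, Finset.mul_sum]
  refine (Fintype.sum_of_injective (incl h) (incl_injective h) _ _ ?_ ?_).symm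
  · intro p hp
    have : extendVec h v p = 0 := Function.extend_apply' _ _ _ (by simpa using hp)
    rw [this, star_zero, zero_smul]
  · intro p
    rw [extendVec, (incl_injective h).extend_apply, fermi_incl h hs, mul_smul_comm]

/-! ### Block diagonal projections of product states. -/

section Products

variable {n m : ℕ} (d : Decomposition n m)

/-- The block diagonal one-particle operator with given blocks. -/
def blockDiag (P : ∀ k, Matrix (d.block k × Fin 2) (d.block k × Fin 2) ℂ) :
    Matrix (Finset.range n × Fin 2) (Finset.range n × Fin 2) ℂ :=
  Matrix.of fun p q => ∑ k, extendVec (d.block_subset k)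
    (fun p' => extendVec (d.block_subset k) (P k p') q) p

theorem extendVec_eq_zero {Λ Λ' : Finset ℕ} (h : Λ' ⊆ Λ) (v : Λ' × Fin 2 → ℂ) {p : Λ × Fin 2}
    (hp : (p.1 : ℕ) ∉ Λ') : extendVec h v p = 0 := by
  refine Function.extend_apply' _ _ _ ?_
  rintro ⟨q, rfl⟩
  exact hp q.1.2

theorem extendVec_incl {Λ Λ' : Finset ℕ} (h : Λ' ⊆ Λ) (v : Λ' × Fin 2 → ℂ) (p : Λ' × Fin 2) :
    extendVec h v (incl h p) = v p := (incl_injective h).extend_apply _ _ _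

theorem exists_incl_block (p : Finset.range n × Fin 2) :
    ∃ k p', p = incl (d.block_subset k) p' := by
  obtain ⟨k, hk⟩ := d.exists_block (Finset.mem_range.1 p.1.2)
  exact ⟨k, (⟨p.1, hk⟩, p.2), rfl⟩

theorem blockDiag_incl (P : ∀ k, Matrix (d.block k × Fin 2) (d.block k × Fin 2) ℂ) (k : Fin m)
    (q : d.block k × Fin 2) (p : Finset.range n × Fin 2) :
    blockDiag d P p (incl (d.block_subset k) q) =
      extendVec (d.block_subset k) (fun p' => P k p' q) p := by
  rw [blockDiag, Matrix.of_apply, Finset.sum_eq_single k]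
  · simp only [extendVec_incl]
  · intro l _ hl
    have : ∀ p', extendVec (d.block_subset l) (P l p') (incl (d.block_subset k) q) = 0 :=
      fun p' => extendVec_eq_zero _ _ fun h => hl (d.block_unique h q.1.2)
    simp only [this]
    by_cases hp : (p.1 : ℕ) ∈ d.block l
    · exact extendVec_incl (d.block_subset l) (fun _ => 0) (⟨p.1, hp⟩, p.2)
    · exact extendVec_eq_zero _ _ hp
  · simp

theorem isVacuum_productVector {P : ∀ k, Matrix (d.block k × Fin 2) (d.block k × Fin 2) ℂ}
    {ψ : ∀ k, Config (d.block k) → ℂ} (h : ∀ k, IsVacuum (P k) (ψ k)) :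
    IsVacuum (blockDiag d P) (productVector d ψ) := by
  -- The string to the left of the block acts after the embedded mode, which already gives zero.
  have kill : ∀ k (w : d.block k × Fin 2 → ℂ), mode w *ᵥ ψ k = 0 →
      mode (extendVec (d.block_subset k) w) *ᵥ productVector d ψ = 0 := by
    intro k w hw
    rw [mode_extendVec _ (d.isSegment_block k), ← Matrix.mulVec_mulVec,
      embed_mulVec_productVector d hw, Matrix.mulVec_zero]
  refine isVacuum_of_single fun q => ?_
  obtain ⟨k, q, rfl⟩ := exists_incl_block d q
  have e : (fun p => blockDiag d P p (incl (d.block_subset k) q)) =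
      extendVec (d.block_subset k) (P k *ᵥ Pi.single q 1) := by
    funext p
    rw [blockDiag_incl, Matrix.mulVec_single_one]
    rfl
  rw [e]
  refine ⟨kill k _ (h k _).1, ?_⟩
  have e2 : (Pi.single (incl (d.block_subset k) q) 1 - extendVec (d.block_subset k)
      (P k *ᵥ Pi.single q 1) : Finset.range n × Fin 2 → ℂ) =
      extendVec (d.block_subset k) (Pi.single q 1 - P k *ᵥ Pi.single q 1) := by
    funext p
    by_cases hp : (p.1 : ℕ) ∈ d.block k
    · obtain ⟨p, rfl⟩ : ∃ p', p = incl (d.block_subset k) p' := ⟨(⟨p.1, hp⟩, p.2), rfl⟩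
      rw [Pi.sub_apply, extendVec_incl, extendVec_incl, Pi.sub_apply, Pi.single_apply,
        Pi.single_apply]
      simp only [(incl_injective (d.block_subset k)).eq_iff]
    · rw [Pi.sub_apply, extendVec_eq_zero _ _ hp, extendVec_eq_zero _ _ hp, Pi.single_apply,
        if_neg, sub_zero]
      rintro rfl
      exact hp q.1.2
  -- The adjoint of a mode is the mode of the conjugate vector, and extension by zero respects the
  -- conjugation; so `kill` also covers adjoints.
  have e3 : ∀ w : d.block k × Fin 2 → ℂ, conjBar (extendVec (d.block_subset k) w) =
      extendVec (d.block_subset k) (conjBar w) := by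
    intro w
    funext p
    by_cases hp : (p.1 : ℕ) ∈ d.block k
    · obtain ⟨p, rfl⟩ : ∃ p', p = incl (d.block_subset k) p' := ⟨(⟨p.1, hp⟩, p.2), rfl⟩
      rw [extendVec_incl]
      exact congrArg star (extendVec_incl (d.block_subset k) w (bar p))
    · rw [extendVec_eq_zero _ _ hp]
      exact (congrArg star (extendVec_eq_zero (p := bar p) _ _ hp)).trans (star_zero _)
  rw [e2, mode_conjTranspose, e3]
  refine kill k _ ?_
  rw [← mode_conjTranspose]
  exact (h k _).2

end Products

/-! ### Subadditivity of the entropy with respect to fermionic modes -/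

/-- Pointwise Gibbs inequality, from log t ≤ t - 1 at t = y / x. -/
theorem negMulLog_le_of_pos {x y : ℝ} (hx : 0 ≤ x) (hy : 0 < y) :
    Real.negMulLog x ≤ -x * Real.log y + y - x := by
  rcases hx.eq_or_lt with rfl | hx
  · simpa using hy.le
  · have h := Real.log_le_sub_one_of_pos (div_pos hy hx)
    rw [Real.log_div hy.ne' hx.ne'] at h
    have h2 := mul_le_mul_of_nonneg_left h hx.le
    have h3 : x * (y / x - 1) = y - x := by field_simp
    rw [h3] at h2
    unfold Real.negMulLog
    linarith

/-- Gibbs' inequality. The distribution `r` is smeared by the doubly stochastic `w` to a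
distribution `p` on occupation numbers, which is compared with the product `q` of the marginals of
`p`. The cross entropy of `p` relative to `q` splits into the binary entropies of the marginals `ξ
j`. -/
theorem sum_negMulLog_le_of_doublyStochastic {I J : Type*} [Fintype I] [Fintype J] [DecidableEq J]
    (r : I → ℝ) (hr : ∀ i, 0 ≤ r i) (hr1 : ∑ i, r i = 1) (w : (J → Bool) → I → ℝ)
    (hw : ∀ α i, 0 ≤ w α i) (hw1 : ∀ i, ∑ α, w α i = 1) (hw2 : ∀ α, ∑ i, w α i = 1)
    (ξ : J → ℝ) (hξ : ∀ j, ξ j = ∑ α : J → Bool, if α j then ∑ i, w α i * r i else 0) :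
    ∑ i, Real.negMulLog (r i) ≤ ∑ j, (Real.negMulLog (ξ j) + Real.negMulLog (1 - ξ j)) := by
  set p : (J → Bool) → ℝ := fun α => ∑ i, w α i * r i with hp
  have hp0 : ∀ α, 0 ≤ p α := fun α => Finset.sum_nonneg fun i _ => mul_nonneg (hw α i) (hr i)
  have hp1 : ∑ α, p α = 1 := by
    simp only [hp]
    rw [Finset.sum_comm]
    simp only [← Finset.sum_mul, hw1, one_mul, hr1]
  set c : J → Bool → ℝ := fun j b => if b then ξ j else 1 - ξ j with hc
  have hcp : ∀ j b, c j b = ∑ α : J → Bool, if α j = b then p α else 0 := by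
    intro j b
    cases b
    · simp only [hc, Bool.false_eq_true, if_false]
      rw [← hp1, hξ, ← Finset.sum_sub_distrib]
      refine Finset.sum_congr rfl fun α _ => ?_
      cases α j <;> simp [hp]
    · simp only [hc, if_true]
      exact hξ j
  have hc0 : ∀ j b, 0 ≤ c j b := fun j b => by
    rw [hcp]; exact Finset.sum_nonneg fun α _ => by split_ifs <;> simp [hp0]
  have hpc : ∀ α j, p α ≤ c j (α j) := by
    intro α j
    rw [hcp]
    refine le_trans (by simp) (Finset.single_le_sum (f := fun β : J → Bool =>
      if β j = α j then p β else 0) (fun β _ => by split_ifs <;> simp [hp0]) (Finset.mem_univ α))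
  set q : (J → Bool) → ℝ := fun α => ∏ j, c j (α j) with hq
  have hq0 : ∀ α, 0 ≤ q α := fun α => Finset.prod_nonneg fun j _ => hc0 j _
  have hq1 : ∑ α, q α = 1 := by
    simp only [hq]
    rw [← Fintype.prod_sum c]
    exact Finset.prod_eq_one fun j _ => by simp [hc]
  -- A sum of logarithms instead of log q: it splits over `j` also where a factor vanishes, with log
  -- 0 = 0.
  set L : (J → Bool) → ℝ := fun α => ∑ j, Real.log (c j (α j)) with hL
  have key : ∀ α i, w α i * Real.negMulLog (r i) ≤ w α i * (-r i * L α + q α - r i) := by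
    intro α i
    by_cases h : ∀ j, c j (α j) ≠ 0
    · refine mul_le_mul_of_nonneg_left ?_ (hw α i)
      have hqpos : 0 < q α := Finset.prod_pos fun j _ => lt_of_le_of_ne (hc0 j _) (h j).symm
      have : L α = Real.log (q α) := (Real.log_prod fun j _ => h j).symm
      rw [this]
      exact negMulLog_le_of_pos (hr i) hqpos
    · push Not at h
      obtain ⟨j, hj⟩ := h
      -- A vanishing marginal forces p α = 0, so `w α i * r i` vanishes for every `i` and the value
      -- of `L` does not matter.
      have hpz : p α = 0 := le_antisymm (hj ▸ hpc α j) (hp0 α)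
      have := (Finset.sum_eq_zero_iff_of_nonneg fun i _ => mul_nonneg (hw α i) (hr i)).1 hpz i
        (Finset.mem_univ i)
      rcases mul_eq_zero.1 this with h0 | h0
      · simp [h0]
      · rw [h0]
        simpa using mul_nonneg (hw α i) (hq0 α)
  calc ∑ i, Real.negMulLog (r i) = ∑ i, ∑ α, w α i * Real.negMulLog (r i) := by
        simp only [← Finset.sum_mul, hw1, one_mul]
    _ ≤ ∑ i, ∑ α, w α i * (-r i * L α + q α - r i) :=
        Finset.sum_le_sum fun i _ => Finset.sum_le_sum fun α _ => key α i
    _ = ∑ α, (-(p α * L α) + q α) - ∑ i, r i := by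
        have e : ∀ i α, w α i * (-r i * L α + q α - r i) =
            (-(w α i * r i * L α) + w α i * q α) - w α i * r i := fun i α => by ring
        simp only [e, Finset.sum_sub_distrib]
        congr 1
        · rw [Finset.sum_comm]
          refine Finset.sum_congr rfl fun α _ => ?_
          rw [Finset.sum_add_distrib, Finset.sum_neg_distrib, ← Finset.sum_mul, ← Finset.sum_mul,
            hw2, one_mul]
        · simp only [← Finset.sum_mul, hw1, one_mul]
    _ = -∑ α, p α * L α := by
        rw [Finset.sum_add_distrib, hq1, hr1, Finset.sum_neg_distrib]; ring
    _ = ∑ j, (Real.negMulLog (ξ j) + Real.negMulLog (1 - ξ j)) := by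
        simp only [hL, Finset.mul_sum]
        rw [Finset.sum_comm, ← Finset.sum_neg_distrib]
        refine Finset.sum_congr rfl fun j _ => ?_
        have e : ∀ α : J → Bool, p α * Real.log (c j (α j)) =
            ∑ b, (if α j = b then p α else 0) * Real.log (c j b) := by
          intro α; simp
        simp only [e]
        rw [Finset.sum_comm]
        simp only [← Finset.sum_mul, ← hcp]
        simp [hc, Real.negMulLog]
        ring

/-! ### Traces in an eigenbasis. -/

section Trace

variable {ι : Type*} [Fintype ι] [DecidableEq ι] {A : Matrix ι ι ℂ} (hA : A.IsHermitian)

theorem trace_functionOf_mul (g : ℝ → ℂ) (X : Matrix ι ι ℂ) :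
    (functionOf hA g * X).trace =
      ∑ i, g (hA.eigenvalues i) * (star (eigvec hA i) ⬝ᵥ (X *ᵥ eigvec hA i)) := by
  simp only [Matrix.trace, Matrix.diag, Matrix.mul_apply, functionOf_apply, Finset.sum_mul,
    Matrix.mulVec, dotProduct, Finset.mul_sum, Pi.star_apply]
  rw [Finset.sum_congr rfl fun p _ => Finset.sum_comm, Finset.sum_comm]
  refine Finset.sum_congr rfl fun i _ => ?_
  rw [Finset.sum_comm]
  refine Finset.sum_congr rfl fun q _ => Finset.sum_congr rfl fun p _ => ?_
  ring

theorem functionOf_id : functionOf hA (fun x => (x : ℂ)) = A := by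
  conv_rhs => rw [hA.spectral_theorem]
  rw [Unitary.conjStarAlgAut_apply]
  rfl

theorem cfc_eq_functionOf (f : ℝ → ℝ) : cfc f A = functionOf hA fun x => (f x : ℂ) := by
  rw [hA.cfc_eq, Matrix.IsHermitian.cfc, Unitary.conjStarAlgAut_apply]
  rfl

end Trace

/-! ### Joint spectral projections of occupation numbers and subadditivity. -/

section Modes

variable {κ J : Type*} [Fintype κ]

/-- Orthogonal projections. -/
def IsOrthProj (X : Matrix κ κ ℂ) : Prop := X * X = X ∧ Xᴴ = X

theorem IsOrthProj.mul {X Y : Matrix κ κ ℂ} (hX : IsOrthProj X) (hY : IsOrthProj Y)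
    (h : X * Y = Y * X) : IsOrthProj (X * Y) := by
  refine ⟨?_, ?_⟩
  · calc X * Y * (X * Y) = X * (Y * X) * Y := by noncomm_ring
      _ = (X * X) * (Y * Y) := by rw [← h]; noncomm_ring
      _ = X * Y := by rw [hX.1, hY.1]
  · rw [Matrix.conjTranspose_mul, hX.2, hY.2, h]

theorem IsOrthProj.quadratic_form {X : Matrix κ κ ℂ} (hX : IsOrthProj X) (v : κ → ℂ) :
    0 ≤ (star v ⬝ᵥ (X *ᵥ v)).re := by
  have e : star v ⬝ᵥ (X *ᵥ v) = star (X *ᵥ v) ⬝ᵥ (X *ᵥ v) := by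
    rw [← dotProduct_mulVec_conjTranspose, hX.2, Matrix.mulVec_mulVec, hX.1]
  rw [e, dotProduct, Complex.re_sum]
  refine Finset.sum_nonneg fun i _ => ?_
  rw [Pi.star_apply, RCLike.star_def, ← Complex.normSq_eq_conj_mul_self, Complex.ofReal_re]
  exact Complex.normSq_nonneg _

variable [DecidableEq κ]

theorem IsOrthProj.one_sub {X : Matrix κ κ ℂ} (hX : IsOrthProj X) : IsOrthProj (1 - X) := by
  refine ⟨?_, ?_⟩
  · rw [sub_mul, mul_sub, mul_sub, hX.1]; simp
  · rw [Matrix.conjTranspose_sub, hX.2, Matrix.conjTranspose_one]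

/-- The joint spectral projections of a commuting family of projections, in a commutative ring that
contains them. -/
def jointProj {A : Type*} [CommRing A] (e : J → A) (s : Finset J) (α : J → Bool) : A :=
  ∏ j ∈ s, if α j then e j else 1 - e j

variable {A : Type*} [CommRing A] (φ : A →+* Matrix κ κ ℂ) {e : J → A}

theorem isOrthProj_jointProj (he : ∀ j, IsOrthProj (φ (e j))) (s : Finset J) (α : J → Bool) :
    IsOrthProj (φ (jointProj e s α)) := by
  refine Finset.prod_induction _ (fun x => IsOrthProj (φ x)) ?_ ?_ ?_
  · intro a b ha hb
    rw [map_mul]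
    exact ha.mul hb (by rw [← map_mul, mul_comm, map_mul])
  · rw [map_one]; exact ⟨mul_one _, Matrix.conjTranspose_one⟩
  · intro j _
    split_ifs
    · exact he j
    · rw [map_sub, map_one]; exact (he j).one_sub

variable {d : J → Matrix κ κ ℂ}

/-- Each further mode halves the trace. The projection X onto given occupations of the other modes
commutes with d_j, so by cyclicity d_j d_j* X and d_j* d_j X have equal trace, and they add up to X.
-/
theorem trace_jointProj [DecidableEq J] (h0 : ∀ i j, d i * d j + d j * d i = 0)
    (h1 : ∀ i j, d i * (d j)ᴴ + (d j)ᴴ * d i = if i = j then 1 else 0)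
    (hφ : ∀ j, φ (e j) = d j * (d j)ᴴ) (s : Finset J) (α : J → Bool) :
    (φ (jointProj e s α)).trace * 2 ^ s.card = Fintype.card κ := by
  induction s using Finset.induction_on with
  | empty => simp [jointProj]
  | insert j s hj ih =>
    have hcomm : ∀ i, i ≠ j → φ (e i) * d j = d j * φ (e i) := by
      intro i hi
      have a1 : d i * d j = -(d j * d i) := eq_neg_of_add_eq_zero_left (h0 i j)
      have a2 : (d i)ᴴ * d j = -(d j * (d i)ᴴ) := by
        refine eq_neg_of_add_eq_zero_right ?_
        rw [h1, if_neg (Ne.symm hi)]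
      rw [hφ, mul_assoc, a2, mul_neg, ← mul_assoc, a1]
      noncomm_ring
    set X := φ (jointProj e s α) with hX
    have hXd : X * d j = d j * X := by
      refine Finset.prod_induction _ (fun x => φ x * d j = d j * φ x) ?_ ?_ ?_
      · intro a b ha hb
        rw [map_mul, mul_assoc, hb, ← mul_assoc, ha, mul_assoc]
      · rw [map_one, one_mul, mul_one]
      · intro i hi
        have hij : i ≠ j := by rintro rfl; exact hj hi
        split_ifs
        · exact hcomm i hij
        · rw [map_sub, map_one, sub_mul, mul_sub, hcomm i hij, one_mul, mul_one]
    have hN : (φ (e j) * X).trace * 2 = X.trace := by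
      have e1 : (φ (e j) * X).trace = ((d j)ᴴ * d j * X).trace := by
        rw [hφ, mul_assoc, Matrix.trace_mul_comm, mul_assoc, hXd, ← mul_assoc]
      have e2 : (d j)ᴴ * d j = 1 - φ (e j) := by
        rw [hφ, eq_sub_iff_add_eq', h1, if_pos rfl]
      rw [e2, sub_mul, one_mul, Matrix.trace_sub] at e1
      linear_combination e1
    have hins : jointProj e (insert j s) α =
        (if α j then e j else 1 - e j) * jointProj e s α := Finset.prod_insert hj
    rw [hins, map_mul, Finset.card_insert_of_notMem hj, pow_succ, ← ih]
    split_ifs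
    · linear_combination (2 : ℂ) ^ s.card * hN
    · rw [map_sub, map_one, sub_mul, one_mul, Matrix.trace_sub]
      linear_combination -(2 : ℂ) ^ s.card * hN

variable [Fintype J] [DecidableEq J]

theorem sum_jointProj : ∑ α, jointProj e Finset.univ α = 1 := by
  unfold jointProj
  rw [← Fintype.prod_sum fun j (b : Bool) => if b then e j else 1 - e j]
  exact Finset.prod_eq_one fun j _ => by simp

theorem mul_jointProj (he : ∀ j, IsOrthProj (φ (e j))) (j : J) (α : J → Bool) :
    φ (e j) * φ (jointProj e Finset.univ α) =
      if α j then φ (jointProj e Finset.univ α) else 0 := by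
  have h : jointProj e Finset.univ α =
      (if α j then e j else 1 - e j) * ∏ i ∈ Finset.univ.erase j, if α i then e i else 1 - e i :=
    (Finset.mul_prod_erase _ _ (Finset.mem_univ j)).symm
  rw [h, map_mul, ← mul_assoc]
  by_cases hj : α j
  · simp only [hj, if_true]
    rw [(he j).1]
  · simp only [hj, Bool.false_eq_true, if_false]
    rw [map_sub, map_one, mul_sub, (he j).1, mul_one, sub_self, zero_mul]

theorem eq_sum_jointProj (he : ∀ j, IsOrthProj (φ (e j))) (j : J) :
    φ (e j) = ∑ α : J → Bool, if α j then φ (jointProj e Finset.univ α) else 0 := by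
  rw [← Finset.sum_congr rfl fun α _ => mul_jointProj φ he j α, ← Finset.mul_sum, ← map_sum,
    sum_jointProj, map_one, mul_one]

open scoped ComplexOrder in
/-- The entropy of a state is at most the sum of the entropies of the restrictions of the state to
the fermionic modes. -/
theorem entropy_le_sum_modes (h0 : ∀ i j, d i * d j + d j * d i = 0)
    (h1 : ∀ i j, d i * (d j)ᴴ + (d j)ᴴ * d i = if i = j then 1 else 0)
    (hcard : Fintype.card κ = 2 ^ Fintype.card J) {ρ : Matrix κ κ ℂ} (hρ : ρ.PosSemidef)
    (htr : ρ.trace = 1) :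
    (cfc Real.negMulLog ρ).trace.re ≤
      ∑ j, (Real.negMulLog (ρ * (d j * (d j)ᴴ)).trace.re +
        Real.negMulLog (1 - (ρ * (d j * (d j)ᴴ)).trace.re)) := by
  have hN : ∀ j, IsOrthProj (d j * (d j)ᴴ) := by
    intro j
    have hd : d j * d j = 0 := by
      have h := h0 j j
      rw [← two_smul ℂ] at h
      exact (smul_eq_zero.1 h).resolve_left two_ne_zero
    refine ⟨?_, by rw [Matrix.conjTranspose_mul, Matrix.conjTranspose_conjTranspose]⟩
    have e2 : (d j)ᴴ * d j = 1 - d j * (d j)ᴴ := by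
      rw [eq_sub_iff_add_eq', h1, if_pos rfl]
    calc d j * (d j)ᴴ * (d j * (d j)ᴴ) = d j * ((d j)ᴴ * d j) * (d j)ᴴ := by noncomm_ring
      _ = d j * (d j)ᴴ - (d j * d j) * (d j)ᴴ * (d j)ᴴ := by rw [e2]; noncomm_ring
      _ = d j * (d j)ᴴ := by rw [hd]; simp
  have hcomm : ∀ i j, d i * (d i)ᴴ * (d j * (d j)ᴴ) = d j * (d j)ᴴ * (d i * (d i)ᴴ) := by
    intro i j
    by_cases hij : i = j
    · rw [hij]
    have a1 : ∀ i j, d i * d j = -(d j * d i) := fun i j => eq_neg_of_add_eq_zero_left (h0 i j)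
    have a2 : ∀ i j, i ≠ j → (d i)ᴴ * d j = -(d j * (d i)ᴴ) := by
      intro i j hij
      refine eq_neg_of_add_eq_zero_right ?_
      rw [h1, if_neg (Ne.symm hij)]
    have a3 : d i * (d i)ᴴ * d j = d j * (d i * (d i)ᴴ) := by
      rw [mul_assoc, a2 i j hij, mul_neg, ← mul_assoc, a1]
      noncomm_ring
    have a4 := congrArg Matrix.conjTranspose a3
    simp only [Matrix.conjTranspose_mul, Matrix.conjTranspose_conjTranspose] at a4
    rw [← mul_assoc, a3, mul_assoc, ← a4, mul_assoc]
  -- The commuting occupation numbers generate a commutative algebra, in which the unordered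
  -- products defining `jointProj` make sense.
  let B := Algebra.adjoin ℂ (Set.range fun j => d j * (d j)ᴴ)
  have hB : IsMulCommutative B := Algebra.isMulCommutative_adjoin ℂ (by
    rintro _ ⟨i, rfl⟩ _ ⟨j, rfl⟩; exact hcomm i j)
  let _ : CommRing B := { (inferInstance : Ring B) with mul_comm := hB.is_comm.comm }
  let φ : B →+* Matrix κ κ ℂ := B.val.toRingHom
  let e : J → B := fun j => ⟨d j * (d j)ᴴ, Algebra.subset_adjoin ⟨j, rfl⟩⟩
  have hφ : ∀ j, φ (e j) = d j * (d j)ᴴ := fun j => rfl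
  have he : ∀ j, IsOrthProj (φ (e j)) := fun j => by rw [hφ]; exact hN j
  have hA := hρ.isHermitian
  set P : (J → Bool) → Matrix κ κ ℂ := fun α => φ (jointProj e Finset.univ α) with hP
  set f := eigvec hA with hf
  have hρtr : ∀ X : Matrix κ κ ℂ, (ρ * X).trace.re =
      ∑ i, (star (f i) ⬝ᵥ (X *ᵥ f i)).re * hA.eigenvalues i := by
    intro X
    have := trace_functionOf_mul hA (fun x => (x : ℂ)) X
    rw [functionOf_id] at this
    rw [this, Complex.re_sum]
    exact Finset.sum_congr rfl fun i _ => by rw [Complex.re_ofReal_mul, mul_comm]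
  have hent : (cfc Real.negMulLog ρ).trace.re = ∑ i, Real.negMulLog (hA.eigenvalues i) := by
    have := trace_functionOf_mul hA (fun x => (Real.negMulLog x : ℂ)) 1
    rw [mul_one] at this
    rw [cfc_eq_functionOf hA, this, Complex.re_sum]
    refine Finset.sum_congr rfl fun i _ => ?_
    rw [Matrix.one_mulVec, eigvec_orthonormal, if_pos rfl, mul_one, Complex.ofReal_re]
  have htrX : ∀ X : Matrix κ κ ℂ, X.trace = ∑ i, star (f i) ⬝ᵥ (X *ᵥ f i) := by
    intro X
    have := trace_functionOf_mul hA (fun _ => 1) X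
    simpa [functionOf_one] using this
  rw [hent]
  -- The weights are the expectations of the joint projections in the eigenvectors of ρ.
  refine sum_negMulLog_le_of_doublyStochastic _ hρ.eigenvalues_nonneg ?_
    (fun α i => (star (f i) ⬝ᵥ (P α *ᵥ f i)).re) ?_ ?_ ?_ _ ?_
  · have := hρtr 1
    rw [mul_one, htr] at this
    simpa [hf, eigvec_orthonormal] using this.symm
  · exact fun α i => (isOrthProj_jointProj φ he _ _).quadratic_form _
  · intro i
    rw [← Complex.re_sum, ← dotProduct_sum, ← Matrix.sum_mulVec, hP, ← map_sum, sum_jointProj,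
      map_one, Matrix.one_mulVec, eigvec_orthonormal, if_pos rfl, Complex.one_re]
  · intro α
    have h2 := trace_jointProj φ h0 h1 hφ Finset.univ α
    rw [hcard, Finset.card_univ] at h2
    push_cast at h2
    -- The dimension is exactly two to the number of modes, so every joint projection has trace one;
    -- this is the second half of double stochasticity.
    have h3 : (P α).trace = 1 := by
      have : (2 : ℂ) ^ Fintype.card J ≠ 0 := pow_ne_zero _ two_ne_zero
      exact mul_right_cancel₀ this (by rw [h2, one_mul])
    rw [← Complex.re_sum, ← htrX, h3, Complex.one_re]
  · intro j
    rw [← hφ, eq_sum_jointProj φ he j, Finset.mul_sum, Matrix.trace_sum, Complex.re_sum]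
    refine Finset.sum_congr rfl fun α _ => ?_
    split_ifs
    · exact hρtr _
    · simp

end Modes

/-! ### Diagonalization compatible with the particle-hole symmetry -/

section ParticleHole

theorem exists_normalize {κ : Type*} [Fintype κ] {u : κ → ℂ} (hu : u ≠ 0) :
    ∃ c : ℂ, star (c • u) ⬝ᵥ (c • u) = 1 := by
  set N : ℝ := ∑ i, Complex.normSq (u i) with hN
  have hN0 : 0 < N := by
    obtain ⟨i, hi⟩ := Function.ne_iff.1 hu
    exact Finset.sum_pos' (fun i _ => Complex.normSq_nonneg _)
      ⟨i, Finset.mem_univ i, Complex.normSq_pos.2 hi⟩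
  have hNu : star u ⬝ᵥ u = (N : ℂ) := by
    rw [dotProduct, hN, Complex.ofReal_sum]
    exact Finset.sum_congr rfl fun i _ => by
      rw [Pi.star_apply, RCLike.star_def, ← Complex.normSq_eq_conj_mul_self]
  refine ⟨((Real.sqrt N)⁻¹ : ℝ), ?_⟩
  rw [star_smul, smul_dotProduct, dotProduct_smul, hNu, RCLike.star_def, Complex.conj_ofReal,
    smul_eq_mul, smul_eq_mul, ← Complex.ofReal_mul, ← Complex.ofReal_mul, ← Complex.ofReal_one]
  congr 1
  have h := Real.mul_self_sqrt hN0.le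
  have h0 : Real.sqrt N ≠ 0 := (Real.sqrt_pos.2 hN0).ne'
  field_simp
  linarith [h]

variable {ι : Type*} [Fintype ι]

theorem star_conjBar_dotProduct (v w : ι × Fin 2 → ℂ) :
    star (conjBar v) ⬝ᵥ w = star (conjBar w) ⬝ᵥ v := by
  simp only [dotProduct, Pi.star_apply, conjBar, star_star]
  refine Fintype.sum_equiv (barEquiv ι) _ _ fun p => ?_
  change _ = w (bar (bar p)) * v (bar p)
  rw [bar_bar, mul_comm]

theorem star_dotProduct_conjBar (v w : ι × Fin 2 → ℂ) :
    star v ⬝ᵥ conjBar w = star w ⬝ᵥ conjBar v := by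
  have h := star_conjBar_dotProduct (conjBar v) (conjBar w)
  rwa [conjBar_conjBar, conjBar_conjBar] at h

theorem star_conjBar_dotProduct_conjBar (v w : ι × Fin 2 → ℂ) :
    star (conjBar v) ⬝ᵥ conjBar w = star w ⬝ᵥ v := by
  rw [star_conjBar_dotProduct, conjBar_conjBar]

theorem mulVec_conjBar {T : Matrix (ι × Fin 2) (ι × Fin 2) ℂ} (hT : T.IsHermitian)
    (hbar : ∀ p q, T (bar p) (bar q) = -T q p) (v : ι × Fin 2 → ℂ) :
    T *ᵥ conjBar v = -conjBar (T *ᵥ v) := by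
  funext p
  simp only [Matrix.mulVec, dotProduct, conjBar, Pi.neg_apply, star_sum, star_mul']
  rw [← Finset.sum_neg_distrib]
  refine Fintype.sum_equiv (barEquiv ι) _ _ fun q => ?_
  change _ = -(star (T (bar p) (bar q)) * _)
  rw [hbar, star_neg, neg_mul, neg_neg, hT.apply]
  rfl

/-- The pairing of `conjBar v` with `w` is a symmetric complex bilinear form, and over ℂ such a form
has a nonzero isotropic vector in any space of dimension at least 2. -/
theorem exists_isotropic {W : Submodule ℂ (ι × Fin 2 → ℂ)} (hW : 2 ≤ Module.finrank ℂ W) :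
    ∃ u ∈ W, u ≠ 0 ∧ star u ⬝ᵥ conjBar u = 0 := by
  have hW0 : W ≠ ⊥ := by rintro rfl; simp at hW
  obtain ⟨w₂, hw₂, hw₂0⟩ := W.exists_mem_ne_zero_of_ne_bot hW0
  obtain ⟨w₁, hw₁, hind⟩ : ∃ w₁ ∈ W, ∀ c : ℂ, c • w₂ ≠ w₁ := by
    by_contra! h
    have := finrank_le_one (⟨w₂, hw₂⟩ : W) fun w => by
      obtain ⟨c, hc⟩ := h w w.2
      exact ⟨c, Subtype.ext hc⟩
    omega
  set B : (ι × Fin 2 → ℂ) → (ι × Fin 2 → ℂ) → ℂ := fun v w => star (conjBar v) ⬝ᵥ w with hB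
  have hstar : ∀ u, star u ⬝ᵥ conjBar u = star (B u u) := fun u => by
    rw [hB]; exact Matrix.star_dotProduct _ _
  by_cases h22 : B w₂ w₂ = 0
  · exact ⟨w₂, hw₂, hw₂0, by rw [hstar, h22, star_zero]⟩
  · obtain ⟨z, hz⟩ := exists_quadratic_eq_zero h22 (b := 2 * B w₁ w₂) (c := B w₁ w₁)
      (IsAlgClosed.exists_eq_mul_self _)
    refine ⟨w₁ + z • w₂, W.add_mem hw₁ (W.smul_mem z hw₂), fun h => hind (-z) ?_, ?_⟩
    · rw [neg_smul]; exact neg_eq_of_add_eq_zero_left h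
    · have hsym : B w₂ w₁ = B w₁ w₂ := star_conjBar_dotProduct _ _
      have hexp : B (w₁ + z • w₂) (w₁ + z • w₂) =
          B w₁ w₁ + z * B w₁ w₂ + z * (B w₂ w₁ + z * B w₂ w₂) := by
        have : star (conjBar (w₁ + z • w₂)) = star (conjBar w₁) + z • star (conjBar w₂) := by
          funext p; simp [conjBar]
        simp only [hB, this, add_dotProduct, dotProduct_add, dotProduct_smul, smul_dotProduct,
          smul_eq_mul]
        ring
      rw [hstar, hexp, hsym]
      have : B w₁ w₁ + z * B w₁ w₂ + z * (B w₁ w₂ + z * B w₂ w₂) = 0 := by linear_combination hz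
      rw [this, star_zero]

/-- For a nonzero eigenvalue `x` isotropy is automatic, as `conjBar u` belongs to `-x`. Only when T
vanishes on W does one need `exists_isotropic`. -/
theorem exists_eigenvector_isotropic {T : Matrix (ι × Fin 2) (ι × Fin 2) ℂ} (hT : T.IsHermitian)
    (hbar : ∀ p q, T (bar p) (bar q) = -T q p) {W : Submodule ℂ (ι × Fin 2 → ℂ)}
    (hW : 2 ≤ Module.finrank ℂ W) (hTW : ∀ w ∈ W, T *ᵥ w ∈ W) :
    ∃ u ∈ W, u ≠ 0 ∧ star u ⬝ᵥ conjBar u = 0 ∧ ∃ x : ℝ, T *ᵥ u = (x : ℂ) • u := by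
  classical
  by_cases h0 : ∀ w ∈ W, T *ᵥ w = 0
  · obtain ⟨u, hu, hu0, hiso⟩ := exists_isotropic hW
    exact ⟨u, hu, hu0, hiso, 0, by rw [h0 u hu]; simp⟩
  · push Not at h0
    obtain ⟨w, hw, hw0⟩ := h0
    -- An eigenvector in the image of the Hermitian T cannot have eigenvalue zero, since the image
    -- is orthogonal to the kernel.
    set W' := W.map (Matrix.toLin' T) with hW'
    have hW'W : W' ≤ W := by
      rintro _ ⟨v, hv, rfl⟩
      rw [Matrix.toLin'_apply]; exact hTW v hv
    have hmaps : ∀ v ∈ W', Matrix.toLin' T v ∈ W' := fun v hv =>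
      Submodule.mem_map_of_mem (hW'W hv)
    have : Nontrivial W' := by
      refine Submodule.nontrivial_iff_ne_bot.2 fun h => hw0 ?_
      have : Matrix.toLin' T w ∈ W' := Submodule.mem_map_of_mem hw
      rwa [h, Submodule.mem_bot, Matrix.toLin'_apply] at this
    obtain ⟨x, hx⟩ := Module.End.exists_eigenvalue ((Matrix.toLin' T).restrict hmaps)
    obtain ⟨⟨u, hu⟩, hux⟩ := hx.exists_hasEigenvector
    have hu0 : u ≠ 0 := fun h => hux.2 (Subtype.ext h)
    have hTu : T *ᵥ u = x • u := by
      have := congrArg Subtype.val hux.apply_eq_smul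
      simpa using this
    obtain ⟨w', hw'W, hw'⟩ := hu
    rw [Matrix.toLin'_apply] at hw'
    obtain ⟨c, hc⟩ := exists_normalize hu0
    have huu : star u ⬝ᵥ u ≠ 0 := by
      intro h
      rw [star_smul, smul_dotProduct, dotProduct_smul, h] at hc
      simp at hc
    have hsymm : ∀ a b, star (T *ᵥ a) ⬝ᵥ b = star a ⬝ᵥ (T *ᵥ b) := fun a b => by
      rw [← dotProduct_mulVec_conjTranspose, hT.eq]
    have hreal : star x = x := by
      have h := hsymm u u
      rw [hTu, star_smul, smul_dotProduct, dotProduct_smul, smul_eq_mul, smul_eq_mul] at h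
      exact mul_right_cancel₀ huu h
    have hxr : ((x.re : ℝ) : ℂ) = x := Complex.conj_eq_iff_re.1 hreal
    have hTu' : T *ᵥ u = (x.re : ℂ) • u := by rw [hxr, hTu]
    have hx0 : x.re ≠ 0 := by
      intro h
      apply huu
      nth_rewrite 1 [← hw']
      rw [hsymm, hTu', h]
      simp
    refine ⟨u, hW'W ⟨w', hw'W, by rw [Matrix.toLin'_apply, hw']⟩, hu0, ?_, x.re, hTu'⟩
    refine dotProduct_eq_zero_of_ne hT hTu' (y := -x.re) ?_ (fun h => hx0 (by linarith))
    rw [mulVec_conjBar hT hbar, hTu']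
    funext p
    simp [conjBar]

/-- The vectors `v i` and their conjugates together form an orthonormal eigenbasis, so the modes of
the `v i` obey the canonical anticommutation relations. The pairs are split off one at a time; care
is needed only in the kernel, where conjugation does not separate eigenspaces. -/
theorem exists_particleHole_eigenbasis [DecidableEq ι] {T : Matrix (ι × Fin 2) (ι × Fin 2) ℂ}
    (hT : T.IsHermitian) (hbar : ∀ p q, T (bar p) (bar q) = -T q p) :
    ∃ (v : ι → ι × Fin 2 → ℂ) (x : ι → ℝ),
      (∀ i j, star (v i) ⬝ᵥ v j = if i = j then 1 else 0) ∧
      (∀ i j, star (v i) ⬝ᵥ conjBar (v j) = 0) ∧ ∀ i, T *ᵥ v i = (x i : ℂ) • v i := by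
  suffices h : ∀ s : Finset ι, ∃ (v : ι → ι × Fin 2 → ℂ) (x : ι → ℝ),
      (∀ i ∈ s, ∀ j ∈ s, star (v i) ⬝ᵥ v j = if i = j then 1 else 0) ∧
      (∀ i ∈ s, ∀ j ∈ s, star (v i) ⬝ᵥ conjBar (v j) = 0) ∧
      ∀ i ∈ s, T *ᵥ v i = (x i : ℂ) • v i by
    obtain ⟨v, x, h1, h2, h3⟩ := h Finset.univ
    exact ⟨v, x, fun i j => h1 i (Finset.mem_univ i) j (Finset.mem_univ j),
      fun i j => h2 i (Finset.mem_univ i) j (Finset.mem_univ j), fun i => h3 i (Finset.mem_univ i)⟩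
  intro s
  induction s using Finset.induction_on with
  | empty => exact ⟨0, 0, by simp, by simp, by simp⟩
  | insert k s hk ih =>
    obtain ⟨v, x, h1, h2, h3⟩ := ih
    -- The kernel of `F` is the orthogonal complement of the chosen pairs. It is invariant under T
    -- and has dimension at least 2 while an index remains.
    let F : (ι × Fin 2 → ℂ) →ₗ[ℂ] (s → ℂ) × (s → ℂ) :=
      { toFun := fun w => (fun i => star (v i) ⬝ᵥ w, fun i => star (conjBar (v i)) ⬝ᵥ w)
        map_add' := fun a b => by ext <;> simp [dotProduct_add]
        map_smul' := fun c a => by ext <;> simp [dotProduct_smul] }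
    have hmem : ∀ w, w ∈ LinearMap.ker F ↔
        ∀ i ∈ s, star (v i) ⬝ᵥ w = 0 ∧ star (conjBar (v i)) ⬝ᵥ w = 0 := by
      intro w
      rw [LinearMap.mem_ker]
      constructor
      · intro h i hi
        exact ⟨congrFun (congrArg Prod.fst h) ⟨i, hi⟩, congrFun (congrArg Prod.snd h) ⟨i, hi⟩⟩
      · intro h
        exact Prod.ext (funext fun i => (h i i.2).1) (funext fun i => (h i i.2).2)
    have hrank : 2 ≤ Module.finrank ℂ (LinearMap.ker F) := by
      have e1 := LinearMap.finrank_range_add_finrank_ker F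
      have e2 := Submodule.finrank_le (LinearMap.range F)
      have e3 : s.card < Fintype.card ι := by
        rw [← Finset.card_univ]
        exact Finset.card_lt_card ⟨Finset.subset_univ s, fun h => hk (h (Finset.mem_univ k))⟩
      simp only [Module.finrank_prod, Module.finrank_fintype_fun_eq_card, Fintype.card_prod,
        Fintype.card_fin, Fintype.card_coe] at e1 e2
      omega
    have hsymm : ∀ a b, star a ⬝ᵥ (T *ᵥ b) = star (T *ᵥ a) ⬝ᵥ b := fun a b => by
      rw [← dotProduct_mulVec_conjTranspose, hT.eq]
    obtain ⟨u, hu, hu0, hiso, y, hy⟩ := exists_eigenvector_isotropic hT hbar hrank (by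
      intro w hw
      rw [hmem] at hw ⊢
      intro i hi
      constructor
      · rw [hsymm, h3 i hi, star_smul, smul_dotProduct, (hw i hi).1, smul_zero]
      · have : conjBar ((x i : ℂ) • v i) = (x i : ℂ) • conjBar (v i) := by
          funext p; simp [conjBar]
        rw [hsymm, mulVec_conjBar hT hbar, h3 i hi, this, star_neg, star_smul, neg_dotProduct,
          smul_dotProduct, (hw i hi).2, smul_zero, neg_zero])
    obtain ⟨c, hc⟩ := exists_normalize hu0
    rw [hmem] at hu
    have hcu : ∀ i ∈ s, star (v i) ⬝ᵥ (c • u) = 0 ∧ star (v i) ⬝ᵥ conjBar (c • u) = 0 := by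
      intro i hi
      rw [dotProduct_smul, (hu i hi).1, star_dotProduct_conjBar, Matrix.star_dotProduct,
        dotProduct_smul, (hu i hi).2]
      simp
    have hcc : star (c • u) ⬝ᵥ conjBar (c • u) = 0 := by
      have : conjBar (c • u) = star c • conjBar u := by funext p; simp [conjBar]
      rw [this, star_smul, smul_dotProduct, dotProduct_smul, hiso, smul_zero, smul_zero]
    have hne : ∀ i ∈ s, i ≠ k := by rintro i hi rfl; exact hk hi
    refine ⟨Function.update v k (c • u), Function.update x k y, ?_, ?_, ?_⟩
    · intro i hi j hj
      rcases Finset.mem_insert.1 hi with rfl | hi' <;> rcases Finset.mem_insert.1 hj with rfl | hj'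
      · simpa using hc
      · rw [Function.update_self, Function.update_of_ne (hne j hj'), if_neg (hne j hj').symm,
          Matrix.star_dotProduct, (hcu j hj').1, star_zero]
      · rw [Function.update_self, Function.update_of_ne (hne i hi'), if_neg (hne i hi'),
          (hcu i hi').1]
      · rw [Function.update_of_ne (hne i hi'), Function.update_of_ne (hne j hj'), h1 i hi' j hj']
    · intro i hi j hj
      rcases Finset.mem_insert.1 hi with rfl | hi' <;> rcases Finset.mem_insert.1 hj with rfl | hj'
      · simpa using hcc
      · rw [Function.update_self, Function.update_of_ne (hne j hj'), star_dotProduct_conjBar,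
          (hcu j hj').2]
      · rw [Function.update_self, Function.update_of_ne (hne i hi'), (hcu i hi').2]
      · rw [Function.update_of_ne (hne i hi'), Function.update_of_ne (hne j hj'), h2 i hi' j hj']
    · intro i hi
      rcases Finset.mem_insert.1 hi with rfl | hi
      · rw [Function.update_self, Function.update_self, Matrix.mulVec_smul, hy, smul_comm]
      · rw [Function.update_of_ne (hne i hi), Function.update_of_ne (hne i hi), h3 i hi]

end ParticleHole

/-! ### The entropy of a state in terms of its covariance matrix -/

/-- For y = s² the inequality log (1/s) ≤ 1/s - 1 gives -y log y ≤ 2s(1-s) ≤ 2√(y(1-y)). A square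
root bound loses little here and suits Peierls' inequality. -/
theorem negMulLog_add_le {x : ℝ} (h0 : 0 ≤ x) (h1 : x ≤ 1) :
    Real.negMulLog x + Real.negMulLog (1 - x) ≤ 4 * Real.sqrt (x * (1 - x)) := by
  have key : ∀ y : ℝ, 0 ≤ y → y ≤ 1 → Real.negMulLog y ≤ 2 * Real.sqrt (y * (1 - y)) := by
    intro y hy0 hy1
    rcases hy0.eq_or_lt with rfl | hy
    · simp
    · set s := Real.sqrt y with hs
      have hs0 : 0 < s := Real.sqrt_pos.2 hy
      have hss : s * s = y := Real.mul_self_sqrt hy.le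
      have hs1 : s ≤ 1 := Real.sqrt_le_one.2 hy1
      have h1 := Real.log_le_sub_one_of_pos (inv_pos.2 hs0)
      rw [Real.log_inv] at h1
      have hlog : Real.log y = 2 * Real.log s := by
        rw [← hss, Real.log_mul hs0.ne' hs0.ne']; ring
      have h2 : Real.negMulLog y ≤ 2 * (s * (1 - s)) := by
        have h3 := mul_le_mul_of_nonneg_left h1 (by positivity : 0 ≤ 2 * (s * s))
        have h4 : 2 * (s * s) * (s⁻¹ - 1) = 2 * (s * (1 - s)) := by field_simp
        rw [h4] at h3
        unfold Real.negMulLog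
        rw [hlog, ← hss]
        linarith
      refine h2.trans (mul_le_mul_of_nonneg_left ?_ two_pos.le)
      refine Real.le_sqrt_of_sq_le ?_
      rw [← hss]
      have : 0 ≤ s * s * (1 - s) * s := by
        have := sub_nonneg.2 hs1
        positivity
      nlinarith
  have h2 := key (1 - x) (by linarith) (by linarith)
  rw [sub_sub_cancel, mul_comm (1 - x)] at h2
  linarith [key x h0 h1]

theorem sqrt_sum_sq_le {κ : Type*} (s : Finset κ) (a : κ → ℝ) (ha : ∀ i, 0 ≤ a i) :
    Real.sqrt (∑ i ∈ s, a i ^ 2) ≤ ∑ i ∈ s, a i := by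
  refine Real.sqrt_le_iff.2 ⟨Finset.sum_nonneg fun i _ => ha i, ?_⟩
  exact Finset.sum_sq_le_sq_sum_of_nonneg fun i _ => ha i

/-- Peierls' inequality for the square root. -/
theorem sum_sqrt_le_sum_sqrt_diag {κ : Type*} [Fintype κ] [DecidableEq κ] {G : Matrix κ κ ℂ}
    (w : κ → κ → ℂ) (g : κ → ℝ) (hw : ∀ a b, star (w a) ⬝ᵥ w b = if a = b then 1 else 0)
    (hg : ∀ a, 0 ≤ g a) (hG : ∀ a, G *ᵥ w a = (g a : ℂ) • w a) :
    ∑ a, Real.sqrt (g a) ≤ ∑ p, Real.sqrt (G p p).re := by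
  set V : Matrix κ κ ℂ := Matrix.of fun p a => w a p with hV
  have hVV : Vᴴ * V = 1 := by
    ext a b
    have := hw a b
    simpa [Matrix.mul_apply, hV, dotProduct, Matrix.one_apply] using this
  have hVV' : V * Vᴴ = 1 := mul_eq_one_comm.1 hVV
  have hGV : G * V = V * Matrix.diagonal fun a => (g a : ℂ) := by
    ext p a
    have := congrFun (hG a) p
    simp only [Matrix.mulVec, dotProduct, Pi.smul_apply, smul_eq_mul] at this
    rw [Matrix.mul_diagonal, Matrix.mul_apply]
    simpa [hV, mul_comm] using this
  have hG' : G = V * (Matrix.diagonal fun a => (g a : ℂ)) * Vᴴ := by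
    rw [← hGV, mul_assoc, hVV', mul_one]
  have hrow : ∀ p, ∑ a, ‖w a p‖ ^ 2 = 1 := by
    intro p
    have h := congrFun (congrFun hVV' p) p
    rw [Matrix.mul_apply, Matrix.one_apply_eq] at h
    have h2 := congrArg Complex.re h
    rw [Complex.re_sum, Complex.one_re] at h2
    rw [← h2]
    refine Finset.sum_congr rfl fun a _ => ?_
    simp only [hV, Matrix.of_apply, Matrix.conjTranspose_apply, RCLike.star_def]
    rw [Complex.mul_conj, Complex.ofReal_re, Complex.normSq_eq_norm_sq]
  have hcol : ∀ a, ∑ p, ‖w a p‖ ^ 2 = 1 := by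
    intro a
    have h2 := congrArg Complex.re (hw a a)
    rw [if_pos rfl, Complex.one_re, dotProduct, Complex.re_sum] at h2
    rw [← h2]
    refine Finset.sum_congr rfl fun p _ => ?_
    rw [Pi.star_apply, RCLike.star_def, ← Complex.normSq_eq_conj_mul_self, Complex.ofReal_re,
      Complex.normSq_eq_norm_sq]
  have hdiag : ∀ p, (G p p).re = ∑ a, ‖w a p‖ ^ 2 * g a := by
    intro p
    rw [hG', Matrix.mul_apply, Complex.re_sum]
    refine Finset.sum_congr rfl fun a _ => ?_
    rw [Matrix.mul_diagonal, Matrix.conjTranspose_apply]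
    simp only [hV, Matrix.of_apply, RCLike.star_def]
    rw [mul_right_comm, Complex.mul_conj, ← Complex.ofReal_mul, Complex.ofReal_re,
      Complex.normSq_eq_norm_sq]
  -- Concavity of the square root for the weights `‖w a p‖ ^ 2`, which sum to one, in the form of
  -- Cauchy-Schwarz.
  have key : ∀ p, ∑ a, ‖w a p‖ ^ 2 * Real.sqrt (g a) ≤ Real.sqrt (G p p).re := by
    intro p
    refine Real.le_sqrt_of_sq_le ?_
    have h := Finset.sum_mul_sq_le_sq_mul_sq Finset.univ (fun a => ‖w a p‖)
      (fun a => ‖w a p‖ * Real.sqrt (g a))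
    rw [hrow, one_mul] at h
    rw [hdiag]
    refine le_trans (le_of_eq ?_) (h.trans (le_of_eq ?_))
    · congr 1
      exact Finset.sum_congr rfl fun a _ => by ring
    · exact Finset.sum_congr rfl fun a _ => by rw [mul_pow, Real.sq_sqrt (hg a)]
  calc ∑ a, Real.sqrt (g a) = ∑ a, ∑ p, ‖w a p‖ ^ 2 * Real.sqrt (g a) := by
        simp only [← Finset.sum_mul, hcol, one_mul]
    _ = ∑ p, ∑ a, ‖w a p‖ ^ 2 * Real.sqrt (g a) := Finset.sum_comm
    _ ≤ _ := Finset.sum_le_sum fun p _ => key p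

/-! ### Entropy bound by the covariance matrix. -/

section Covariance

variable {Λ : Finset ℕ}

/-- The covariance matrix of a state. -/
def covarianceMatrix (ρ : Op Λ) : Matrix (Λ × Fin 2) (Λ × Fin 2) ℂ :=
  Matrix.of fun p q => (ρ * (fermi p * (fermi q)ᴴ)).trace

theorem trace_mul_mode (ρ : Op Λ) (v w : Λ × Fin 2 → ℂ) :
    (ρ * (mode v * (mode w)ᴴ)).trace = star v ⬝ᵥ (covarianceMatrix ρ *ᵥ w) := by
  rw [mode, mode, Matrix.conjTranspose_sum, Finset.sum_mul_sum]
  simp only [Matrix.conjTranspose_smul, star_star, Finset.mul_sum, Matrix.trace_sum, smul_mul_assoc,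
    mul_smul_comm,
    Matrix.trace_smul, dotProduct, Matrix.mulVec, covarianceMatrix, Matrix.of_apply, Pi.star_apply,
    smul_eq_mul]
  refine Finset.sum_congr rfl fun p _ => Finset.sum_congr rfl fun q _ => ?_
  ring

theorem covarianceMatrix_isHermitian {ρ : Op Λ} (hρ : ρ.IsHermitian) :
    (covarianceMatrix ρ).IsHermitian := by
  ext p q
  rw [Matrix.conjTranspose_apply, covarianceMatrix, Matrix.of_apply, Matrix.of_apply,
    ← Matrix.trace_conjTranspose, Matrix.conjTranspose_mul, Matrix.conjTranspose_mul,
    Matrix.conjTranspose_conjTranspose, hρ.eq, Matrix.trace_mul_comm]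

/-- The anticommutation relations make Γ - 1/2 odd under particle-hole exchange, as
`exists_particleHole_eigenbasis` requires. -/
theorem covarianceMatrix_bar {ρ : Op Λ} (htr : ρ.trace = 1) (p q : Λ × Fin 2) :
    covarianceMatrix ρ (bar p) (bar q) = (if p = q then 1 else 0) - covarianceMatrix ρ q p := by
  rw [covarianceMatrix, Matrix.of_apply, Matrix.of_apply, fermi_conjTranspose, fermi_conjTranspose,
    bar_bar, fermi_anticomm', bar_bar, mul_sub, Matrix.trace_sub]
  congr 1
  by_cases h : q = p
  · rw [if_pos h, if_pos h.symm, mul_one, htr]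
  · rw [if_neg h, if_neg (Ne.symm h), mul_zero, Matrix.trace_zero]

open scoped ComplexOrder in
-- Subadditivity over the modes that diagonalize Γ bounds the entropy by binary entropies of its
-- eigenvalues ξ, whatever the higher correlations of ρ. The rest is `negMulLog_add_le` and Peierls'
-- inequality for Γ - Γ².
theorem vonNeumannEntropy_le {ρ : Op Λ} (hρ : ρ.PosSemidef) (htr : ρ.trace = 1) :
    vonNeumannEntropy ρ ≤ 2 * ∑ p, Real.sqrt
      ((covarianceMatrix ρ - covarianceMatrix ρ * covarianceMatrix ρ) p p).re := by
  set Γ := covarianceMatrix ρ with hΓ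
  have hΓh : Γ.IsHermitian := covarianceMatrix_isHermitian hρ.isHermitian
  have hT : (Γ - (2⁻¹ : ℂ) • (1 : Matrix (Λ × Fin 2) (Λ × Fin 2) ℂ)).IsHermitian := by
    rw [Matrix.IsHermitian, Matrix.conjTranspose_sub, hΓh.eq, Matrix.conjTranspose_smul,
      Matrix.conjTranspose_one]
    simp
  have hTbar : ∀ p q, (Γ - (2⁻¹ : ℂ) • (1 : Matrix (Λ × Fin 2) (Λ × Fin 2) ℂ)) (bar p) (bar q) =
      -(Γ - (2⁻¹ : ℂ) • (1 : Matrix (Λ × Fin 2) (Λ × Fin 2) ℂ)) q p := by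
    intro p q
    rw [Matrix.sub_apply, Matrix.sub_apply, hΓ, covarianceMatrix_bar htr, Matrix.smul_apply,
      Matrix.smul_apply, Matrix.one_apply, Matrix.one_apply]
    have e1 : (bar p = bar q) = (p = q) := propext (barEquiv Λ).injective.eq_iff
    have e2 : (q = p) = (p = q) := propext eq_comm
    simp only [e1, e2, smul_eq_mul]
    split_ifs <;> ring
  obtain ⟨v, x, h1, h2, h3⟩ := exists_particleHole_eigenbasis hT hTbar
  set ξ : Λ → ℝ := fun i => x i + 2⁻¹ with hξ
  have hΓv : ∀ i, Γ *ᵥ v i = (ξ i : ℂ) • v i := by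
    intro i
    have h := h3 i
    rw [Matrix.sub_mulVec, Matrix.smul_mulVec, Matrix.one_mulVec, sub_eq_iff_eq_add,
      ← add_smul] at h
    rw [h, hξ]
    push_cast
    rfl
  have htrξ : ∀ i, (ρ * (mode (v i) * (mode (v i))ᴴ)).trace = ξ i := by
    intro i
    rw [trace_mul_mode, ← hΓ, hΓv, dotProduct_smul, h1, if_pos rfl, smul_eq_mul, mul_one]
  have hanti : ∀ i j, mode (v i) * mode (v j) + mode (v j) * mode (v i) = 0 := fun i j => by
    rw [mode_anticomm, h2, zero_smul]
  have hstar : ∀ i j, mode (v i) * (mode (v j))ᴴ + (mode (v j))ᴴ * mode (v i) =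
      if i = j then 1 else 0 := fun i j => by
    rw [mode_anticomm_star, h1]; split_ifs <;> simp
  have hξ0 : ∀ i, 0 ≤ ξ i := by
    intro i
    have h := (hρ.conjTranspose_mul_mul_same (mode (v i))).trace_nonneg
    rw [Matrix.trace_mul_comm, ← mul_assoc, Matrix.trace_mul_comm, htrξ] at h
    exact_mod_cast h
  have hξ1 : ∀ i, ξ i ≤ 1 := by
    intro i
    have h := (hρ.mul_mul_conjTranspose_same (mode (v i))).trace_nonneg
    rw [Matrix.trace_mul_comm, ← mul_assoc, Matrix.trace_mul_comm,
      eq_sub_of_add_eq' (hstar i i), if_pos rfl, mul_sub, mul_one, Matrix.trace_sub, htr, htrξ] at h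
    have h' : (0 : ℝ) ≤ 1 - ξ i := by exact_mod_cast h
    linarith
  have hent := entropy_le_sum_modes hanti hstar (by simp [Config]) hρ htr
  simp only [htrξ, Complex.ofReal_re] at hent
  have hbar : ∀ i, Γ *ᵥ conjBar (v i) = ((1 - ξ i : ℝ) : ℂ) • conjBar (v i) := by
    intro i
    have h := mulVec_conjBar hT hTbar (v i)
    have e : conjBar ((x i : ℂ) • v i) = (x i : ℂ) • conjBar (v i) := by
      funext p; simp [conjBar]
    rw [h3, e, Matrix.sub_mulVec, Matrix.smul_mulVec, Matrix.one_mulVec, sub_eq_iff_eq_add,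
      ← neg_smul, ← add_smul] at h
    rw [h, hξ]
    congr 1
    push_cast
    ring
  have hG : ∀ (u : Λ × Fin 2 → ℂ) (y : ℝ), Γ *ᵥ u = (y : ℂ) • u →
      (Γ - Γ * Γ) *ᵥ u = ((y * (1 - y) : ℝ) : ℂ) • u := by
    intro u y hu
    rw [Matrix.sub_mulVec, ← Matrix.mulVec_mulVec, hu, Matrix.mulVec_smul, hu, smul_smul,
      ← sub_smul]
    congr 1
    push_cast
    ring
  -- `v i` and its conjugate belong to ξ and 1 - ξ, so both give the eigenvalue ξ(1-ξ) of Γ - Γ².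
  -- This double counting turns the factor 4 into 2.
  have hpeierls := sum_sqrt_le_sum_sqrt_diag (G := Γ - Γ * Γ)
    (fun a : Λ × Fin 2 => if a.2 = 0 then v a.1 else conjBar (v a.1))
    (fun a => ξ a.1 * (1 - ξ a.1)) (by
      rintro ⟨i, a⟩ ⟨j, b⟩
      fin_cases a <;> fin_cases b
      · simp [h1]
      · simp [h2]
      · have e : star (conjBar (v i)) ⬝ᵥ v j = 0 := by
          rw [Matrix.star_dotProduct, h2, star_zero]
        simpa using e
      · simp [star_conjBar_dotProduct_conjBar, h1, eq_comm])
    (fun a => mul_nonneg (hξ0 _) (sub_nonneg.2 (hξ1 _))) (by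
      rintro ⟨i, a⟩
      fin_cases a
      · exact hG _ _ (hΓv i)
      · have := hG _ _ (hbar i)
        rw [sub_sub_cancel, mul_comm] at this
        exact this)
  rw [Fintype.sum_prod_type] at hpeierls
  simp only [Fin.sum_univ_two, ← two_mul, ← Finset.mul_sum] at hpeierls
  have hsum : ∑ i, (Real.negMulLog (ξ i) + Real.negMulLog (1 - ξ i)) ≤
      ∑ i, 4 * Real.sqrt (ξ i * (1 - ξ i)) :=
    Finset.sum_le_sum fun i _ => negMulLog_add_le (hξ0 i) (hξ1 i)
  rw [← Finset.mul_sum] at hsum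
  have := hent.trans hsum
  unfold vonNeumannEntropy
  linarith

end Covariance

/-- Γ is the compression of the projection P to the segment. In the diagonal of Γ - Γ² the part of
P² = P summed over the inside cancels, leaving the squared entries that lead outside. -/
theorem entanglement_pureState_le {Λ Λ' : Finset ℕ} (h : Λ' ⊆ Λ) {a : ℕ} (hs : IsSegment Λ Λ' a)
    {P : Matrix (Λ × Fin 2) (Λ × Fin 2) ℂ} {ψ : Config Λ → ℂ} (hP : IsVacuum P ψ)
    (h1 : star ψ ⬝ᵥ ψ = 1) :
    entanglement Λ' (pureState ψ) ≤
      2 * ∑ p : Λ' × Fin 2, ∑ q ∈ Finset.univ.filter fun q : Λ × Fin 2 => (q.1 : ℕ) ∉ Λ',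
        ‖P (incl h p) q‖ := by
  have htr : (partialTrace Λ' (pureState ψ)).trace = 1 := by
    have := trace_partialTrace_mul h (pureState ψ) 1
    rwa [mul_one, embed_one, trace_pureState_mul, Matrix.one_mulVec, h1] at this
  refine (vonNeumannEntropy_le (partialTrace_pureState_posSemidef ψ) htr).trans ?_
  refine mul_le_mul_of_nonneg_left (Finset.sum_le_sum fun p _ => ?_) two_pos.le
  have hcov : ∀ p q, covarianceMatrix (partialTrace Λ' (pureState ψ)) p q =
      P (incl h p) (incl h q) := by
    intro p q
    rw [covarianceMatrix, Matrix.of_apply, trace_partialTrace_mul h, ← fermi_mul_star_incl h hs,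
      trace_pureState_mul, hP.covariance h1]
  have hherm := hP.isHermitian h1
  have hPP : P (incl h p) (incl h p) = ∑ q, P (incl h p) q * P q (incl h p) := by
    rw [← Matrix.mul_apply, hP.mul_self h1]
  have hsplit : ((covarianceMatrix (partialTrace Λ' (pureState ψ)) -
      covarianceMatrix (partialTrace Λ' (pureState ψ)) *
        covarianceMatrix (partialTrace Λ' (pureState ψ))) p p).re =
      ∑ q ∈ Finset.univ.filter fun q : Λ × Fin 2 => (q.1 : ℕ) ∉ Λ', ‖P (incl h p) q‖ ^ 2 := by
    have e : ∀ q, P (incl h p) q * P q (incl h p) = ((‖P (incl h p) q‖ ^ 2 : ℝ) : ℂ) := by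
      intro q
      rw [← hherm.apply q, RCLike.star_def, Complex.mul_conj, Complex.normSq_eq_norm_sq]
    rw [Matrix.sub_apply, Matrix.mul_apply]
    simp only [hcov]
    rw [hPP, ← Finset.sum_filter_add_sum_filter_not Finset.univ
      (fun q : Λ × Fin 2 => (q.1 : ℕ) ∉ Λ')]
    have e2 : ∑ q ∈ Finset.univ.filter (fun q : Λ × Fin 2 => ¬(q.1 : ℕ) ∉ Λ'),
        P (incl h p) q * P q (incl h p) =
        ∑ q, P (incl h p) (incl h q) * P (incl h q) (incl h p) := by
      symm
      refine Finset.sum_bij (fun q _ => incl h q) ?_ ?_ ?_ ?_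
      · intro q _
        simp only [Finset.mem_filter, Finset.mem_univ, true_and, not_not]
        exact q.1.2
      · intro q _ q' _ hq; exact incl_injective h hq
      · intro q hq
        simp only [Finset.mem_filter, Finset.mem_univ, true_and, not_not] at hq
        exact ⟨(⟨q.1, hq⟩, q.2), Finset.mem_univ _, rfl⟩
      · intros; rfl
    rw [e2, add_sub_cancel_right, Complex.re_sum]
    exact Finset.sum_congr rfl fun q _ => by rw [e, Complex.ofReal_re]
  rw [hsplit]
  exact sqrt_sum_sq_le _ _ fun q => norm_nonneg _

/-! ### The entanglement bound in terms of eigencorrelators -/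

theorem norm_apply_le_norm_toEuclideanCLM {ι : Type*} [Fintype ι] [DecidableEq ι]
    (A : Matrix ι ι ℂ) (x y : ι) :
    ‖A x y‖ ≤ ‖Matrix.toEuclideanCLM (n := ι) (𝕜 := ℂ) A‖ := by
  have h1 := (Matrix.toEuclideanCLM (n := ι) (𝕜 := ℂ) A).le_opNorm (EuclideanSpace.single y 1)
  have h2 := PiLp.norm_apply_le (Matrix.toEuclideanCLM (n := ι) (𝕜 := ℂ) A
    (EuclideanSpace.single y 1)) x
  have h3 : (Matrix.toEuclideanCLM (n := ι) (𝕜 := ℂ) A (EuclideanSpace.single y 1)) x = A x y := by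
    rw [Matrix.ofLp_toEuclideanCLM]
    change (A *ᵥ Pi.single y 1) x = _
    rw [Matrix.mulVec_single_one]
    rfl
  rw [h3] at h2
  simpa using h2.trans h1

theorem norm_functionOf_le_one {ι : Type*} [Fintype ι] [DecidableEq ι] {A : Matrix ι ι ℂ}
    (hA : A.IsHermitian) {g : ℝ → ℂ} (hg : ∀ x, ‖g x‖ ≤ 1) (p q : ι) :
    ‖functionOf hA g p q‖ ≤ 1 := by
  have hrow : ∀ p, ∑ i, ‖eigvec hA i p‖ ^ 2 = 1 := by
    intro p
    have h := congrArg Complex.re (eigvec_complete hA p p)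
    rw [if_pos rfl, Complex.one_re, Complex.re_sum] at h
    rw [← h]
    refine Finset.sum_congr rfl fun i _ => ?_
    rw [RCLike.star_def, Complex.mul_conj, Complex.ofReal_re, Complex.normSq_eq_norm_sq]
  rw [functionOf_apply]
  calc ‖∑ i, g (hA.eigenvalues i) * (eigvec hA i p * star (eigvec hA i q))‖
      ≤ ∑ i, ‖eigvec hA i p‖ * ‖eigvec hA i q‖ := by
        refine (norm_sum_le _ _).trans (Finset.sum_le_sum fun i _ => ?_)
        rw [norm_mul, norm_mul, norm_star]
        exact mul_le_of_le_one_left (by positivity) (hg _)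
    _ ≤ ∑ i, (‖eigvec hA i p‖ ^ 2 + ‖eigvec hA i q‖ ^ 2) / 2 :=
        Finset.sum_le_sum fun i _ => by nlinarith [sq_nonneg (‖eigvec hA i p‖ - ‖eigvec hA i q‖)]
    _ = 1 := by rw [← Finset.sum_div, Finset.sum_add_distrib, hrow, hrow]; norm_num

/-- The eigencorrelator, cut off at `1`. -/
def cutCorrelator (Λ : Finset ℕ) (μ γ ν : ℕ → ℝ) (j k : Λ) : ℝ≥0∞ :=
  min 1 (eigencorrelator Λ μ γ ν j k)

/-- The bound by 1 comes for free and is kept because `lintegral_mul_mul_le` needs bounded factors.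
-/
theorem enorm_functionOf_le (Λ : Finset ℕ) (μ γ ν : ℕ → ℝ) {g : ℝ → ℂ} (hg : Measurable g)
    (hg1 : ∀ x, ‖g x‖ ≤ 1) (p q : Λ × Fin 2) :
    ‖functionOf (effectiveHamiltonian_isHermitian Λ μ γ ν) g p q‖ₑ ≤
      cutCorrelator Λ μ γ ν p.1 q.1 := by
  rw [← ofReal_norm]
  refine le_min ?_ ?_
  · exact ENNReal.ofReal_le_one.2 (norm_functionOf_le_one _ hg1 _ _)
  · unfold eigencorrelator
    refine le_trans ?_ (le_iSup_of_le g (le_iSup_of_le hg (le_iSup_of_le hg1 le_rfl)))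
    exact ENNReal.ofReal_le_ofReal (norm_apply_le_norm_toEuclideanCLM (Matrix.of fun x y =>
      functionOf (effectiveHamiltonian_isHermitian Λ μ γ ν) g (p.1, x) (q.1, y)) p.2 q.2)

/-- The cut-off eigencorrelator of the decoupled chain. -/
def blockCorrelator {n m : ℕ} (d : Decomposition n m) (μ γ ν : ℕ → ℝ) (j k : Finset.range n) :
    ℝ≥0∞ :=
  ∑ l, if h : (j : ℕ) ∈ d.block l ∧ (k : ℕ) ∈ d.block l then
    cutCorrelator (d.block l) μ γ ν ⟨j, h.1⟩ ⟨k, h.2⟩ else 0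

theorem enorm_blockDiag_le {n m : ℕ} (d : Decomposition n m) (μ γ ν : ℕ → ℝ) {g : Fin m → ℝ → ℂ}
    (hg : ∀ k, Measurable (g k)) (hg1 : ∀ k x, ‖g k x‖ ≤ 1) (p q : Finset.range n × Fin 2) :
    ‖blockDiag d (fun k => functionOf (effectiveHamiltonian_isHermitian (d.block k) μ γ ν) (g k))
      p q‖ₑ ≤ blockCorrelator d μ γ ν p.1 q.1 := by
  obtain ⟨k, q, rfl⟩ := exists_incl_block d q
  rw [blockDiag_incl]
  by_cases hp : (p.1 : ℕ) ∈ d.block k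
  · obtain ⟨p, rfl⟩ : ∃ p', p = incl (d.block_subset k) p' := ⟨(⟨p.1, hp⟩, p.2), rfl⟩
    rw [extendVec_incl]
    refine (enorm_functionOf_le _ μ γ ν (hg k) (hg1 k) p q).trans ?_
    rw [blockCorrelator]
    refine le_trans (le_of_eq ?_) (Finset.single_le_sum (fun _ _ => zero_le) (Finset.mem_univ k))
    rw [dif_pos ⟨p.1.2, q.1.2⟩]
    rfl
  · rw [extendVec_eq_zero _ _ hp, enorm_zero]
    exact zero_le

theorem isSegment_Icc {n a b : ℕ} : IsSegment (Finset.range n) (Finset.Icc a b) a := by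
  refine ⟨fun j hj => (Finset.mem_Icc.1 hj).1, fun i _ j hj h1 h2 => ?_⟩
  exact Finset.mem_Icc.2 ⟨h1, h2.le.trans (Finset.mem_Icc.1 hj).2⟩

/-- The correlations between the inside and the outside of `Λ'`. -/
def boundaryCorrelation {n m : ℕ} (d : Decomposition n m) (Λ' : Finset ℕ) (μ γ ν : ℕ → ℝ) :
    ℝ≥0∞ :=
  ∑ j ∈ Finset.univ.filter fun j : Finset.range n => (j : ℕ) ∈ Λ',
    ∑ k ∈ Finset.univ.filter fun k : Finset.range n => (k : ℕ) ∉ Λ', ∑ l, ∑ l',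
      cutCorrelator (Finset.range n) μ γ ν j l * blockCorrelator d μ γ ν l l' *
        cutCorrelator (Finset.range n) μ γ ν k l'

theorem supEntanglement_le {n m : ℕ} (d : Decomposition n m) {a b : ℕ} (hb : b < n)
    {μ γ ν : ℕ → ℝ} (hs : ∀ k, HasSimpleSpectrum (hamiltonian (d.block k) μ γ ν)) :
    supEntanglement d (Finset.Icc a b) μ γ ν ≤
      32 * boundaryCorrelation d (Finset.Icc a b) μ γ ν := by
  refine iSup_le fun t => iSup_le fun ψ => iSup_le fun hψ => ?_
  choose S hS hvac using fun k => exists_isVacuum_of_eigenstate (hs k) (hψ k)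
  set M := effectiveHamiltonian_isHermitian (Finset.range n) μ γ ν
  set P := blockDiag d fun k =>
    functionOf (effectiveHamiltonian_isHermitian (d.block k) μ γ ν) ((S k).indicator 1) with hP
  set W := oneParticleEvolution (Finset.range n) μ γ ν t with hW
  have hH := hamiltonian_isHermitian (Finset.range n) μ γ ν
  have hvacP : IsVacuum P (productVector d ψ) := isVacuum_productVector d hvac
  have hnorm := norm_productVector d fun k => (hψ k).1
  have hsub : Finset.Icc a b ⊆ Finset.range n := fun j hj =>
    Finset.mem_range.2 (lt_of_le_of_lt (Finset.mem_Icc.1 hj).2 hb)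
  rw [productState_pureState, evolve_pureState hH]
  have hent := entanglement_pureState_le hsub isSegment_Icc (hvacP.propagate μ γ ν t)
    (by rw [norm_propagator_mulVec hH, hnorm])
  have hWb : ∀ p q, ‖W p q‖ₑ ≤ cutCorrelator (Finset.range n) μ γ ν p.1 q.1 := by
    intro p q
    refine enorm_functionOf_le _ μ γ ν ?_ ?_ p q
    · fun_prop
    · intro x
      rw [Complex.norm_exp_ofReal_mul_I]
  have hPb : ∀ p q, ‖P p q‖ₑ ≤ blockCorrelator d μ γ ν p.1 q.1 := by
    intro p q
    refine enorm_blockDiag_le d μ γ ν ?_ ?_ p q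
    · exact fun k => measurable_one.indicator (hS k)
    · intro k x
      by_cases hx : x ∈ S k <;> simp [hx]
  set F : Finset.range n → Finset.range n → ℝ≥0∞ := fun j k => ∑ l, ∑ l',
      cutCorrelator (Finset.range n) μ γ ν j l * blockCorrelator d μ γ ν l l' *
        cutCorrelator (Finset.range n) μ γ ν k l' with hF
  -- The 4 counts the components of the two intermediate labels. The components of `p` and `q` and
  -- the prefactor 2 of the entropy bound later raise it to 32.
  have hentry : ∀ p q, ‖(W * P * Wᴴ) p q‖ₑ ≤ 4 * F p.1 q.1 := by
    intro p q
    rw [Matrix.mul_apply]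
    calc ‖∑ r', (W * P) p r' * Wᴴ r' q‖ₑ
        ≤ ∑ r' : Finset.range n × Fin 2, ∑ r : Finset.range n × Fin 2,
          cutCorrelator (Finset.range n) μ γ ν p.1 r.1 * blockCorrelator d μ γ ν r.1 r'.1 *
            cutCorrelator (Finset.range n) μ γ ν q.1 r'.1 := by
          refine (enorm_sum_le _ _).trans (Finset.sum_le_sum fun r' _ => ?_)
          rw [enorm_mul, ← Finset.sum_mul, Matrix.conjTranspose_apply]
          refine mul_le_mul' ?_ ?_
          · rw [Matrix.mul_apply]
            refine (enorm_sum_le _ _).trans (Finset.sum_le_sum fun r _ => ?_)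
            rw [enorm_mul]
            exact mul_le_mul' (hWb _ _) (hPb _ _)
          · refine le_trans (le_of_eq ?_) (hWb q r')
            rw [← ofReal_norm, norm_star, ofReal_norm]
      _ = 4 * F p.1 q.1 := by
          rw [Fintype.sum_prod_type]
          simp only [Fintype.sum_prod_type, Finset.sum_const, Finset.card_univ, Fintype.card_fin,
            nsmul_eq_mul, ← Finset.mul_sum]
          rw [Finset.sum_comm, ← mul_assoc]
          congr 1
          norm_num
  calc ENNReal.ofReal (entanglement (Finset.Icc a b) (pureState
        (propagator (hamiltonian (Finset.range n) μ γ ν) t *ᵥ productVector d ψ)))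
      ≤ ENNReal.ofReal (2 * ∑ p : Finset.Icc a b × Fin 2, ∑ q ∈ Finset.univ.filter
          fun q : Finset.range n × Fin 2 => (q.1 : ℕ) ∉ Finset.Icc a b,
          ‖(W * P * Wᴴ) (incl hsub p) q‖) := ENNReal.ofReal_le_ofReal hent
    _ = 2 * ∑ p : Finset.Icc a b × Fin 2, ∑ q ∈ Finset.univ.filter
          fun q : Finset.range n × Fin 2 => (q.1 : ℕ) ∉ Finset.Icc a b,
          ‖(W * P * Wᴴ) (incl hsub p) q‖ₑ := by
        rw [ENNReal.ofReal_mul two_pos.le, ENNReal.ofReal_ofNat, ENNReal.ofReal_sum_of_nonneg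
          (fun p _ => Finset.sum_nonneg fun q _ => norm_nonneg _)]
        congr 1
        refine Finset.sum_congr rfl fun p _ => ?_
        rw [ENNReal.ofReal_sum_of_nonneg fun q _ => norm_nonneg _]
        exact Finset.sum_congr rfl fun q _ => ofReal_norm _
    _ ≤ 2 * ∑ p : Finset.Icc a b × Fin 2, ∑ q ∈ Finset.univ.filter
          fun q : Finset.range n × Fin 2 => (q.1 : ℕ) ∉ Finset.Icc a b,
          4 * F (inclSite hsub p.1) q.1 := by
        gcongr with p _ q _
        exact hentry _ _
    _ = 32 * boundaryCorrelation d (Finset.Icc a b) μ γ ν := by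
        have e1 : ∀ j, ∑ q ∈ Finset.univ.filter
            (fun q : Finset.range n × Fin 2 => (q.1 : ℕ) ∉ Finset.Icc a b), 4 * F j q.1 =
            8 * ∑ k ∈ Finset.univ.filter
              (fun k : Finset.range n => (k : ℕ) ∉ Finset.Icc a b), F j k := by
          intro j
          rw [Finset.sum_filter, Fintype.sum_prod_type, Finset.sum_filter, Finset.mul_sum]
          refine Finset.sum_congr rfl fun k _ => ?_
          simp only [Fin.sum_univ_two]
          split_ifs <;> ring
        rw [Fintype.sum_prod_type]
        simp only [e1, Finset.sum_const, Finset.card_univ, Fintype.card_fin, nsmul_eq_mul,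
          ← Finset.mul_sum]
        have e2 : ∀ f : Finset.range n → ℝ≥0∞, ∑ j : Finset.Icc a b, f (inclSite hsub j) =
            ∑ j ∈ Finset.univ.filter (fun j : Finset.range n => (j : ℕ) ∈ Finset.Icc a b), f j := by
          intro f
          refine Finset.sum_bij (fun j _ => inclSite hsub j) ?_ ?_ ?_ ?_
          · intro j _
            exact Finset.mem_filter.2 ⟨Finset.mem_univ _, j.2⟩
          · intro j _ j' _ h; exact (inclSite hsub).injective h
          · intro j hj
            exact ⟨⟨j, (Finset.mem_filter.1 hj).2⟩, Finset.mem_univ _, rfl⟩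
          · intros; rfl
        rw [e2 fun j => ∑ k ∈ Finset.univ.filter
          (fun k : Finset.range n => (k : ℕ) ∉ Finset.Icc a b), F j k, ← mul_assoc, ← mul_assoc]
        congr 1
        norm_num

/-! ### Measurability in the parameters of the chain -/

open scoped Matrix.Norms.L2Operator in
theorem continuous_cfc {X ι : Type*} [TopologicalSpace X] [Fintype ι] [DecidableEq ι]
    {A : X → Matrix ι ι ℂ} (hc : Continuous A) (hA : ∀ x, (A x).IsHermitian) {f : ℝ → ℝ}
    (hf : Continuous f) : Continuous fun x => cfc f (A x) :=
  hc.cfc_of_mem_nhdsSet f (s := Set.univ) Filter.univ_mem (fun x => (hA x).isSelfAdjoint)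
    hf.continuousOn

/-- The matrix of eigenvectors need not depend continuously on A; passing to `cfc` gives access to
continuity of the functional calculus. -/
theorem functionOf_eq_re_add_im {ι : Type*} [Fintype ι] [DecidableEq ι] {A : Matrix ι ι ℂ}
    (hA : A.IsHermitian) (g : ℝ → ℂ) :
    functionOf hA g = cfc (fun y => (g y).re) A + Complex.I • cfc (fun y => (g y).im) A := by
  rw [cfc_eq_functionOf hA, cfc_eq_functionOf hA]
  ext p q
  rw [Matrix.add_apply, Matrix.smul_apply, functionOf_apply, functionOf_apply, functionOf_apply,
    smul_eq_mul, Finset.mul_sum, ← Finset.sum_add_distrib]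
  refine Finset.sum_congr rfl fun i _ => ?_
  rw [← mul_assoc Complex.I, ← add_mul, mul_comm Complex.I, Complex.re_add_im]

theorem continuous_functionOf {X ι : Type*} [TopologicalSpace X] [Fintype ι] [DecidableEq ι]
    {A : X → Matrix ι ι ℂ} (hc : Continuous A) (hA : ∀ x, (A x).IsHermitian) {g : ℝ → ℂ}
    (hg : Continuous g) : Continuous fun x => functionOf (hA x) g := by
  simp_rw [functionOf_eq_re_add_im]
  have h1 : Continuous fun x => cfc (fun y => (g y).re) (A x) :=
    continuous_cfc hc hA (Complex.continuous_re.comp hg)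
  have h2 : Continuous fun x => cfc (fun y => (g y).im) (A x) :=
    continuous_cfc hc hA (Complex.continuous_im.comp hg)
  exact h1.add (h2.const_smul Complex.I)

open scoped Matrix.Norms.L2Operator in
theorem continuous_matrix_exp (ι : Type*) [Fintype ι] [DecidableEq ι] :
    Continuous (NormedSpace.exp : Matrix ι ι ℂ → Matrix ι ι ℂ) := by
  let : NormedAlgebra ℚ (Matrix ι ι ℂ) := NormedAlgebra.restrictScalars ℚ ℂ _
  exact NormedSpace.exp_continuous

/-- The couplings, anisotropies and fields of a chain. -/
abbrev Parameters : Type := (ℕ → ℝ) × (ℕ → ℝ) × (ℕ → ℝ)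

theorem continuous_effectiveHamiltonian (Λ : Finset ℕ) :
    Continuous fun x : Parameters => effectiveHamiltonian Λ x.1 x.2.1 x.2.2 := by
  refine continuous_matrix fun p q => ?_
  obtain ⟨j, x⟩ := p
  obtain ⟨k, y⟩ := q
  simp only [effectiveHamiltonian, effectiveBlock, couplingBlock, Matrix.of_apply]
  split_ifs
  · simp only [Matrix.smul_apply]
    fun_prop
  · fin_cases x <;> fin_cases y <;> simp <;> fun_prop
  · fin_cases x <;> fin_cases y <;> simp <;> fun_prop
  · exact continuous_const

theorem continuous_hamiltonian (Λ : Finset ℕ) :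
    Continuous fun x : Parameters => hamiltonian Λ x.1 x.2.1 x.2.2 := by
  unfold hamiltonian
  refine (continuous_finsetSum _ fun j _ => continuous_finsetSum _ fun k _ => ?_).neg.sub
    (continuous_finsetSum _ fun j _ => ?_)
  · split_ifs <;> fun_prop
  · fun_prop

/-- A bounded function agrees on a finite set with a bounded continuous function. -/
theorem exists_continuous_eqOn (s : Finset ℝ) {g : ℝ → ℂ} (hg : ∀ x, ‖g x‖ ≤ 1) :
    ∃ f : ℝ → ℂ, Continuous f ∧ (∀ x, ‖f x‖ ≤ 1) ∧ ∀ x ∈ s, f x = g x := by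
  -- Interpolate, then divide by max(1, |G|). This enforces the bound and changes nothing at the
  -- nodes, where |g| ≤ 1.
  set p := Lagrange.interpolate s (fun x : ℝ => (x : ℂ)) g with hp
  set G : ℝ → ℂ := fun x => p.eval (x : ℂ) with hG
  have hc : Continuous G := p.continuous.comp Complex.continuous_ofReal
  have hpos : ∀ x, 0 < max 1 ‖G x‖ := fun x => lt_of_lt_of_le one_pos (le_max_left _ _)
  refine ⟨fun x => ((max 1 ‖G x‖ : ℝ) : ℂ)⁻¹ * G x, ?_, fun x => ?_, fun x hx => ?_⟩
  · refine Continuous.mul (Continuous.inv₀ (by fun_prop) fun x => ?_) hc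
    exact_mod_cast (hpos x).ne'
  · rw [norm_mul, norm_inv, Complex.norm_real, Real.norm_of_nonneg (hpos x).le, ← div_eq_inv_mul]
    exact div_le_one_of_le₀ (le_max_right _ _) (hpos x).le
  · have h : G x = g x :=
      Lagrange.eval_interpolate_at_node g (Complex.ofReal_injective.injOn) hx
    simp only [h, max_eq_left (hg x), Complex.ofReal_one, inv_one, one_mul]

theorem functionOf_congr {ι : Type*} [Fintype ι] [DecidableEq ι] {A : Matrix ι ι ℂ}
    (hA : A.IsHermitian) {f g : ℝ → ℂ} (h : ∀ i, f (hA.eigenvalues i) = g (hA.eigenvalues i)) :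
    functionOf hA f = functionOf hA g := by
  unfold functionOf
  simp_rw [h]

/-- Only the values of `g` on the finite spectrum matter. For continuous `g` each term is continuous
in the parameters, so the uncountable supremum is lower semicontinuous, hence measurable. -/
theorem eigencorrelator_eq_iSup_continuous (Λ : Finset ℕ) (μ γ ν : ℕ → ℝ) (j k : Λ) :
    eigencorrelator Λ μ γ ν j k =
      ⨆ (g : ℝ → ℂ) (_ : Continuous g) (_ : ∀ x, ‖g x‖ ≤ 1),
        ENNReal.ofReal ‖Matrix.toEuclideanCLM (n := Fin 2) (𝕜 := ℂ) (Matrix.of fun x y =>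
          functionOf (effectiveHamiltonian_isHermitian Λ μ γ ν) g (j, x) (k, y))‖ := by
  refine le_antisymm ?_ ?_
  · refine iSup_le fun g => iSup_le fun _ => iSup_le fun hg => ?_
    obtain ⟨f, hf, hf1, hfg⟩ := exists_continuous_eqOn
      (Finset.univ.image (effectiveHamiltonian_isHermitian Λ μ γ ν).eigenvalues) hg
    refine le_iSup_of_le f (le_iSup_of_le hf (le_iSup_of_le hf1 ?_))
    rw [functionOf_congr _ fun i => hfg _ (Finset.mem_image_of_mem _ (Finset.mem_univ i))]
  · exact iSup_le fun g => iSup_le fun hg => iSup_le fun hg1 =>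
      le_iSup_of_le g (le_iSup_of_le hg.measurable (le_iSup_of_le hg1 le_rfl))

theorem measurable_eigencorrelator (Λ : Finset ℕ) (j k : Λ) :
    Measurable fun x : Parameters => eigencorrelator Λ x.1 x.2.1 x.2.2 j k := by
  refine LowerSemicontinuous.measurable ?_
  simp_rw [eigencorrelator_eq_iSup_continuous]
  refine lowerSemicontinuous_iSup fun g => lowerSemicontinuous_iSup fun hg =>
    lowerSemicontinuous_iSup fun _ => Continuous.lowerSemicontinuous ?_
  have h := continuous_functionOf (continuous_effectiveHamiltonian Λ)
    (fun x => effectiveHamiltonian_isHermitian Λ x.1 x.2.1 x.2.2) hg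
  have hT : Continuous (Matrix.toEuclideanCLM (n := Fin 2) (𝕜 := ℂ)) :=
    (Matrix.toEuclideanCLM (n := Fin 2) (𝕜 := ℂ)).toAlgEquiv.toLinearMap
      |>.continuous_of_finiteDimensional
  refine ENNReal.continuous_ofReal.comp (continuous_norm.comp (hT.comp ?_))
  exact continuous_matrix fun x y => h.matrix_elem _ _

/-- The supremum of a continuous function over the fibers of a closed set is measurable. -/
theorem measurable_iSup_of_isClosed {X Y : Type*} [TopologicalSpace X] [MeasurableSpace X]
    [BorelSpace X] [TopologicalSpace Y] [SigmaCompactSpace Y] {K : Set (X × Y)} (hK : IsClosed K)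
    {f : X × Y → ℝ≥0∞} (hf : Continuous f) :
    Measurable fun x => ⨆ (y : Y) (_ : (x, y) ∈ K), f (x, y) := by
  -- Projection along a compact factor is a closed map, so along a σ-compact one the image is a
  -- countable union of closed sets.
  have hproj : ∀ K : Set (X × Y), IsClosed K → MeasurableSet (Prod.fst '' K) := by
    intro K hK
    have h : Prod.fst '' K = ⋃ n, Prod.fst ''
        ((fun z : X × compactCovering Y n => (z.1, (z.2 : Y))) ⁻¹' K) := by
      ext x
      simp only [Set.mem_image, Set.mem_iUnion, Prod.exists, exists_and_right, exists_eq_right,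
        Set.mem_preimage]
      constructor
      · rintro ⟨y, hy⟩
        obtain ⟨n, hn⟩ := exists_mem_compactCovering y
        exact ⟨n, ⟨y, hn⟩, hy⟩
      · rintro ⟨n, y, hy⟩
        exact ⟨y, hy⟩
    rw [h]
    refine MeasurableSet.iUnion fun n => ?_
    have : CompactSpace (compactCovering Y n) :=
      isCompact_iff_compactSpace.1 (isCompact_compactCovering Y n)
    exact (isClosedMap_fst_of_compactSpace _ (hK.preimage (by fun_prop))).measurableSet
  refine measurable_of_Ioi fun c => ?_
  have h : (fun x => ⨆ (y : Y) (_ : (x, y) ∈ K), f (x, y)) ⁻¹' Set.Ioi c =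
      ⋃ (q : ℚ) (_ : c < Real.toNNReal q),
        Prod.fst '' (K ∩ {z | (Real.toNNReal q : ℝ≥0∞) ≤ f z}) := by
    ext x
    simp only [Set.mem_preimage, Set.mem_Ioi, lt_iSup_iff, Set.mem_iUnion, Set.mem_image,
      Set.mem_inter_iff, Set.mem_ofPred_eq, Prod.exists, exists_and_right, exists_eq_right]
    constructor
    · rintro ⟨y, hy, hlt⟩
      obtain ⟨q, _, h1, h2⟩ := ENNReal.lt_iff_exists_rat_btwn.1 hlt
      exact ⟨q, h1, y, hy, h2.le⟩
    · rintro ⟨q, h1, y, hy, h2⟩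
      exact ⟨y, hy, h1.trans_le h2⟩
  rw [h]
  exact MeasurableSet.iUnion fun q => MeasurableSet.iUnion fun _ =>
    hproj _ (hK.inter (isClosed_le continuous_const hf))

/-- Degeneracy means two independent eigenvectors, that is, a nonzero 2 × 2 minor. Scaling the minor
to 1 makes this a closed condition on H, E and the vectors. -/
theorem hasSimpleSpectrum_iff {Λ : Finset ℕ} (H : Op Λ) :
    HasSimpleSpectrum H ↔ ∀ (E : ℂ) (φ ψ : Config Λ → ℂ), H *ᵥ φ = E • φ → H *ᵥ ψ = E • ψ →
      ∀ s s', φ s * ψ s' - φ s' * ψ s ≠ 1 := by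
  refine forall_congr' fun E => ?_
  have hmem : ∀ φ : Config Λ → ℂ, φ ∈ Module.End.eigenspace (Matrix.toLin' H) E ↔
      H *ᵥ φ = E • φ := fun φ => by
    rw [Module.End.mem_eigenspace_iff, Matrix.toLin'_apply]
  constructor
  · intro h φ ψ hφ hψ s s'
    obtain ⟨v, hv⟩ := finrank_le_one_iff.1 h
    obtain ⟨c, hc⟩ := hv ⟨φ, (hmem φ).2 hφ⟩
    obtain ⟨c', hc'⟩ := hv ⟨ψ, (hmem ψ).2 hψ⟩
    have e1 : φ = c • (v : Config Λ → ℂ) := (congrArg Subtype.val hc).symm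
    have e2 : ψ = c' • (v : Config Λ → ℂ) := (congrArg Subtype.val hc').symm
    have : φ s * ψ s' - φ s' * ψ s = 0 := by
      rw [e1, e2]
      simp only [Pi.smul_apply, smul_eq_mul]
      ring
    rw [this]
    exact zero_ne_one
  · intro h
    by_cases h0 : ∃ φ : Config Λ → ℂ, H *ᵥ φ = E • φ ∧ φ ≠ 0
    · obtain ⟨φ, hφ, hne⟩ := h0
      obtain ⟨s, hs⟩ := Function.ne_iff.1 hne
      refine finrank_le_one ⟨φ, (hmem φ).2 hφ⟩ ?_
      rintro ⟨ψ, hψ⟩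
      refine ⟨ψ s / φ s, Subtype.ext (funext fun s' => ?_)⟩
      change ψ s / φ s * φ s' = ψ s'
      by_contra hcon
      have hm : φ s * ψ s' - φ s' * ψ s ≠ 0 := by
        intro h0
        apply hcon
        rw [div_mul_eq_mul_div, div_eq_iff hs]
        linear_combination -h0
      refine h φ ((φ s * ψ s' - φ s' * ψ s)⁻¹ • ψ) hφ ?_ s s' ?_
      · rw [Matrix.mulVec_smul, (hmem ψ).1 hψ, smul_comm]
      · simp only [Pi.smul_apply, smul_eq_mul]
        rw [← inv_mul_cancel₀ hm]
        ring
    · push Not at h0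
      refine finrank_le_one 0 ?_
      rintro ⟨ψ, hψ⟩
      exact ⟨0, Subtype.ext ((smul_zero _).trans (h0 ψ ((hmem ψ).1 hψ)).symm)⟩

theorem measurableSet_hasSimpleSpectrum (Λ : Finset ℕ) :
    MeasurableSet {x : Parameters | HasSimpleSpectrum (hamiltonian Λ x.1 x.2.1 x.2.2)} := by
  have hH := continuous_hamiltonian Λ
  -- A supremum of the constant 1 is the indicator of the projection of a closed set, so simplicity
  -- is the vanishing of all the `F s s'`.
  set F : Config Λ → Config Λ → Parameters → ℝ≥0∞ := fun s s' x =>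
    ⨆ (y : ℂ × (Config Λ → ℂ) × (Config Λ → ℂ))
      (_ : (x, y) ∈ {z : Parameters × ℂ × (Config Λ → ℂ) × (Config Λ → ℂ) |
        hamiltonian Λ z.1.1 z.1.2.1 z.1.2.2 *ᵥ z.2.2.1 = z.2.1 • z.2.2.1 ∧
        hamiltonian Λ z.1.1 z.1.2.1 z.1.2.2 *ᵥ z.2.2.2 = z.2.1 • z.2.2.2 ∧
        z.2.2.1 s * z.2.2.2 s' - z.2.2.1 s' * z.2.2.2 s = 1}), 1 with hF
  have hmeas : ∀ s s', Measurable (F s s') := by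
    intro s s'
    have hH' : Continuous fun z : Parameters × ℂ × (Config Λ → ℂ) × (Config Λ → ℂ) =>
      hamiltonian Λ z.1.1 z.1.2.1 z.1.2.2 := hH.comp continuous_fst
    refine measurable_iSup_of_isClosed (f := fun _ => 1) ?_ continuous_const
    refine (isClosed_eq (hH'.matrix_mulVec (by fun_prop)) (by fun_prop)).inter
      ((isClosed_eq (hH'.matrix_mulVec (by fun_prop)) (by fun_prop)).inter
        (isClosed_eq (by fun_prop) continuous_const))
  have h : {x : Parameters | HasSimpleSpectrum (hamiltonian Λ x.1 x.2.1 x.2.2)} =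
      ⋂ s, ⋂ s', F s s' ⁻¹' {0} := by
    ext x
    simp only [Set.mem_ofPred_eq, hasSimpleSpectrum_iff, Set.mem_iInter, Set.mem_preimage,
      Set.mem_singleton_iff, hF, ENNReal.iSup_eq_zero, one_ne_zero, imp_false, Prod.forall, not_and]
    exact ⟨fun h s s' E φ ψ h1 h2 => h E φ ψ h1 h2 s s',
      fun h E φ ψ h1 h2 s s' => h s s' E φ ψ h1 h2⟩
  rw [h]
  exact MeasurableSet.iInter fun s => MeasurableSet.iInter fun s' =>
    hmeas s s' (measurableSet_singleton 0)

theorem pureState_isHermitian {Λ : Finset ℕ} (ψ : Config Λ → ℂ) : (pureState ψ).IsHermitian := by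
  rw [Matrix.IsHermitian, pureState, Matrix.conjTranspose_vecMulVec, star_star]

theorem measurable_supEntanglement {n m : ℕ} (d : Decomposition n m) {Λ₀ : Finset ℕ} :
    Measurable fun x : Parameters => supEntanglement d Λ₀ x.1 x.2.1 x.2.2 := by
  -- For a normalized eigenvector the eigenvalue is its energy expectation; inserting it removes the
  -- quantifier over E and makes the condition closed.
  set K : Set (Parameters × ℝ × (∀ k, Config (d.block k) → ℂ)) :=
    ⋂ k, {z | star (z.2.2 k) ⬝ᵥ z.2.2 k = 1 ∧
    hamiltonian (d.block k) z.1.1 z.1.2.1 z.1.2.2 *ᵥ z.2.2 k =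
      (star (z.2.2 k) ⬝ᵥ hamiltonian (d.block k) z.1.1 z.1.2.1 z.1.2.2 *ᵥ z.2.2 k) • z.2.2 k}
    with hKdef
  have hK : IsClosed K := by
    refine isClosed_iInter fun k => ?_
    have hH' : Continuous fun z : Parameters × ℝ × (∀ k, Config (d.block k) → ℂ) =>
      hamiltonian (d.block k) z.1.1 z.1.2.1 z.1.2.2 :=
        (continuous_hamiltonian (d.block k)).comp continuous_fst
    have hψ : Continuous fun z : Parameters × ℝ × (∀ k, Config (d.block k) → ℂ) => z.2.2 k := by
      fun_prop
    have hHψ := hH'.matrix_mulVec hψ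
    exact (isClosed_eq (hψ.star.dotProduct hψ) continuous_const).inter
      (isClosed_eq hHψ ((hψ.star.dotProduct hHψ).smul hψ))
  set f : Parameters × ℝ × (∀ k, Config (d.block k) → ℂ) → ℝ≥0∞ := fun z =>
    ENNReal.ofReal (entanglement Λ₀
      (evolve (hamiltonian (Finset.range n) z.1.1 z.1.2.1 z.1.2.2) z.2.1
        (pureState (productVector d z.2.2)))) with hfdef
  have hf : Continuous f := by
    refine ENNReal.continuous_ofReal.comp (Complex.continuous_re.comp (Continuous.matrix_trace ?_))
    have hH' : Continuous fun z : Parameters × ℝ × (∀ k, Config (d.block k) → ℂ) =>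
      hamiltonian (Finset.range n) z.1.1 z.1.2.1 z.1.2.2 :=
        (continuous_hamiltonian (Finset.range n)).comp continuous_fst
    have hprop : Continuous fun z : Parameters × ℝ × (∀ k, Config (d.block k) → ℂ) => propagator
        (hamiltonian (Finset.range n) z.1.1 z.1.2.1 z.1.2.2) z.2.1 :=
      (continuous_matrix_exp _).comp (Continuous.smul (f := fun z => -(Complex.I * (z.2.1 : ℂ)))
        (by fun_prop) hH')
    have hvec : Continuous fun z : Parameters × ℝ × (∀ k, Config (d.block k) → ℂ) =>
        productVector d z.2.2 := by
      unfold productVector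
      fun_prop
    simp_rw [evolve_pureState (hamiltonian_isHermitian _ _ _ _)]
    have hφ := hprop.matrix_mulVec hvec
    refine continuous_cfc ?_ ?_ Real.continuous_negMulLog
    · refine continuous_matrix fun s s' => continuous_finsetSum _ fun u _ => ?_
      exact (hφ.matrix_vecMulVec hφ.star).matrix_elem _ _
    · intro z
      ext s s'
      rw [Matrix.conjTranspose_apply, partialTrace, Matrix.of_apply, Matrix.of_apply, star_sum]
      exact Finset.sum_congr rfl fun u _ => (pureState_isHermitian _).apply _ _
  have h := measurable_iSup_of_isClosed hK hf
  convert h using 2 with x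
  rw [iSup_prod]
  refine iSup_congr fun t => iSup_congr fun ψ => ?_
  refine iSup_congr_Prop ?_ fun _ => ?_
  · simp only [hKdef, Set.mem_iInter, Set.mem_ofPred_eq]
    refine forall_congr' fun k => and_congr_right fun h1 => ⟨?_, fun h => ⟨_, h⟩⟩
    rintro ⟨E, hE⟩
    rw [hE, dotProduct_smul, h1, smul_eq_mul, mul_one]
  · rw [productState_pureState]

/-! ### Translation invariance -/

theorem functionOf_mulVec_of_eigen {ι : Type*} [Fintype ι] [DecidableEq ι] {A : Matrix ι ι ℂ}
    (hA : A.IsHermitian) (g : ℝ → ℂ) {v : ι → ℂ} {x : ℝ} (hv : A *ᵥ v = (x : ℂ) • v) :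
    functionOf hA g *ᵥ v = g x • v := by
  rw [functionOf_mulVec]
  conv_rhs => rw [← sum_eigvec hA v, Finset.smul_sum]
  refine Finset.sum_congr rfl fun i _ => ?_
  rw [smul_smul]
  by_cases h : hA.eigenvalues i = x
  · rw [h]
  · rw [dotProduct_eq_zero_of_ne hA (mulVec_eigvec hA i) hv h, mul_zero, mul_zero]

/-- A relabelling need not match the chosen eigenbases, so the two sides are compared on
eigenvectors, where both act as g of the eigenvalue. -/
theorem functionOf_submatrix {ι κ : Type*} [Fintype ι] [DecidableEq ι] [Fintype κ] [DecidableEq κ]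
    {A : Matrix ι ι ℂ} {B : Matrix κ κ ℂ} (hA : A.IsHermitian) (hB : B.IsHermitian) (e : ι ≃ κ)
    (h : A = B.submatrix e e) (g : ℝ → ℂ) :
    functionOf hA g = (functionOf hB g).submatrix e e := by
  have key : ∀ i, functionOf hA g *ᵥ eigvec hA i =
      (functionOf hB g).submatrix e e *ᵥ eigvec hA i := by
    intro i
    have hi := mulVec_eigvec hA i
    rw [functionOf_mulVec_of_eigen hA g hi, Matrix.submatrix_mulVec_equiv,
      functionOf_mulVec_of_eigen hB g (x := hA.eigenvalues i)]
    · funext p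
      simp
    · have h2 := hi
      nth_rewrite 1 [h] at h2
      rw [Matrix.submatrix_mulVec_equiv] at h2
      funext q
      simpa using congrFun h2 (e.symm q)
  refine Matrix.ext_of_mulVec_single fun p => ?_
  rw [← sum_eigvec hA (Pi.single p 1), Matrix.mulVec_sum, Matrix.mulVec_sum]
  exact Finset.sum_congr rfl fun i _ => by rw [Matrix.mulVec_smul, Matrix.mulVec_smul, key]

section

variable {Λ Λ' : Finset ℕ} {e : Λ ≃ Λ'} {r : ℕ}

theorem effectiveHamiltonian_translate (he : ∀ j : Λ, (j : ℕ) = e j + r) (μ γ ν : ℕ → ℝ) :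
    effectiveHamiltonian Λ μ γ ν = (effectiveHamiltonian Λ' (fun i => μ (i + r))
      (fun i => γ (i + r)) (fun i => ν (i + r))).submatrix (e.prodCongr (Equiv.refl _))
        (e.prodCongr (Equiv.refl _)) := by
  ext ⟨j, x⟩ ⟨k, y⟩
  simp only [effectiveHamiltonian, effectiveBlock, Matrix.submatrix_apply, Matrix.of_apply,
    Equiv.prodCongr_apply, Prod.map_apply, Equiv.coe_refl, id_eq, he j, he k,
    Nat.add_right_cancel_iff,
    add_right_comm _ r 1]

theorem eigencorrelator_translate (he : ∀ j : Λ, (j : ℕ) = e j + r) (μ γ ν : ℕ → ℝ) (j k : Λ) :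
    eigencorrelator Λ μ γ ν j k = eigencorrelator Λ' (fun i => μ (i + r))
      (fun i => γ (i + r)) (fun i => ν (i + r)) (e j) (e k) := by
  unfold eigencorrelator
  simp_rw [functionOf_submatrix (effectiveHamiltonian_isHermitian Λ μ γ ν)
    (effectiveHamiltonian_isHermitian Λ' (fun i => μ (i + r)) (fun i => γ (i + r))
      fun i => ν (i + r)) _ (effectiveHamiltonian_translate he μ γ ν)]
  rfl

theorem siteOp_translate (j : Λ) (A : Matrix (Fin 2) (Fin 2) ℂ) :
    siteOp j A = (siteOp (e j) A).submatrix (e.arrowCongr (Equiv.refl _))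
      (e.arrowCongr (Equiv.refl _)) := by
  ext s s'
  simp only [siteOp, Matrix.submatrix_apply, Matrix.of_apply, Equiv.arrowCongr_apply,
    Equiv.coe_refl, Function.comp_apply, id_eq, Equiv.symm_apply_apply]
  refine if_congr ⟨fun h i hi => h _ ?_, fun h i hi => ?_⟩ rfl rfl
  · rintro rfl
    exact hi (e.apply_symm_apply i).symm
  · simpa using h (e i) (e.injective.ne hi)

theorem hamiltonian_translate (he : ∀ j : Λ, (j : ℕ) = e j + r) (μ γ ν : ℕ → ℝ) :
    hamiltonian Λ μ γ ν = (hamiltonian Λ' (fun i => μ (i + r))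
      (fun i => γ (i + r)) (fun i => ν (i + r))).submatrix (e.arrowCongr (Equiv.refl _))
        (e.arrowCongr (Equiv.refl _)) := by
  set T := Matrix.reindexAlgEquiv ℂ ℂ (e.arrowCongr (Equiv.refl (Fin 2))).symm
  have hT : ∀ j A, T (siteOp (e j) A) = siteOp j A := fun j A => (siteOp_translate j A).symm
  change _ = T (hamiltonian Λ' (fun i => μ (i + r)) (fun i => γ (i + r)) fun i => ν (i + r))
  simp only [hamiltonian, map_sub, map_neg, map_sum]
  congr 1
  · congr 1
    refine Fintype.sum_equiv e _ _ fun j => Fintype.sum_equiv e _ _ fun k => ?_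
    rw [apply_ite T, map_zero, map_smul, map_add, map_smul, map_smul, map_mul, map_mul]
    simp only [hT, he j, he k, add_right_comm _ r 1, Nat.add_right_cancel_iff]
  · refine Fintype.sum_equiv e _ _ fun j => ?_
    rw [map_smul, hT, he j]

theorem HasSimpleSpectrum.translate (he : ∀ j : Λ, (j : ℕ) = e j + r) {μ γ ν : ℕ → ℝ}
    (h : HasSimpleSpectrum (hamiltonian Λ' (fun i => μ (i + r)) (fun i => γ (i + r))
      (fun i => ν (i + r)))) : HasSimpleSpectrum (hamiltonian Λ μ γ ν) := by
  rw [hasSimpleSpectrum_iff] at h ⊢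
  intro E φ ψ hφ hψ s s'
  rw [hamiltonian_translate he, Matrix.submatrix_mulVec_equiv] at hφ hψ
  set eC := e.arrowCongr (Equiv.refl (Fin 2))
  have key : ∀ φ : Config Λ → ℂ, (hamiltonian Λ' (fun i => μ (i + r)) (fun i => γ (i + r))
      (fun i => ν (i + r)) *ᵥ (φ ∘ eC.symm)) ∘ eC = E • φ →
      hamiltonian Λ' (fun i => μ (i + r)) (fun i => γ (i + r))
      (fun i => ν (i + r)) *ᵥ (φ ∘ eC.symm) = E • (φ ∘ eC.symm) := by
    intro φ hφ
    funext x
    simpa using congrFun hφ (eC.symm x)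
  simpa using h E _ _ (key φ hφ) (key ψ hψ) (eC s) (eC s')

end

/-- The translation of a block to the beginning of the chain. -/
def icoEquivRange (r s : ℕ) : Finset.Ico r s ≃ Finset.range (s - r) where
  toFun j := ⟨j - r, Finset.mem_range.2 (by have := Finset.mem_Ico.1 j.2; omega)⟩
  invFun j := ⟨j + r, Finset.mem_Ico.2 (by have := Finset.mem_range.1 j.2; omega)⟩
  left_inv j := Subtype.ext (Nat.sub_add_cancel (Finset.mem_Ico.1 j.2).1)
  right_inv j := Subtype.ext (Nat.add_sub_cancel _ _)

theorem icoEquivRange_add (r s : ℕ) (j : Finset.Ico r s) : (j : ℕ) = icoEquivRange r s j + r :=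
  (Nat.sub_add_cancel (Finset.mem_Ico.1 j.2).1).symm

/-! ### Stationarity of the disorder -/

/-- The parameters of the chain translated by `r`. -/
def translateParameters (r : ℕ) (x : Parameters) : Parameters :=
  (fun i => x.1 (i + r), fun i => x.2.1 (i + r), fun i => x.2.2 (i + r))

/-- By independence the joint law is a product of the single-site laws. The translation is an
injective relabelling within each of the three families, and identical distribution makes the
factors agree. -/
theorem map_translate_eq {Ω : Type*} [MeasurableSpace Ω] (P : Measure Ω)
    {μ γ ν : ℕ → Ω → ℝ}
    (hμ : ∀ j, Measurable (μ j)) (hγ : ∀ j, Measurable (γ j)) (hν : ∀ j, Measurable (ν j))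
    (hindep : iIndepFun (Sum.elim μ (Sum.elim γ ν)) P)
    (hidμ : ∀ j, IdentDistrib (μ j) (μ 0) P P)
    (hidγ : ∀ j, IdentDistrib (γ j) (γ 0) P P)
    (hidν : ∀ j, IdentDistrib (ν j) (ν 0) P P) (r : ℕ) :
    P.map (fun ω => translateParameters r (fun i => μ i ω, fun i => γ i ω, fun i => ν i ω)) =
      P.map fun ω => (fun i => μ i ω, fun i => γ i ω, fun i => ν i ω) := by
  set X : ℕ ⊕ ℕ ⊕ ℕ → Ω → ℝ := Sum.elim μ (Sum.elim γ ν)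
  have hX : ∀ i, Measurable (X i) := by rintro (i | i | i); exacts [hμ i, hγ i, hν i]
  set σ : ℕ ⊕ ℕ ⊕ ℕ → ℕ ⊕ ℕ ⊕ ℕ := Sum.map (· + r) (Sum.map (· + r) (· + r))
  have hσ : Function.Injective σ :=
    (add_left_injective r).sumMap ((add_left_injective r).sumMap (add_left_injective r))
  have hlaw : P.map (fun ω i => X (σ i) ω) = P.map fun ω i => X i ω := by
    rw [hindep.map_fun_eq_infinitePi_map hX,
      (hindep.precomp hσ).map_fun_eq_infinitePi_map fun i => hX (σ i)]
    congr 1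
    funext i
    rcases i with i | i | i
    · exact (hidμ (i + r)).map_eq.trans (hidμ i).map_eq.symm
    · exact (hidγ (i + r)).map_eq.trans (hidγ i).map_eq.symm
    · exact (hidν (i + r)).map_eq.trans (hidν i).map_eq.symm
  set T : (ℕ ⊕ ℕ ⊕ ℕ → ℝ) → Parameters := fun y =>
    (fun i => y (Sum.inl i), fun i => y (Sum.inr (Sum.inl i)), fun i => y (Sum.inr (Sum.inr i)))
  have hT : Measurable T := by fun_prop
  have h := congrArg (Measure.map T) hlaw
  rwa [Measure.map_map hT (measurable_pi_iff.2 fun i => hX (σ i)),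
    Measure.map_map hT (measurable_pi_iff.2 hX)] at h

theorem ae_hasSimpleSpectrum_Ico {Ω : Type*} [MeasurableSpace Ω] {P : Measure Ω}
    {x : Ω → Parameters} (hx : Measurable x)
    (hlaw : ∀ r, P.map (fun ω => translateParameters r (x ω)) = P.map x)
    (hsimple : ∀ n : ℕ, ∀ᵐ ω ∂P, HasSimpleSpectrum
      (hamiltonian (Finset.range n) (x ω).1 (x ω).2.1 (x ω).2.2)) (r s : ℕ) :
    ∀ᵐ ω ∂P, HasSimpleSpectrum (hamiltonian (Finset.Ico r s) (x ω).1 (x ω).2.1 (x ω).2.2) := by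
  have hT : Measurable (translateParameters r) := by
    unfold translateParameters
    fun_prop
  have hms := measurableSet_hasSimpleSpectrum (Finset.range (s - r))
  have h := (ae_map_iff hx.aemeasurable hms).2 (hsimple (s - r))
  rw [← hlaw r] at h
  filter_upwards [(ae_map_iff (hT.comp hx).aemeasurable hms).1 h] with ω hω
  exact HasSimpleSpectrum.translate (icoEquivRange_add r s) hω

theorem measurable_cutCorrelator (Λ : Finset ℕ) (j k : Λ) :
    Measurable fun x : Parameters => cutCorrelator Λ x.1 x.2.1 x.2.2 j k :=
  measurable_const.min (measurable_eigencorrelator Λ j k)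

theorem lintegral_cutCorrelator_Ico {Ω : Type*} [MeasurableSpace Ω] {P : Measure Ω}
    {x : Ω → Parameters} (hx : Measurable x)
    (hlaw : ∀ r, P.map (fun ω => translateParameters r (x ω)) = P.map x) (r s : ℕ)
    (j k : Finset.Ico r s) :
    ∫⁻ ω, cutCorrelator (Finset.Ico r s) (x ω).1 (x ω).2.1 (x ω).2.2 j k ∂P =
      ∫⁻ ω, cutCorrelator (Finset.range (s - r)) (x ω).1 (x ω).2.1 (x ω).2.2
        (icoEquivRange r s j) (icoEquivRange r s k) ∂P := by
  have hT : Measurable (translateParameters r) := by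
    unfold translateParameters
    fun_prop
  have hm := measurable_cutCorrelator (Finset.range (s - r)) (icoEquivRange r s j)
    (icoEquivRange r s k)
  have h1 := lintegral_map (μ := P) hm hx
  have h2 := lintegral_map (μ := P) hm (hT.comp hx)
  rw [← h1, ← hlaw r]
  refine Eq.trans ?_ h2.symm
  refine lintegral_congr fun ω => ?_
  rw [cutCorrelator, eigencorrelator_translate (icoEquivRange_add r s)]
  rfl

theorem measurable_blockCorrelator {n m : ℕ} (d : Decomposition n m) (j k : Finset.range n) :
    Measurable fun x : Parameters => blockCorrelator d x.1 x.2.1 x.2.2 j k := by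
  refine Finset.measurable_fun_sum _ fun l _ => ?_
  by_cases h : (j : ℕ) ∈ d.block l ∧ (k : ℕ) ∈ d.block l
  · simp only [h, and_self, dite_true]
    exact measurable_cutCorrelator _ _ _
  · simp only [h, dite_false]
    exact measurable_const

/-- Two sites of a chain are either uncorrelated or in a common block. -/
theorem blockCorrelator_eq_zero_or {n m : ℕ} (d : Decomposition n m) (j k : Finset.range n) :
    (∀ μ γ ν, blockCorrelator d μ γ ν j k = 0) ∨
      ∃ (l : Fin m) (hj : (j : ℕ) ∈ d.block l) (hk : (k : ℕ) ∈ d.block l), ∀ μ γ ν,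
        blockCorrelator d μ γ ν j k = cutCorrelator (d.block l) μ γ ν ⟨j, hj⟩ ⟨k, hk⟩ := by
  obtain ⟨l, hj⟩ := d.exists_block (Finset.mem_range.1 j.2)
  have hne : ∀ l', l' ≠ l → ¬ ((j : ℕ) ∈ d.block l' ∧ (k : ℕ) ∈ d.block l') :=
    fun l' hl' h => hl' (d.block_unique h.1 hj)
  by_cases hk : (k : ℕ) ∈ d.block l
  · refine Or.inr ⟨l, hj, hk, fun μ γ ν => ?_⟩
    rw [blockCorrelator, Finset.sum_eq_single l (fun l' _ h => dif_neg (hne l' h))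
      (fun h => absurd (Finset.mem_univ l) h), dif_pos ⟨hj, hk⟩]
  · refine Or.inl fun μ γ ν => Finset.sum_eq_zero fun l' _ => dif_neg ?_
    by_cases h : l' = l
    · rw [h]
      exact fun h' => hk h'.2
    · exact hne l' h

theorem cutCorrelator_le_one (Λ : Finset ℕ) (μ γ ν : ℕ → ℝ) (j k : Λ) :
    cutCorrelator Λ μ γ ν j k ≤ 1 := min_le_left _ _

theorem blockCorrelator_le_one {n m : ℕ} (d : Decomposition n m) (μ γ ν : ℕ → ℝ)
    (j k : Finset.range n) : blockCorrelator d μ γ ν j k ≤ 1 := by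
  rcases blockCorrelator_eq_zero_or d j k with h | ⟨l, hj, hk, h⟩
  · rw [h]
    exact zero_le
  · rw [h]
    exact cutCorrelator_le_one _ _ _ _ _ _

/-! ### Summation of the correlations -/

/-- Power-law decay in the distance of two sites. -/
def decay (s : ℝ) (j k : ℕ) : ℝ≥0∞ := ENNReal.ofReal ((1 + |(j : ℝ) - k|) ^ (-s))

theorem decay_comm (s : ℝ) (j k : ℕ) : decay s j k = decay s k j := by
  rw [decay, decay, abs_sub_comm]

theorem decay_pow_three (C β : ℝ) (j k : ℕ) :
    ENNReal.ofReal (C / (1 + |(j : ℝ) - k|) ^ β) = ENNReal.ofReal C * decay (β / 3) j k ^ 3 := by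
  have h : (0 : ℝ) ≤ 1 + |(j : ℝ) - k| := by positivity
  rw [decay, ← ENNReal.ofReal_pow (Real.rpow_nonneg h _), ← Real.rpow_natCast, ← Real.rpow_mul h,
    ← ENNReal.ofReal_mul' (Real.rpow_nonneg h _), div_eq_mul_inv, ← Real.rpow_neg h]
  congr 3
  push_cast
  ring

/-- The integral is at most that of any one factor. Multiplying the three estimates and taking the
cube root replaces Hölder's inequality, needs no independence, and divides the decay exponent by
three. -/
theorem lintegral_mul_mul_le {Ω : Type*} [MeasurableSpace Ω] {P : Measure Ω} {f g h : Ω → ℝ≥0∞}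
    (hf : ∀ ω, f ω ≤ 1) (hg : ∀ ω, g ω ≤ 1) (hh : ∀ ω, h ω ≤ 1) {c a b d : ℝ≥0∞}
    (ha : ∫⁻ ω, f ω ∂P ≤ c * a ^ 3) (hb : ∫⁻ ω, g ω ∂P ≤ c * b ^ 3)
    (hd : ∫⁻ ω, h ω ∂P ≤ c * d ^ 3) : ∫⁻ ω, f ω * g ω * h ω ∂P ≤ c * (a * b * d) := by
  set I := ∫⁻ ω, f ω * g ω * h ω ∂P
  have h1 : I ≤ c * a ^ 3 := le_trans (lintegral_mono fun ω =>
    (mul_le_of_le_one_right' (hh ω)).trans (mul_le_of_le_one_right' (hg ω))) ha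
  have h2 : I ≤ c * b ^ 3 := le_trans (lintegral_mono fun ω =>
    (mul_le_of_le_one_right' (hh ω)).trans (mul_le_of_le_one_left' (hf ω))) hb
  have h3 : I ≤ c * d ^ 3 := le_trans (lintegral_mono fun ω =>
    mul_le_of_le_one_left' (mul_le_one' (hf ω) (hg ω))) hd
  refine (ENNReal.pow_le_pow_left_iff three_ne_zero).1 ?_
  calc I ^ 3 = I * I * I := by ring
    _ ≤ (c * a ^ 3) * (c * b ^ 3) * (c * d ^ 3) := by gcongr
    _ = (c * (a * b * d)) ^ 3 := by ring

/-- A path j, l, l', k from inside to outside has a step that leaves the set. That step is summed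
with the boundary bound `A`, the two others freely with `B`; the three choices give the 3. -/
theorem sum_boundary_le {V : Type*} [Fintype V] (p : V → Prop) [DecidablePred p]
    {g : V → V → ℝ≥0∞} (hg : ∀ j k, g j k = g k j) {A B : ℝ≥0∞} (hB : ∀ j, ∑ k, g j k ≤ B)
    (hA : ∑ j ∈ Finset.univ.filter p, ∑ k ∈ Finset.univ.filter (fun k => ¬ p k), g j k ≤ A) :
    ∑ j ∈ Finset.univ.filter p, ∑ k ∈ Finset.univ.filter (fun k => ¬ p k), ∑ l, ∑ l',
      g j l * g l l' * g k l' ≤ 3 * (A * B * B) := by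
  set χ : V → V → ℝ≥0∞ := fun j k => if p j ∧ ¬ p k then 1 else 0 with hχ
  have hfilter : ∀ f : V → V → ℝ≥0∞, ∑ j ∈ Finset.univ.filter p,
      ∑ k ∈ Finset.univ.filter (fun k => ¬ p k), f j k = ∑ j, ∑ k, χ j k * f j k := by
    intro f
    rw [Finset.sum_filter]
    refine Finset.sum_congr rfl fun j _ => ?_
    split_ifs with hj
    · rw [Finset.sum_filter]
      exact Finset.sum_congr rfl fun k _ => by simp [hχ, hj]
    · simp [hχ, hj]
  rw [hfilter] at hA ⊢
  have hcut : ∀ j k l l', χ j k ≤ χ j l + χ l l' + χ l' k := by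
    intro j k l l'
    simp only [hχ]
    by_cases hj : p j <;> by_cases hk : p k <;> by_cases hl : p l <;> by_cases hl' : p l' <;>
      simp [hj, hk, hl, hl']
  have hB' : ∀ k, ∑ j, g j k ≤ B := fun k => by simpa only [hg _ k] using hB k
  calc ∑ j, ∑ k, χ j k * ∑ l, ∑ l', g j l * g l l' * g k l'
      ≤ ∑ j, ∑ k, ∑ l, ∑ l', (χ j l * g j l * g l l' * g l' k + χ l l' * g l l' * g j l * g l' k +
          χ l' k * g l' k * g l l' * g j l) := by
        refine Finset.sum_le_sum fun j _ => Finset.sum_le_sum fun k _ => ?_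
        rw [Finset.mul_sum]
        refine Finset.sum_le_sum fun l _ => ?_
        rw [Finset.mul_sum]
        refine Finset.sum_le_sum fun l' _ => ?_
        rw [hg k l']
        calc _ ≤ (χ j l + χ l l' + χ l' k) * (g j l * g l l' * g l' k) := by
              gcongr
              exact hcut j k l l'
          _ = _ := by ring
    _ = ∑ j, ∑ l, χ j l * g j l * (∑ l', g l l' * ∑ k, g l' k) +
        ∑ l, ∑ l', χ l l' * g l l' * ((∑ j, g j l) * ∑ k, g l' k) +
        ∑ l', ∑ k, χ l' k * g l' k * (∑ l, g l l' * ∑ j, g j l) := by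
        simp only [Finset.sum_add_distrib]
        congr 1
        · congr 1
          · refine Finset.sum_congr rfl fun j _ => ?_
            rw [Finset.sum_comm]
            refine Finset.sum_congr rfl fun l _ => ?_
            rw [Finset.sum_comm, Finset.mul_sum]
            refine Finset.sum_congr rfl fun l' _ => ?_
            rw [Finset.mul_sum, Finset.mul_sum]
            exact Finset.sum_congr rfl fun k _ => by ring
          · rw [Finset.sum_congr rfl fun j _ => Finset.sum_comm, Finset.sum_comm]
            refine Finset.sum_congr rfl fun l _ => ?_
            rw [Finset.sum_congr rfl fun j _ => Finset.sum_comm, Finset.sum_comm]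
            refine Finset.sum_congr rfl fun l' _ => ?_
            rw [Finset.sum_mul_sum, Finset.mul_sum]
            refine Finset.sum_congr rfl fun j _ => ?_
            rw [Finset.mul_sum]
            exact Finset.sum_congr rfl fun k _ => by ring
        · rw [Finset.sum_comm, Finset.sum_congr rfl fun k _ => Finset.sum_congr rfl fun j _ =>
            Finset.sum_comm, Finset.sum_congr rfl fun k _ => Finset.sum_comm, Finset.sum_comm]
          refine Finset.sum_congr rfl fun l' _ => Finset.sum_congr rfl fun k _ => ?_
          rw [Finset.sum_comm, Finset.mul_sum]
          refine Finset.sum_congr rfl fun l _ => ?_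
          rw [Finset.mul_sum, Finset.mul_sum]
          exact Finset.sum_congr rfl fun j _ => by ring
    _ ≤ A * (B * B) + A * (B * B) + A * (B * B) := by
        have hAX : ∀ X : V → V → ℝ≥0∞, (∀ l l', X l l' ≤ B * B) →
            ∑ l, ∑ l', χ l l' * g l l' * X l l' ≤ A * (B * B) := fun X hX =>
          calc ∑ l, ∑ l', χ l l' * g l l' * X l l'
              ≤ ∑ l, ∑ l', χ l l' * g l l' * (B * B) := by
                gcongr
                exact hX _ _
            _ = (∑ l, ∑ l', χ l l' * g l l') * (B * B) := by simp only [Finset.sum_mul]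
            _ ≤ A * (B * B) := by gcongr
        have hBB : ∀ (f : V → V → ℝ≥0∞) (h : V → ℝ≥0∞) (l : V), (∑ l', f l l' ≤ B) →
            (∀ l', h l' ≤ B) → ∑ l', f l l' * h l' ≤ B * B := fun f h l hf hh =>
          calc ∑ l', f l l' * h l' ≤ ∑ l', f l l' * B := by
                gcongr
                exact hh _
            _ ≤ B * B := by
                rw [← Finset.sum_mul]
                gcongr
        refine add_le_add (add_le_add (hAX _ fun j l => ?_) (hAX _ fun l l' => ?_))
          (hAX _ fun l' k => ?_)
        · exact hBB g _ l (hB l) hB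
        · exact mul_le_mul' (hB' l) (hB l')
        · exact hBB (fun l' l => g l l') _ l' (hB' l') hB'
    _ = 3 * (A * B * B) := by ring

theorem sum_comp_le_tsum {V : Type*} (t : Finset V) (f : ℕ → ℝ≥0∞) {φ : V → ℕ}
    (hφ : Set.InjOn φ t) : ∑ j ∈ t, f (φ j) ≤ ∑' i, f i := by
  rw [← Finset.sum_image (f := f) hφ]
  exact ENNReal.sum_le_tsum _

/-- The decay weights at the distances `0, 1, 2, …`. -/
def decayTotal (s : ℝ) : ℝ≥0∞ := ∑' i : ℕ, decay s i 0

theorem decayTotal_ne_top {s : ℝ} (hs : 1 < s) : decayTotal s ≠ ⊤ := by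
  have h : Summable fun i : ℕ => (1 + |(i : ℝ) - (0 : ℕ)|) ^ (-s) := by
    have h1 := (summable_nat_add_iff 1).2 (Real.summable_nat_rpow.2 (neg_lt_neg hs))
    refine h1.congr fun i => ?_
    rw [Nat.cast_zero, sub_zero, Nat.abs_cast, Nat.cast_add, Nat.cast_one, add_comm]
  exact h.tsum_ofReal_ne_top

theorem decay_eq_sub {s : ℝ} {j k : ℕ} (h : k ≤ j) : decay s j k = decay s (j - k) 0 := by
  rw [decay, decay, Nat.cast_sub h, Nat.cast_zero, sub_zero]

theorem sum_decay_le {n : ℕ} (s : ℝ) (j : Finset.range n) :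
    ∑ k : Finset.range n, decay s j k ≤ 2 * decayTotal s := by
  rw [← Finset.sum_filter_add_sum_filter_not Finset.univ (fun k : Finset.range n => (k : ℕ) ≤ j),
    two_mul]
  refine add_le_add ?_ ?_
  · rw [Finset.sum_congr rfl fun k hk => decay_eq_sub (Finset.mem_filter.1 hk).2]
    refine sum_comp_le_tsum _ (fun i => decay s i 0) fun k hk k' hk' h => Subtype.ext ?_
    have h1 := (Finset.mem_filter.1 hk).2
    have h2 := (Finset.mem_filter.1 hk').2
    omega
  · rw [Finset.sum_congr rfl fun (k : Finset.range n) hk => (decay_comm s j k).trans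
      (decay_eq_sub (not_le.1 (Finset.mem_filter.1 hk).2).le)]
    refine sum_comp_le_tsum _ (fun i => decay s i 0) fun k hk k' hk' h => Subtype.ext ?_
    have h1 := (Finset.mem_filter.1 hk).2
    have h2 := (Finset.mem_filter.1 hk').2
    omega

/-- With the distance split at `a` into x + y one has (1+x)(1+y) ≤ (1+x+y)², so half the exponent
goes to each part. -/
theorem decay_le_mul {s : ℝ} (hs : 0 ≤ s) {j k a : ℕ} (hj : a ≤ j) (hk : k ≤ a) :
    decay s j k ≤ decay (s / 2) (j - a) 0 * decay (s / 2) (a - k) 0 := by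
  rw [← decay_eq_sub hj, ← decay_eq_sub hk, decay, decay, decay,
    ← ENNReal.ofReal_mul (by positivity)]
  refine ENNReal.ofReal_le_ofReal ?_
  have hj' : (a : ℝ) ≤ j := by exact_mod_cast hj
  have hk' : (k : ℝ) ≤ a := by exact_mod_cast hk
  rw [abs_of_nonneg (by linarith), abs_of_nonneg (by linarith), abs_of_nonneg (by linarith),
    ← Real.mul_rpow (by linarith) (by linarith)]
  calc (1 + ((j : ℝ) - k)) ^ (-s) = ((1 + ((j : ℝ) - k)) ^ (2 : ℕ)) ^ (-(s / 2)) := by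
        rw [← Real.rpow_natCast, ← Real.rpow_mul (by linarith)]
        congr 1
        push_cast
        ring
    _ ≤ ((1 + ((j : ℝ) - a)) * (1 + ((a : ℝ) - k))) ^ (-(s / 2)) := by
        refine Real.rpow_le_rpow_of_nonpos ?_ ?_ (by linarith)
        · exact mul_pos (by linarith) (by linarith)
        · nlinarith [mul_nonneg (sub_nonneg.2 hj') (sub_nonneg.2 hk'), sq_nonneg ((j : ℝ) - k)]

/-- Separated pairs straddle one of the two endpoints. After splitting the decay there the double
sum factorizes, with a bound independent of `n`, `a` and `b`. -/
theorem sum_decay_boundary_le {n : ℕ} {s : ℝ} (hs : 0 ≤ s) (a b : ℕ) :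
    ∑ j ∈ Finset.univ.filter (fun j : Finset.range n => (j : ℕ) ∈ Finset.Icc a b),
      ∑ k ∈ Finset.univ.filter (fun k : Finset.range n => (k : ℕ) ∉ Finset.Icc a b),
        decay s j k ≤ 2 * decayTotal (s / 2) ^ 2 := by
  set D := fun i => decay (s / 2) i 0 with hD
  set J := Finset.univ.filter (fun j : Finset.range n => (j : ℕ) ∈ Finset.Icc a b) with hJ
  set K := Finset.univ.filter (fun k : Finset.range n => (k : ℕ) ∉ Finset.Icc a b) with hK
  set K₁ := K.filter fun k : Finset.range n => (k : ℕ) < a with hK₁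
  set K₂ := K.filter fun k : Finset.range n => ¬ (k : ℕ) < a with hK₂
  have mJ : ∀ j ∈ J, a ≤ j ∧ j ≤ b := fun j hj => Finset.mem_Icc.1 (Finset.mem_filter.1 hj).2
  have m₁ : ∀ k ∈ K₁, (k : ℕ) < a := fun k hk => (Finset.mem_filter.1 hk).2
  have m₂ : ∀ k ∈ K₂, b < k := fun k hk => by
    have h1 := (Finset.mem_filter.1 hk).2
    have h2 := (Finset.mem_filter.1 (Finset.mem_filter.1 hk).1).2
    rw [Finset.mem_Icc] at h2
    omega
  have h1 : ∑ j ∈ J, ∑ k ∈ K₁, decay s j k ≤ decayTotal (s / 2) * decayTotal (s / 2) := by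
    calc _ ≤ ∑ j ∈ J, ∑ k ∈ K₁, D (j - a) * D (a - k) :=
          Finset.sum_le_sum fun j hj => Finset.sum_le_sum fun k hk =>
            decay_le_mul hs (mJ j hj).1 (m₁ k hk).le
      _ = (∑ j ∈ J, D (j - a)) * ∑ k ∈ K₁, D (a - k) := (Finset.sum_mul_sum _ _ _ _).symm
      _ ≤ _ := by
          refine mul_le_mul' (sum_comp_le_tsum _ D fun k hk k' hk' h => Subtype.ext ?_)
            (sum_comp_le_tsum _ D fun k hk k' hk' h => Subtype.ext ?_)
          · have := mJ k hk
            have := mJ k' hk'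
            omega
          · have := m₁ k hk
            have := m₁ k' hk'
            omega
  have h2 : ∑ j ∈ J, ∑ k ∈ K₂, decay s j k ≤ decayTotal (s / 2) * decayTotal (s / 2) := by
    calc _ ≤ ∑ j ∈ J, ∑ k ∈ K₂, D (b - j) * D (k - b) :=
          Finset.sum_le_sum fun j hj => Finset.sum_le_sum fun k hk => by
            rw [decay_comm, mul_comm]
            exact decay_le_mul hs (m₂ k hk).le (mJ j hj).2
      _ = (∑ j ∈ J, D (b - j)) * ∑ k ∈ K₂, D (k - b) := (Finset.sum_mul_sum _ _ _ _).symm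
      _ ≤ _ := by
          refine mul_le_mul' (sum_comp_le_tsum _ D fun k hk k' hk' h => Subtype.ext ?_)
            (sum_comp_le_tsum _ D fun k hk k' hk' h => Subtype.ext ?_)
          · have := mJ k hk
            have := mJ k' hk'
            omega
          · have := m₂ k hk
            have := m₂ k' hk'
            omega
  calc _ = ∑ j ∈ J, ∑ k ∈ K₁, decay s j k + ∑ j ∈ J, ∑ k ∈ K₂, decay s j k := by
        rw [← Finset.sum_add_distrib]
        exact Finset.sum_congr rfl fun j _ => (Finset.sum_filter_add_sum_filter_not K _ _).symm
    _ ≤ _ := by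
        rw [sq, two_mul]
        exact add_le_add h1 h2

theorem lintegral_boundaryCorrelation_le {Ω : Type*} [MeasurableSpace Ω] {P : Measure Ω}
    {x : Ω → Parameters} (hx : Measurable x)
    (hlaw : ∀ r, P.map (fun ω => translateParameters r (x ω)) = P.map x)
    {C β : ℝ} (hβ : 0 ≤ β)
    (hloc : ∀ (n : ℕ) (j k : Finset.range n),
      ∫⁻ ω, eigencorrelator (Finset.range n) (x ω).1 (x ω).2.1 (x ω).2.2 j k ∂P ≤
        ENNReal.ofReal (C / (1 + |((j : ℕ) : ℝ) - ((k : ℕ) : ℝ)|) ^ β))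
    {n m : ℕ} (d : Decomposition n m) (a b : ℕ) :
    ∫⁻ ω, boundaryCorrelation d (Finset.Icc a b) (x ω).1 (x ω).2.1 (x ω).2.2 ∂P ≤
      ENNReal.ofReal C * (3 * (2 * decayTotal (β / 3 / 2) ^ 2 * (2 * decayTotal (β / 3)) *
        (2 * decayTotal (β / 3)))) := by
  have hcut : ∀ (n : ℕ) (j k : Finset.range n),
      ∫⁻ ω, cutCorrelator (Finset.range n) (x ω).1 (x ω).2.1 (x ω).2.2 j k ∂P ≤
        ENNReal.ofReal C * decay (β / 3) j k ^ 3 := fun n j k => by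
    rw [← decay_pow_three]
    exact (lintegral_mono fun ω => min_le_right _ _).trans (hloc n j k)
  have hblock : ∀ j k : Finset.range n,
      ∫⁻ ω, blockCorrelator d (x ω).1 (x ω).2.1 (x ω).2.2 j k ∂P ≤
        ENNReal.ofReal C * decay (β / 3) j k ^ 3 := fun j k => by
    rcases blockCorrelator_eq_zero_or d j k with h | ⟨l, hj, hk, h⟩
    · simp [h]
    · simp_rw [h]
      -- Localization is known only on initial intervals; stationarity moves the block there and
      -- preserves distances.
      refine (lintegral_cutCorrelator_Ico hx hlaw _ _ ⟨j, hj⟩ ⟨k, hk⟩).trans_le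
        ((hcut _ _ _).trans (le_of_eq ?_))
      have e1 := icoEquivRange_add _ _ ⟨(j : ℕ), hj⟩
      have e2 := icoEquivRange_add _ _ ⟨(k : ℕ), hk⟩
      simp only at e1 e2
      rw [decay, decay]
      conv_rhs => rw [e1, e2]
      push_cast
      rw [add_sub_add_right_eq_sub]
  have m1 := fun j k => (measurable_cutCorrelator (Finset.range n) j k).comp hx
  have m2 := fun j k => (measurable_blockCorrelator d j k).comp hx
  have mterm : ∀ j k l l' : Finset.range n, Measurable fun ω =>
      cutCorrelator (Finset.range n) (x ω).1 (x ω).2.1 (x ω).2.2 j l *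
        blockCorrelator d (x ω).1 (x ω).2.1 (x ω).2.2 l l' *
          cutCorrelator (Finset.range n) (x ω).1 (x ω).2.1 (x ω).2.2 k l' :=
    fun j k l l' => ((m1 j l).mul (m2 l l')).mul (m1 k l')
  unfold boundaryCorrelation
  rw [lintegral_finsetSum _ fun j _ => Finset.measurable_fun_sum _ fun k _ =>
    Finset.measurable_fun_sum _ fun l _ => Finset.measurable_fun_sum _ fun l' _ => mterm j k l l']
  calc _ ≤ ∑ j ∈ Finset.univ.filter (fun j : Finset.range n => (j : ℕ) ∈ Finset.Icc a b),
        ∑ k ∈ Finset.univ.filter (fun k : Finset.range n => (k : ℕ) ∉ Finset.Icc a b),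
          ∑ l : Finset.range n, ∑ l' : Finset.range n, ENNReal.ofReal C *
            (decay (β / 3) j l * decay (β / 3) l l' * decay (β / 3) k l') := by
        refine Finset.sum_le_sum fun j _ => ?_
        rw [lintegral_finsetSum _ fun k _ => Finset.measurable_fun_sum _ fun l _ =>
          Finset.measurable_fun_sum _ fun l' _ => mterm j k l l']
        refine Finset.sum_le_sum fun k _ => ?_
        rw [lintegral_finsetSum _ fun l _ => Finset.measurable_fun_sum _ fun l' _ => mterm j k l l']
        refine Finset.sum_le_sum fun l _ => ?_
        rw [lintegral_finsetSum _ fun l' _ => mterm j k l l']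
        exact Finset.sum_le_sum fun l' _ => lintegral_mul_mul_le
          (fun ω => cutCorrelator_le_one _ _ _ _ _ _) (fun ω => blockCorrelator_le_one _ _ _ _ _ _)
          (fun ω => cutCorrelator_le_one _ _ _ _ _ _) (hcut n j l) (hblock l l') (hcut n k l')
    _ ≤ _ := by
        simp only [← Finset.mul_sum]
        gcongr
        exact sum_boundary_le (fun j : Finset.range n => (j : ℕ) ∈ Finset.Icc a b)
          (g := fun j k => decay (β / 3) j k) (fun j k => decay_comm _ _ _)
          (fun j => sum_decay_le _ j) (sum_decay_boundary_le (by positivity) a b)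

end

end XYChain

/-! ### Conclusion: the uniform bound on the expected entanglement. -/

theorem theorem1p2 {Ω : Type*} [MeasurableSpace Ω] (P : Measure Ω) [IsProbabilityMeasure P]
    (μ γ ν : ℕ → Ω → ℝ)
    (hμ : ∀ j, Measurable (μ j)) (hγ : ∀ j, Measurable (γ j)) (hν : ∀ j, Measurable (ν j))
    (hindep : iIndepFun (Sum.elim μ (Sum.elim γ ν)) P)
    (hidμ : ∀ j, IdentDistrib (μ j) (μ 0) P P)
    (hidγ : ∀ j, IdentDistrib (γ j) (γ 0) P P)
    (hidν : ∀ j, IdentDistrib (ν j) (ν 0) P P)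
    (hbdd : ∃ K : ℝ, ∀ j, ∀ᵐ ω ∂P, |μ j ω| ≤ K ∧ |γ j ω| ≤ K ∧ |ν j ω| ≤ K)
    (hsimple : ∀ n : ℕ, ∀ᵐ ω ∂P, XYChain.HasSimpleSpectrum
      (XYChain.hamiltonian (Finset.range n) (fun i => μ i ω) (fun i => γ i ω) (fun i => ν i ω)))
    (C β : ℝ) (hC : 0 < C) (hβ : 6 < β)
    (hloc : XYChain.EigencorrelatorLocalization P μ γ ν (fun r => C / (1 + r) ^ β)) :
    ∃ C' : ℝ, ∀ (n m : ℕ) (d : XYChain.Decomposition n m) (a b : ℕ), a ≤ b → b < n →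
      AEMeasurable (fun ω => XYChain.supEntanglement d (Finset.Icc a b)
        (fun i => μ i ω) (fun i => γ i ω) (fun i => ν i ω)) P ∧
      ∫⁻ ω, XYChain.supEntanglement d (Finset.Icc a b)
        (fun i => μ i ω) (fun i => γ i ω) (fun i => ν i ω) ∂P ≤ ENNReal.ofReal C' := by
  set x : Ω → XYChain.Parameters :=
    fun ω => (fun i => μ i ω, fun i => γ i ω, fun i => ν i ω) with hxdef
  have hx : Measurable x :=
    (measurable_pi_iff.2 hμ).prodMk ((measurable_pi_iff.2 hγ).prodMk (measurable_pi_iff.2 hν))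
  have hlaw := XYChain.map_translate_eq P hμ hγ hν hindep hidμ hidγ hidν
  set D : ℝ≥0∞ := 32 * (ENNReal.ofReal C * (3 * (2 * XYChain.decayTotal (β / 3 / 2) ^ 2 *
    (2 * XYChain.decayTotal (β / 3)) * (2 * XYChain.decayTotal (β / 3))))) with hD
  have hDtop : D ≠ ⊤ := by
    -- Here β > 6 is used in full: one third is lost to the three factors and another half to the
    -- sum over separated pairs.
    have h1 : XYChain.decayTotal (β / 3 / 2) ≠ ⊤ := XYChain.decayTotal_ne_top (by linarith)
    have h2 : XYChain.decayTotal (β / 3) ≠ ⊤ := XYChain.decayTotal_ne_top (by linarith)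
    finiteness
  refine ⟨D.toReal, fun n m d a b _ hb =>
    ⟨((XYChain.measurable_supEntanglement d).comp hx).aemeasurable, ?_⟩⟩
  rw [ENNReal.ofReal_toReal hDtop]
  have hblocks : ∀ᵐ ω ∂P, ∀ k, XYChain.HasSimpleSpectrum
      (XYChain.hamiltonian (d.block k) (x ω).1 (x ω).2.1 (x ω).2.2) :=
    ae_all_iff.2 fun k => XYChain.ae_hasSimpleSpectrum_Ico hx hlaw hsimple _ _
  calc _ ≤ ∫⁻ ω, 32 * XYChain.boundaryCorrelation d (Finset.Icc a b)
        (x ω).1 (x ω).2.1 (x ω).2.2 ∂P := by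
        refine lintegral_mono_ae ?_
        filter_upwards [hblocks] with ω hω
        exact XYChain.supEntanglement_le d hb hω
    _ = 32 * ∫⁻ ω, XYChain.boundaryCorrelation d (Finset.Icc a b)
        (x ω).1 (x ω).2.1 (x ω).2.2 ∂P := lintegral_const_mul' _ _ ENNReal.ofNat_ne_top
    _ ≤ D := mul_le_mul_right
        (XYChain.lintegral_boundaryCorrelation_le hx hlaw (by linarith) hloc d a b) _
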